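/- Let $P\subseteq(0,\infty)$ be an open interval and let $f\colon P\to\mathbb C$ be smooth ($C^\infty$) such that there is no real constant $c$ with $\rho f_{\rho\rho}=c f_\rho$ on $P$ (that is, $f_\rho\not\equiv0$ and $\rho f_{\rho\rho}/f_\rho$ is not a real constant). Consider the equations $$i\psi_t+\psi_{xx}+f(|\psi|)\psi+V(t,x)\psi=0,\qquad (t,x)\in\Omega,\ |\psi|\in P,$$ where $\Omega\subseteq\mathbb R^2$ is a nonempty open set whose projection $I$ to the $t$-axis and whose slices at fixed $t$ are intervals, and $V\colon\Omega\to\mathbb C$ is smooth. Let $A_f(V)$ be the maximal Lie invariance algebra of the equation: the space of all smooth real vector fields $\xi^t\partial_t+\xi^x\partial_x+\eta\partial_\psi+\eta^*\partial_{\psi^*}$, with coefficients depending on $(t,x,\psi)$, $(t,x)\in\Omega$, $|\psi|\in P$, that satisfy the infinitesimal invariance criterion. Let $A_f^\cap$ be the intersection of the algebras $A_f(V)$ over all smooth potentials $V$ on $\Omega$. Put $M=i(\psi\partial_\psi-\psi^*\partial_{\psi^*})$ and $G(\chi)=\chi\partial_x+\frac12\chi_t x M$ for $\chi=\chi(t)$.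 For $a\in\mathbb R\setminus\{0\}$ and $z\in\mathbb C$ let $\hat z=z$ if $a>0$ and $\hat z=z^*$ if $a<0$. Call $V$ on $\Omega$ \emph{equivalent} to a smooth potential $\tilde V$ on $\tilde\Omega$ if, for some $a\ne0$, $b\in\mathbb R$, $\varepsilon=\pm1$ and smooth real functions $X,\Psi$ on $I$, the point transformation $$\tilde t=at+b,\quad \tilde x=\varepsilon|a|^{1/2}x+X(t),\quad \tilde\psi=\hat\psi\exp\Bigl(\tfrac i2\tfrac{\varepsilon\,\mathrm{sign}(a)X_t}{|a|^{1/2}}x+i\Psi(t)\Bigr)$$ maps $\Omega$ onto $\tilde\Omega$ and the equation with $(f,V)$ to the equation with $(\hat f/|a|,\tilde V)$; so $f$ is regarded as determined up to a positive multiplier and complex conjugation. Call $V$ \emph{strictly equivalent} to $\tilde V$ if this is possible with $a=1$, or with $a=-1$ in case $f$ is real-valued (so that $f$ itself is preserved; this is the group $G^\sim_f$). Consider the following potentials: 1. $V$ with $V_t=0$ (that is, $V=V(x)$) which is not equivalent to any potential of Cases 3, 4, 5; 2. $V=v(t)x^2+iw(t)$ with smooth real functions $v,w$ on $I$, $(v_t,w_t)\not\equiv(0,0)$;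 3. $V=0$ or $V=i$; 4. $V=x^2+i\nu$, $\nu\in\mathbb R$; 5. $V=-x^2+i\nu$, $\nu\in\mathbb R$. Then the following holds. (i) $A_f^\cap=\langle M\rangle$. (ii) $A_f(V)\ne A_f^\cap$ if and only if $V$ is strictly equivalent to a potential of Case 1 or 2, or equivalent to a potential of Case 3, 4 or 5. (iii) In Cases 1–5 a basis of $A_f(V)$ is formed, respectively, by $M,\partial_t$; by $M,G(\chi^1),G(\chi^2)$, where $\chi^1,\chi^2$ is any fundamental system of solutions on $I$ of $\chi_{tt}=4v\chi$ (and such a system exists); by $M,\partial_t,G(1),G(t)$; by $M,\partial_t,G(e^{-2t}),G(e^{2t})$; by $M,\partial_t,G(\cos2t),G(\sin2t)$. (iv) Potentials of different cases are inequivalent; so are $V=0$ and $V=i$ in Case 3. If $x^2+i\nu$ is equivalent to $x^2+i\nu'$, or $-x^2+i\nu$ to $-x^2+i\nu'$, then $\nu'=\pm\nu$; if they are strictly equivalent and $f$ is not real-valued, then $\nu'=\nu$. -/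

import Mathlib

open Set Filter Topology
open scoped ContDiff

noncomputable section

namespace NLS

/-- The space of the variables `(t, x, ψ)`; the variable `ψ*` is the complex conjugate of `ψ`. -/
abbrev Space : Type := ℝ × ℝ × ℂ

/-- Partial derivative with respect to `t` of a function of `(t, x)`. -/
def dt (u : ℝ × ℝ → ℂ) (p : ℝ × ℝ) : ℂ := fderiv ℝ u p (1, 0)

/-- Partial derivative with respect to `x` of a function of `(t, x)`. -/
def dx (u : ℝ × ℝ → ℂ) (p : ℝ × ℝ) : ℂ := fderiv ℝ u p (0, 1)

/-- The left-hand side `i ψ_t + ψ_xx + f(|ψ|) ψ + V(t,x) ψ`, evaluated on `ψ = u` at `p`. -/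
def nls (f : ℝ → ℂ) (V : ℝ × ℝ → ℂ) (u : ℝ × ℝ → ℂ) (p : ℝ × ℝ) : ℂ :=
  Complex.I * dt u p + dx (dx u) p + f ‖u p‖ * u p + V p * u p

/-- The admitted domains of the independent variables: nonempty open sets whose set of times is an
interval and whose slices at fixed times are intervals (all convex open sets, and all sets
`I × J` with open intervals `I` and `J`, among them). -/
def IsTXDomain (Ω : Set (ℝ × ℝ)) : Prop :=
  IsOpen Ω ∧ Ω.Nonempty ∧ (Prod.fst '' Ω).OrdConnected ∧
    ∀ t : ℝ, {x : ℝ | (t, x) ∈ Ω}.OrdConnected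

/-- The set of times of a domain. -/
def times (Ω : Set (ℝ × ℝ)) : Set ℝ := Prod.fst '' Ω

/-- The part of the space `(t, x, ψ)` on which the equation is considered: `(t, x) ∈ Ω` and
`|ψ| ∈ P`, where `P` is the domain of the nonlinearity. -/
def phaseDomain (Ω : Set (ℝ × ℝ)) (P : Set ℝ) : Set Space :=
  {z | (z.1, z.2.1) ∈ Ω ∧ ‖z.2.2‖ ∈ P}

/-! ### Lie invariance algebras

A vector field `ξᵗ ∂_t + ξˣ ∂_x + η ∂_ψ + η* ∂_{ψ*}` is a function `Q = (ξᵗ, ξˣ, η)` on the space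
of `(t, x, ψ)`. -/

/-- The characteristic `η - ξᵗ ψ_t - ξˣ ψ_x` of the vector field `Q`, evaluated on `ψ = u`. -/
def characteristic (Q : Space → Space) (u : ℝ × ℝ → ℂ) (p : ℝ × ℝ) : ℂ :=
  (Q (p.1, p.2, u p)).2.2 - ((Q (p.1, p.2, u p)).1 : ℂ) * dt u p
    - ((Q (p.1, p.2, u p)).2.1 : ℂ) * dx u p

/-- The coefficient of `∂_{ψ_t}` in the prolongation of `Q`, evaluated on `ψ = u`. -/
def prolongT (Q : Space → Space) (u : ℝ × ℝ → ℂ) (p : ℝ × ℝ) : ℂ :=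
  dt (characteristic Q u) p + ((Q (p.1, p.2, u p)).1 : ℂ) * dt (dt u) p
    + ((Q (p.1, p.2, u p)).2.1 : ℂ) * dx (dt u) p

/-- The coefficient of `∂_{ψ_xx}` in the prolongation of `Q`, evaluated on `ψ = u`. -/
def prolongXX (Q : Space → Space) (u : ℝ × ℝ → ℂ) (p : ℝ × ℝ) : ℂ :=
  dx (dx (characteristic Q u)) p + ((Q (p.1, p.2, u p)).1 : ℂ) * dt (dx (dx u)) p
    + ((Q (p.1, p.2, u p)).2.1 : ℂ) * dx (dx (dx u)) p

/-- The derivative-free part `f(|ψ|) ψ + V(t,x) ψ` of the equation as a function of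
`(t, x, ψ)`. -/
def lowerPart (f : ℝ → ℂ) (V : ℝ × ℝ → ℂ) (z : Space) : ℂ :=
  f ‖z.2.2‖ * z.2.2 + V (z.1, z.2.1) * z.2.2

/-- The result of applying the second prolongation of `Q` to the left-hand side of the equation,
evaluated on `ψ = u`. -/
def prolongedAction (f : ℝ → ℂ) (V : ℝ × ℝ → ℂ) (Q : Space → Space) (u : ℝ × ℝ → ℂ)
    (p : ℝ × ℝ) : ℂ :=
  Complex.I * prolongT Q u p + prolongXX Q u p
    + fderiv ℝ (lowerPart f V) (p.1, p.2, u p) (Q (p.1, p.2, u p))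

/-- The infinitesimal invariance criterion: the second prolongation of `Q` annuls the left-hand
side of the equation on the manifold that the equation determines in the second jet space
(the points of the jet space are the jets of smooth functions `u`). -/
def IsInvariant (f : ℝ → ℂ) (P : Set ℝ) (V : ℝ × ℝ → ℂ) (Ω : Set (ℝ × ℝ))
    (Q : Space → Space) : Prop :=
  ∀ u : ℝ × ℝ → ℂ, ContDiff ℝ ∞ u → ∀ p ∈ Ω, ‖u p‖ ∈ P →
    nls f V u p = 0 → prolongedAction f V Q u p = 0

/-- The maximal Lie invariance algebra `A_f(V)` of the equation on `Ω`: the smooth vector fields on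
the domain of the equation that satisfy the infinitesimal invariance criterion. -/
def lieAlgebra (f : ℝ → ℂ) (P : Set ℝ) (Ω : Set (ℝ × ℝ)) (V : ℝ × ℝ → ℂ) :
    Set (phaseDomain Ω P → Space) :=
  {R | ∃ Q : Space → Space, ContDiffOn ℝ ∞ Q (phaseDomain Ω P) ∧
    (phaseDomain Ω P).domRestrict Q = R ∧ IsInvariant f P V Ω Q}

/-- The common part of the algebras `A_f(V)` for all smooth potentials `V` on `Ω`. -/
def kernelAlgebra (f : ℝ → ℂ) (P : Set ℝ) (Ω : Set (ℝ × ℝ)) :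
    Set (phaseDomain Ω P → Space) :=
  ⋂ V ∈ {V : ℝ × ℝ → ℂ | ContDiffOn ℝ ∞ V Ω}, lieAlgebra f P Ω V

/-- The restrictions to `U` of the vector fields `b 0, …, b (n-1)` form a basis of the real vector
space `S` of vector fields on `U`. -/
def IsBasisOf {U : Set Space} {n : ℕ} (b : Fin n → Space → Space) (S : Set (U → Space)) : Prop :=
  LinearIndependent ℝ (fun i => U.domRestrict (b i)) ∧
    S = (Submodule.span ℝ (Set.range fun i => U.domRestrict (b i)) : Set (U → Space))

/-- `M = i(ψ ∂_ψ - ψ* ∂_{ψ*})`. -/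
def fieldM : Space → Space := fun z => (0, 0, Complex.I * z.2.2)

/-- `∂_t`. -/
def fieldDt : Space → Space := fun _ => (1, 0, 0)

/-- `G(χ) = χ ∂_x + (1/2) χ_t x M`. -/
def fieldG (χ : ℝ → ℝ) : Space → Space := fun z =>
  (0, χ z.1, ((deriv χ z.1 * z.2.1 / 2 : ℝ) : ℂ) * (Complex.I * z.2.2))

/-! ### Equivalence transformations -/

/-- `z` if `a > 0`, and the conjugate of `z` otherwise. -/
def hat (a : ℝ) (z : ℂ) : ℂ := if 0 < a then z else (starRingEnd ℂ) z

/-- Parameters of an equivalence transformation; `T(t) = a t + b`. -/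
structure Transf where
  a : ℝ
  b : ℝ
  ε : ℝ
  X : ℝ → ℝ
  Ψ : ℝ → ℝ

namespace Transf

/-- The parameters are admitted over the set of times `I`. -/
def IsAdmitted (g : Transf) (I : Set ℝ) : Prop :=
  g.a ≠ 0 ∧ (g.ε = 1 ∨ g.ε = -1) ∧ ContDiffOn ℝ ∞ g.X I ∧ ContDiffOn ℝ ∞ g.Ψ I

/-- The transformation of the independent variables:
`t' = a t + b`, `x' = ε |a|^{1/2} x + X(t)`. -/
def base (g : Transf) (p : ℝ × ℝ) : ℝ × ℝ :=
  (g.a * p.1 + g.b, g.ε * √|g.a| * p.2 + g.X p.1)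

/-- The transformed value of the dependent variable, with `ε' = sign a`:
`ψ' = hat ψ · exp(i ((1/2) ε ε' |a|^{-1/2} X_t x + Ψ(t)))`. -/
def fibre (g : Transf) (p : ℝ × ℝ) (ψ : ℂ) : ℂ :=
  hat g.a ψ * Complex.exp (Complex.I *
    ((g.ε * SignType.sign g.a / (2 * √|g.a|) * deriv g.X p.1 * p.2 + g.Ψ p.1 : ℝ) : ℂ))

/-- The transformed nonlinearity `hat f / |a|`. -/
def actF (g : Transf) (f : ℝ → ℂ) : ℝ → ℂ := fun ρ => hat g.a (f ρ) / (|g.a| : ℝ)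

/-- The transformation maps the manifold of the equation with `(f, V)` in the second jet space to
that of the equation with `(f', V')`: whenever the graph of `u` is mapped near `p` into the graph
of `u'`, the function `u` satisfies the first equation at `p` if and only if `u'` satisfies the
second one at the image of `p`. -/
def MapsEquation (g : Transf) (P : Set ℝ) (Ω : Set (ℝ × ℝ)) (f : ℝ → ℂ) (V : ℝ × ℝ → ℂ)
    (f' : ℝ → ℂ) (V' : ℝ × ℝ → ℂ) : Prop :=
  ∀ u u' : ℝ × ℝ → ℂ, ∀ p ∈ Ω, ‖u p‖ ∈ P →
    ContDiffAt ℝ ∞ u p → ContDiffAt ℝ ∞ u' (g.base p) →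
    (∀ᶠ q in 𝓝 p, u' (g.base q) = g.fibre q (u q)) →
    (nls f V u p = 0 ↔ nls f' V' u' (g.base p) = 0)

/-- `g` transforms the equation with nonlinearity `f` and potential `V` on `Ω` into the equation
with nonlinearity `hat f / |a|` and (smooth) potential `V'` on `Ω'`. -/
def Carries (g : Transf) (f : ℝ → ℂ) (P : Set ℝ) (Ω : Set (ℝ × ℝ)) (V : ℝ × ℝ → ℂ)
    (Ω' : Set (ℝ × ℝ)) (V' : ℝ × ℝ → ℂ) : Prop :=
  g.IsAdmitted (times Ω) ∧ Ω' = g.base '' Ω ∧ ContDiffOn ℝ ∞ V' Ω' ∧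
    g.MapsEquation P Ω f V (g.actF f) V'

end Transf

/-- Equivalence of potentials, `f` being determined up to a positive multiplier and complex
conjugation. -/
def PotEquiv (f : ℝ → ℂ) (P : Set ℝ) (Ω : Set (ℝ × ℝ)) (V : ℝ × ℝ → ℂ)
    (Ω' : Set (ℝ × ℝ)) (V' : ℝ × ℝ → ℂ) : Prop :=
  ∃ g : Transf, g.Carries f P Ω V Ω' V'

/-- Equivalence of potentials under the transformations that preserve `f`: those with `T_t = 1`,
and with `T_t = ±1` if `f` is real-valued. -/
def StrictPotEquiv (f : ℝ → ℂ) (P : Set ℝ) (Ω : Set (ℝ × ℝ)) (V : ℝ × ℝ → ℂ)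
    (Ω' : Set (ℝ × ℝ)) (V' : ℝ × ℝ → ℂ) : Prop :=
  ∃ g : Transf, (g.a = 1 ∨ (g.a = -1 ∧ ∀ ρ ∈ P, (f ρ).im = 0)) ∧ g.Carries f P Ω V Ω' V'

/-! ### The list of potentials -/

/-- `V = v(t) x² + i w(t)` on `Ω`, with real-valued smooth `v`, `w` and `(v_t, w_t) ≢ (0, 0)`. -/
def IsQuadratic (v w : ℝ → ℝ) (Ω : Set (ℝ × ℝ)) (V : ℝ × ℝ → ℂ) : Prop :=
  ContDiffOn ℝ ∞ v (times Ω) ∧ ContDiffOn ℝ ∞ w (times Ω) ∧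
    (∃ t ∈ times Ω, deriv v t ≠ 0 ∨ deriv w t ≠ 0) ∧
    ∀ p ∈ Ω, V p = ((v p.1 * p.2 ^ 2 : ℝ) : ℂ) + Complex.I * (w p.1 : ℂ)

/-- Case 2. -/
def Case2 (Ω : Set (ℝ × ℝ)) (V : ℝ × ℝ → ℂ) : Prop :=
  ∃ v w : ℝ → ℝ, IsQuadratic v w Ω V

/-- Case 3: `V = 0` or `V = i`. -/
def Case3 (Ω : Set (ℝ × ℝ)) (V : ℝ × ℝ → ℂ) : Prop :=
  (∀ p ∈ Ω, V p = 0) ∨ (∀ p ∈ Ω, V p = Complex.I)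

/-- `V = s x² + i ν` on `Ω`. -/
def IsOscillator (s ν : ℝ) (Ω : Set (ℝ × ℝ)) (V : ℝ × ℝ → ℂ) : Prop :=
  ∀ p ∈ Ω, V p = ((s * p.2 ^ 2 : ℝ) : ℂ) + Complex.I * (ν : ℂ)

/-- Case 4: `V = x² + i ν` with a real constant `ν`. -/
def Case4 (Ω : Set (ℝ × ℝ)) (V : ℝ × ℝ → ℂ) : Prop := ∃ ν : ℝ, IsOscillator 1 ν Ω V

/-- Case 5: `V = -x² + i ν` with a real constant `ν`. -/
def Case5 (Ω : Set (ℝ × ℝ)) (V : ℝ × ℝ → ℂ) : Prop := ∃ ν : ℝ, IsOscillator (-1) ν Ω V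

/-- Case 1: the potential does not depend on `t` (if the sets of `t` with `(t, x) ∈ Ω` are
intervals, this is `V = V(x)`), and is not equivalent to one of the more special potentials of
Cases 3, 4 and 5. -/
def Case1 (f : ℝ → ℂ) (P : Set ℝ) (Ω : Set (ℝ × ℝ)) (V : ℝ × ℝ → ℂ) : Prop :=
  (∀ p ∈ Ω, dt V p = 0) ∧
    ∀ (Ω' : Set (ℝ × ℝ)) (V' : ℝ × ℝ → ℂ), PotEquiv f P Ω V Ω' V' →
      ¬ (Case3 Ω' V' ∨ Case4 Ω' V' ∨ Case5 Ω' V')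

/-- The cases of the list, numbered from `0`. -/
def TableCase (f : ℝ → ℂ) (P : Set ℝ) : Fin 5 → Set (ℝ × ℝ) → (ℝ × ℝ → ℂ) → Prop :=
  ![Case1 f P, Case2, Case3, Case4, Case5]

/-- `χ₁, χ₂` form a fundamental system of solutions of `χ_tt = 4 v χ` on `I`. -/
def IsFundamentalSystem (v : ℝ → ℝ) (I : Set ℝ) (χ₁ χ₂ : ℝ → ℝ) : Prop :=
  ContDiffOn ℝ ∞ χ₁ I ∧ ContDiffOn ℝ ∞ χ₂ I ∧
    (∀ t ∈ I, deriv (deriv χ₁) t = 4 * v t * χ₁ t) ∧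
    (∀ t ∈ I, deriv (deriv χ₂) t = 4 * v t * χ₂ t) ∧
    ∀ c₁ c₂ : ℝ, (∀ t ∈ I, c₁ * χ₁ t + c₂ * χ₂ t = 0) → c₁ = 0 ∧ c₂ = 0

end NLS

end

/-! The invariance criterion is an identity on jets. The polynomials `jetPoly` realize every jet
that matters, so once one derivative is eliminated by the equation the others are free and the
criterion splits (`IsInvariant.jet_equation`). The free ψ_tx forces ξᵗ to depend on t alone. The
free ψ_t forces ξˣ to be independent of ψ, ξᵗ_t = 2ξˣ_x, and η to be complex-affine in ψ, say η = Aψ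
+ B. The free ψ_x gives 2A_x = iξˣ_t (`IsInvariant.tau_eq`, `IsInvariant.first_order`,
`IsInvariant.second_order`).

What remains is an identity in ψ. Varying the direction of ψ yields B = 0 and a relation c₀ + k f +
r ρ f_ρ = 0 with real k = ξᵗ_t and r = Re A. Differentiating it shows that the hypothesis on f is
what forces k = r = 0 (`coeffs_eq_zero`, `split_fibre`). Hence the invariance fields are exactly
τ∂_t + G(χ) + σM with constant τ and real functions χ, σ of t such that τV_t + χV_x = χ_tt x/2 + σ_t
(`IsInvariant.exists_symField`, `IsSymmetry.isInvariant`). The right-hand side is real, so the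
potentials it and ix leave only M in the common part.

Suppose V admits a further field. If τ ≠ 0, a shift x + X(t) with X_t = -χ/τ straightens the field
and makes V independent of t. If τ = 0, then V_x is affine in x with real coefficients wherever χ ≠
0. Locally χ solves a linear second-order equation, so it cannot vanish on a subinterval, and V is
quadratic in x everywhere. A shift with X_tt = 4vX - 2b and a choice of phase reduce V to v x² + iw.
If v and w are constant, scaling of t leads to 0, i or ±x² + iν.

A transformation carries (f, V) to V' exactly if |a| V'∘base = hat V + a real function affine in x
(`Transf.nls_transform`, `Transf.carries_iff`), whose x-free part can be prescribed through Ψ. Thus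
equivalence is symmetric and transitive, and invariance fields pull back with τ divided by a
(`Transf.Carries.pullback`). Fields with τ ≠ 0 exist for all autonomous potentials but not in Case
2. For potentials s x² + iν a comparison of coefficients gives a² s' = s and |a| ν' = sign(a) ν
(`Transf.Carries.isOscillator`), which settles the remaining inequivalences. Case 1 is separated
from Cases 3, 4, 5 by its definition together with symmetry. -/

noncomputable section

namespace NLS

/-! ### Functions of one real variable -/

section Line

variable {E : Type*} [NormedAddCommGroup E] [NormedSpace ℝ E]

/-- Coefficients that are continuous on `I` may be unbounded there. A compact interval around both
points gives the bounds for existence and uniqueness of solutions. -/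
theorem exists_Icc_subset {I : Set ℝ} (ho : IsOpen I) (hc : I.OrdConnected) {s t : ℝ}
    (hs : s ∈ I) (ht : t ∈ I) :
    ∃ c d, s ∈ Ioo c d ∧ t ∈ Ioo c d ∧ Icc c d ⊆ I := by
  have key : ∀ r ∈ I, ∃ c d, c < r ∧ r < d ∧ c ∈ I ∧ d ∈ I := by
    intro r hr
    obtain ⟨ε, hε, hb⟩ := Metric.isOpen_iff.1 ho r hr
    refine ⟨r - ε / 2, r + ε / 2, by linarith, by linarith, hb ?_, hb ?_⟩ <;>
      rw [Metric.mem_ball, Real.dist_eq, abs_lt] <;> constructor <;> linarith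
  obtain ⟨c₁, d₁, h₁, h₂, h₃, h₄⟩ := key s hs
  obtain ⟨c₂, d₂, g₁, g₂, g₃, g₄⟩ := key t ht
  refine ⟨min c₁ c₂, max d₁ d₂, ⟨by simp [h₁], by simp [h₂]⟩, ⟨by simp [g₁], by simp [g₂]⟩,
    hc.out ?_ ?_⟩
  · rcases min_choice c₁ c₂ with h | h <;> rw [h] <;> assumption
  · rcases max_choice d₁ d₂ with h | h <;> rw [h] <;> assumption

theorem contDiffOn_of_hasDerivAt {I : Set ℝ} (ho : IsOpen I) {g g' : ℝ → E}
    (h : ∀ t ∈ I, HasDerivAt g (g' t) t) {n : ℕ} (hg' : ContDiffOn ℝ n g' I) :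
    ContDiffOn ℝ (n + 1) g I := by
  rw [contDiffOn_succ_iff_derivWithin ho.uniqueDiffOn]
  refine ⟨fun t ht => (h t ht).differentiableAt.differentiableWithinAt, by simp, ?_⟩
  refine hg'.congr fun t ht => ?_
  rw [derivWithin_of_isOpen ho ht, (h t ht).deriv]

theorem contDiffOn_infty_of_hasDerivAt {I : Set ℝ} (ho : IsOpen I) {g g' : ℝ → E}
    (h : ∀ t ∈ I, HasDerivAt g (g' t) t) (hg' : ContDiffOn ℝ ∞ g' I) :
    ContDiffOn ℝ ∞ g I := by
  rw [contDiffOn_infty]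
  intro n
  exact (contDiffOn_of_hasDerivAt ho h (n := n)
    (hg'.of_le (by exact_mod_cast le_top))).of_le (by exact_mod_cast Nat.le_succ n)

theorem contDiffOn_deriv {I : Set ℝ} (ho : IsOpen I) {g : ℝ → E} (hg : ContDiffOn ℝ ∞ g I) :
    ContDiffOn ℝ ∞ (deriv g) I := by
  have h := (contDiffOn_infty_iff_derivWithin ho.uniqueDiffOn).1 hg
  exact h.2.congr fun t ht => (derivWithin_of_isOpen ho ht).symm

theorem hasDerivAt_of_contDiffOn {I : Set ℝ} (ho : IsOpen I) {g : ℝ → E}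
    (hg : ContDiffOn ℝ ∞ g I) {t : ℝ} (ht : t ∈ I) : HasDerivAt g (deriv g t) t :=
  ((hg.contDiffAt (ho.mem_nhds ht)).differentiableAt (by simp)).hasDerivAt

theorem hasDerivAt_integral [CompleteSpace E] {I : Set ℝ} (ho : IsOpen I) (hc : I.OrdConnected)
    {g : ℝ → E} (hg : ContinuousOn g I) {t₀ t : ℝ} (h₀ : t₀ ∈ I) (ht : t ∈ I) :
    HasDerivAt (fun r => ∫ s in t₀..r, g s) (g t) t := by
  have hsub : uIcc t₀ t ⊆ I := hc.uIcc_subset h₀ ht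
  refine intervalIntegral.integral_hasDerivAt_right (hg.mono hsub).intervalIntegrable ?_
    (hg.continuousAt (ho.mem_nhds ht))
  exact hg.stronglyMeasurableAtFilter ho t ht

theorem exists_primitive {I : Set ℝ} (ho : IsOpen I) (hc : I.OrdConnected) (hn : I.Nonempty)
    {g : ℝ → ℝ} (hg : ContDiffOn ℝ ∞ g I) :
    ∃ G : ℝ → ℝ, ContDiffOn ℝ ∞ G I ∧ ∀ t ∈ I, HasDerivAt G (g t) t := by
  obtain ⟨t₀, h₀⟩ := hn
  have h := fun t (ht : t ∈ I) => hasDerivAt_integral ho hc hg.continuousOn h₀ ht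
  exact ⟨_, contDiffOn_infty_of_hasDerivAt ho h hg, h⟩

/-- Equality of derivatives on an open interval, in the form that gives a constant. -/
theorem eq_of_deriv_eq_zero {I : Set ℝ} (ho : IsOpen I) (hc : I.OrdConnected) {g : ℝ → E}
    (hg : ∀ t ∈ I, HasDerivAt g 0 t) {s t : ℝ} (hs : s ∈ I) (ht : t ∈ I) : g s = g t := by
  obtain ⟨a, ha⟩ := ho.exists_is_const_of_deriv_eq_zero hc.isPreconnected
    (fun r hr => (hg r hr).differentiableAt.differentiableWithinAt)
    (fun r hr => (hg r hr).deriv)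
  rw [ha s hs, ha t ht]

/-- The terms of the Picard series of the linear equation `y' = A y`, starting from `y₀`. -/
def picardTerm (A : ℝ → E →L[ℝ] E) (t₀ : ℝ) (y₀ : ℝ → E) : ℕ → ℝ → E
  | 0 => y₀
  | n + 1 => fun t => ∫ s in t₀..t, A s (picardTerm A t₀ y₀ n s)

theorem continuousOn_picardTerm [CompleteSpace E] {I : Set ℝ} (ho : IsOpen I)
    (hc : I.OrdConnected) {A : ℝ → E →L[ℝ] E} (hA : ContinuousOn A I) {t₀ : ℝ} (h₀ : t₀ ∈ I)
    {y₀ : ℝ → E} (hy : ContinuousOn y₀ I) (n : ℕ) : ContinuousOn (picardTerm A t₀ y₀ n) I := by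
  induction n with
  | zero => exact hy
  | succ n ih =>
    intro t ht
    exact (hasDerivAt_integral ho hc (hA.clm_apply ih) h₀ ht).continuousAt.continuousWithinAt

/-- Each iteration contributes a factor `M` and one integration of |s - t₀|ⁿ, whence the factorial
that makes the series converge on every compact interval. -/
theorem norm_picardTerm_le {A : ℝ → E →L[ℝ] E} {t₀ : ℝ} {y₀ : ℝ → E} {J : Set ℝ}
    (hJ : J.OrdConnected) (hJ₀ : t₀ ∈ J) {M C : ℝ} (hM : ∀ t ∈ J, ‖A t‖ ≤ M) (hC : ∀ t ∈ J, ‖y₀ t‖ ≤ C) (n : ℕ) :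
    ∀ t ∈ J, ‖picardTerm A t₀ y₀ n t‖ ≤ C * M ^ n * |t - t₀| ^ n / n.factorial := by
  have hM₀ : 0 ≤ M := (norm_nonneg _).trans (hM t₀ hJ₀)
  induction n with
  | zero => intro t ht; simpa [picardTerm] using hC t ht
  | succ n ih =>
    intro t ht
    have hsub : uIoc t₀ t ⊆ J := uIoc_subset_uIcc.trans (hJ.uIcc_subset hJ₀ ht)
    -- Over the unordered interval the cases t < t₀ and t > t₀ are treated at once.
    rw [picardTerm, intervalIntegral.norm_intervalIntegral_eq]
    calc ‖∫ s in uIoc t₀ t, A s (picardTerm A t₀ y₀ n s)‖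
        ≤ ∫ s in uIoc t₀ t, M * C * M ^ n / n.factorial * |s - t₀| ^ n := by
          apply MeasureTheory.norm_integral_le_of_norm_le
            (Continuous.integrableOn_uIoc (by fun_prop))
          apply MeasureTheory.ae_restrict_mem measurableSet_Ioc |>.mono
          intro s hs
          have hs' : s ∈ J := hsub hs
          calc ‖A s (picardTerm A t₀ y₀ n s)‖ ≤ ‖A s‖ * ‖picardTerm A t₀ y₀ n s‖ :=
                (A s).le_opNorm _
            _ ≤ M * (C * M ^ n * |s - t₀| ^ n / n.factorial) :=
                mul_le_mul (hM s hs') (ih s hs') (norm_nonneg _) hM₀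
            _ = _ := by ring
      _ = C * M ^ (n + 1) * |t - t₀| ^ (n + 1) / (n + 1).factorial := by
          rw [MeasureTheory.integral_const_mul, integral_pow_abs_sub_uIoc, Nat.factorial_succ]
          push_cast
          field_simp
          ring

/-- The solution is the sum of the Picard series started at x₀ + ∫b. Linearity makes the series
converge on compact subintervals of any length, so the solution exists on all of `I` and no
continuation argument is needed. -/
theorem exists_linear_ode [CompleteSpace E] {I : Set ℝ} (ho : IsOpen I) (hc : I.OrdConnected)
    {A : ℝ → E →L[ℝ] E} (hA : ContinuousOn A I) {b : ℝ → E} (hb : ContinuousOn b I)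
    {t₀ : ℝ} (h₀ : t₀ ∈ I) (x₀ : E) :
    ∃ y : ℝ → E, y t₀ = x₀ ∧ ∀ t ∈ I, HasDerivAt y (A t (y t) + b t) t := by
  set y₀ : ℝ → E := fun t => x₀ + ∫ s in t₀..t, b s with hy₀
  have hy₀' : ∀ t ∈ I, HasDerivAt y₀ (b t) t := fun t ht =>
    (hasDerivAt_integral ho hc hb h₀ ht).const_add x₀
  have hyc : ContinuousOn y₀ I := fun t ht => (hy₀' t ht).continuousAt.continuousWithinAt
  set Y := picardTerm A t₀ y₀
  have hY : ∀ n, ContinuousOn (Y n) I := continuousOn_picardTerm ho hc hA h₀ hyc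
  have hYd : ∀ n, ∀ t ∈ I, HasDerivAt (Y (n + 1)) (A t (Y n t)) t := fun n t ht =>
    hasDerivAt_integral ho hc (hA.clm_apply (hY n)) h₀ ht
  have hY₀ : ∀ n, Y (n + 1) t₀ = 0 := fun n => by simp [Y, picardTerm]
  refine ⟨fun t => y₀ t + ∑' n, Y (n + 1) t, by simp [hY₀, hy₀], fun t ht => ?_⟩
  obtain ⟨c, d, hs, htt, hcd⟩ := exists_Icc_subset ho hc h₀ ht
  obtain ⟨M, hM⟩ := isCompact_Icc.exists_bound_of_continuousOn (hA.mono hcd)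
  obtain ⟨C, hC⟩ := isCompact_Icc.exists_bound_of_continuousOn (hyc.mono hcd)
  have hM₀ : 0 ≤ M := (norm_nonneg _).trans (hM t₀ (Ioo_subset_Icc_self hs))
  have hC₀ : 0 ≤ C := (norm_nonneg _).trans (hC t₀ (Ioo_subset_Icc_self hs))
  have hbd : ∀ n, ∀ r ∈ Ioo c d, ‖Y n r‖ ≤ C * ((M * (d - c)) ^ n / n.factorial) := by
    intro n r hr
    refine (norm_picardTerm_le ordConnected_Icc (Ioo_subset_Icc_self hs)
      hM hC n r (Ioo_subset_Icc_self hr)).trans ?_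
    rw [mul_pow, mul_div_assoc, mul_assoc, ← mul_div_assoc]
    have : |r - t₀| ≤ d - c := by
      rw [abs_le]; constructor <;> linarith [hr.1, hr.2, hs.1, hs.2]
    gcongr
  have hsum : Summable fun n : ℕ => C * ((M * (d - c)) ^ n / n.factorial) :=
    (Real.summable_pow_div_factorial _).mul_left C
  have hder := hasDerivAt_tsum_of_isPreconnected (hsum.mul_left M) isOpen_Ioo isPreconnected_Ioo
    (fun n r hr => hYd n r (hcd (Ioo_subset_Icc_self hr)))
    (fun n r hr => ((A r).le_opNorm _).trans
      (mul_le_mul (hM r (Ioo_subset_Icc_self hr)) (hbd n r hr) (norm_nonneg _) hM₀))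
    hs (by simp [hY₀]) htt
  have hS : Summable fun n => Y n t := Summable.of_norm_bounded hsum fun n => hbd n t htt
  have := (hy₀' t ht).add hder
  convert! this using 1
  -- The derivatives of the terms with index n + 1 sum to `A t` applied to the full series.
  -- Splitting off its zeroth term returns y₀ plus the tail.
  rw [← (A t).map_tsum hS, hS.tsum_eq_zero_add, add_comm]
  rfl

end Line

/-- Smooth linear second-order equations are solvable on open intervals. -/
theorem exists_second_order {I : Set ℝ} (ho : IsOpen I) (hc : I.OrdConnected) {h k : ℝ → ℝ}
    (hh : ContDiffOn ℝ ∞ h I) (hk : ContDiffOn ℝ ∞ k I) {t₀ : ℝ} (h₀ : t₀ ∈ I) (x₀ x₁ : ℝ) :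
    ∃ X : ℝ → ℝ, ContDiffOn ℝ ∞ X I ∧ X t₀ = x₀ ∧ deriv X t₀ = x₁ ∧
      ∀ t ∈ I, deriv (deriv X) t = h t * X t + k t := by
  set A : ℝ → ℝ × ℝ →L[ℝ] ℝ × ℝ := fun t =>
    (ContinuousLinearMap.snd ℝ ℝ ℝ).prod (h t • ContinuousLinearMap.fst ℝ ℝ ℝ) with hAdef
  have hA : ContinuousOn A I := by
    -- A constant operator plus `h t` times a constant operator depends continuously on t.
    have : A = fun t => (ContinuousLinearMap.snd ℝ ℝ ℝ).prod (0 : ℝ × ℝ →L[ℝ] ℝ) +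
        h t • (0 : ℝ × ℝ →L[ℝ] ℝ).prod (ContinuousLinearMap.fst ℝ ℝ ℝ) := by
      funext t; ext <;> simp [hAdef]
    rw [this]
    exact continuousOn_const.add (hh.continuousOn.smul continuousOn_const)
  obtain ⟨y, hy₀, hy⟩ := exists_linear_ode ho hc hA (b := fun t => (0, k t))
    (continuousOn_const.prodMk hk.continuousOn) h₀ (x₀, x₁)
  have h1 : ∀ t ∈ I, HasDerivAt (fun t => (y t).1) (y t).2 t := by
    intro t ht
    refine ((ContinuousLinearMap.fst ℝ ℝ ℝ).hasFDerivAt.comp_hasDerivAt t (hy t ht)).congr_deriv ?_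
    simp [hAdef]
  have h2 : ∀ t ∈ I, HasDerivAt (fun t => (y t).2) (h t * (y t).1 + k t) t := by
    intro t ht
    refine ((ContinuousLinearMap.snd ℝ ℝ ℝ).hasFDerivAt.comp_hasDerivAt t (hy t ht)).congr_deriv ?_
    simp [hAdef]
  -- Bootstrapping: in the system y₁' = y₂, y₂' = h y₁ + k each component gains one derivative from
  -- the other.
  have hsm : ∀ n : ℕ, ContDiffOn ℝ n (fun t => (y t).1) I ∧ ContDiffOn ℝ n (fun t => (y t).2) I := by
    intro n
    induction n with
    | zero =>
      simp only [CharP.cast_eq_zero, contDiffOn_zero]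
      exact ⟨fun t ht => (h1 t ht).continuousAt.continuousWithinAt,
        fun t ht => (h2 t ht).continuousAt.continuousWithinAt⟩
    | succ n ih =>
      push_cast
      exact ⟨contDiffOn_of_hasDerivAt ho h1 ih.2, contDiffOn_of_hasDerivAt ho h2
        (((hh.of_le (by exact_mod_cast le_top)).mul ih.1).add
          (hk.of_le (by exact_mod_cast le_top)))⟩
  have hd : ∀ t ∈ I, deriv (fun t => (y t).1) t = (y t).2 := fun t ht => (h1 t ht).deriv
  refine ⟨fun t => (y t).1, contDiffOn_infty.2 fun n => (hsm n).1, by simp [hy₀],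
    by simp [hd t₀ h₀, hy₀], fun t ht => ?_⟩
  have : deriv (fun t => (y t).1) =ᶠ[𝓝 t] fun t => (y t).2 := by
    filter_upwards [ho.mem_nhds ht] with s hs using hd s hs
  rw [this.deriv_eq, (h2 t ht).deriv]

/-- A smooth solution of a linear homogeneous equation with zero Cauchy data vanishes. -/
theorem eq_zero_of_second_order {I : Set ℝ} (ho : IsOpen I) (hc : I.OrdConnected) {h χ : ℝ → ℝ}
    (hh : ContinuousOn h I) (hχ : ContDiffOn ℝ ∞ χ I)
    (heq : ∀ t ∈ I, deriv (deriv χ) t = h t * χ t) {t₀ : ℝ} (h₀ : t₀ ∈ I)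
    (hz : χ t₀ = 0) (hz' : deriv χ t₀ = 0) {t : ℝ} (ht : t ∈ I) : χ t = 0 := by
  obtain ⟨c, d, hs, htt, hcd⟩ := exists_Icc_subset ho hc h₀ ht
  obtain ⟨M, hM⟩ := isCompact_Icc.exists_bound_of_continuousOn (hh.mono hcd)
  -- Comparison with the zero solution of the first-order system. In the maximum norm the two
  -- components of the right-hand side have Lipschitz constants 1 and `M`.
  have key := ODE_solution_unique_of_mem_Ioo (a := c) (b := d) (t₀ := t₀)
    (v := fun t (y : ℝ × ℝ) => (y.2, h t * y.1)) (s := fun _ => univ) (K := max 1 M.toNNReal)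
    (f := fun t => (χ t, deriv χ t)) (g := fun _ => 0) ?_ hs ?_ ?_ (by simp [hz, hz'])
  · have := key htt
    simpa using congrArg Prod.fst this
  · intro t ht
    refine LipschitzWith.lipschitzOnWith ?_
    refine LipschitzWith.prodMk LipschitzWith.prod_snd ?_
    refine LipschitzWith.of_dist_le_mul fun x y => ?_
    rw [Real.dist_eq, ← mul_sub, abs_mul]
    have h1 : |h t| ≤ M := hM t (Ioo_subset_Icc_self ht)
    have h2 : |x.1 - y.1| ≤ dist x y := by
      rw [← Real.dist_eq]; exact le_max_left _ _
    rw [Real.coe_toNNReal _ ((abs_nonneg _).trans h1)]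
    exact mul_le_mul h1 h2 (abs_nonneg _) ((abs_nonneg _).trans h1)
  · intro t ht
    have htI := hcd (Ioo_subset_Icc_self ht)
    refine ⟨?_, mem_univ _⟩
    have h2 := hasDerivAt_of_contDiffOn ho (contDiffOn_deriv ho hχ) htI
    rw [heq t htI] at h2
    exact (hasDerivAt_of_contDiffOn ho hχ htI).prodMk h2
  · intro t ht
    refine ⟨?_, mem_univ _⟩
    simpa using! hasDerivAt_const t (0 : ℝ × ℝ)

/-! ### Functions of `(t, x)` -/

section Plane

variable {u v : ℝ × ℝ → ℂ} {p : ℝ × ℝ} {U : Set (ℝ × ℝ)}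

theorem hasDerivAt_slice_t {E : Type*} [NormedAddCommGroup E] [NormedSpace ℝ E]
    {u : ℝ × ℝ → E} (hu : DifferentiableAt ℝ u p) :
    HasDerivAt (fun s => u (s, p.2)) (fderiv ℝ u p (1, 0)) p.1 :=
  HasFDerivAt.comp_hasDerivAt (f := fun s : ℝ => (s, p.2)) p.1 hu.hasFDerivAt
    ((hasDerivAt_id p.1).prodMk (hasDerivAt_const p.1 p.2))

theorem hasDerivAt_slice_x {E : Type*} [NormedAddCommGroup E] [NormedSpace ℝ E]
    {u : ℝ × ℝ → E} (hu : DifferentiableAt ℝ u p) :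
    HasDerivAt (fun y => u (p.1, y)) (fderiv ℝ u p (0, 1)) p.2 :=
  HasFDerivAt.comp_hasDerivAt (f := fun y : ℝ => (p.1, y)) p.2 hu.hasFDerivAt
    ((hasDerivAt_const p.2 p.1).prodMk (hasDerivAt_id p.2))

theorem dt_eq {d : ℂ} (hu : DifferentiableAt ℝ u p)
    (h : HasDerivAt (fun s => u (s, p.2)) d p.1) : dt u p = d :=
  (hasDerivAt_slice_t hu).unique h

theorem dx_eq {d : ℂ} (hu : DifferentiableAt ℝ u p)
    (h : HasDerivAt (fun y => u (p.1, y)) d p.2) : dx u p = d :=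
  (hasDerivAt_slice_x hu).unique h

theorem dt_congr (h : u =ᶠ[𝓝 p] v) : dt u p = dt v p := by
  rw [dt, dt, h.fderiv_eq]

theorem dx_congr (h : u =ᶠ[𝓝 p] v) : dx u p = dx v p := by
  rw [dx, dx, h.fderiv_eq]

theorem dx_eventuallyEq (h : u =ᶠ[𝓝 p] v) : dx u =ᶠ[𝓝 p] dx v := by
  filter_upwards [h.eventuallyEq_nhds] with q hq using dx_congr hq

theorem dx_add (hu : DifferentiableAt ℝ u p) (hv : DifferentiableAt ℝ v p) :
    dx (fun q => u q + v q) p = dx u p + dx v p := by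
  simp [dx, fderiv_fun_add hu hv]

theorem dt_sub (hu : DifferentiableAt ℝ u p) (hv : DifferentiableAt ℝ v p) :
    dt (fun q => u q - v q) p = dt u p - dt v p := by
  simp [dt, fderiv_fun_sub hu hv]

theorem dx_sub (hu : DifferentiableAt ℝ u p) (hv : DifferentiableAt ℝ v p) :
    dx (fun q => u q - v q) p = dx u p - dx v p := by
  simp [dx, fderiv_fun_sub hu hv]

theorem dt_mul (hu : DifferentiableAt ℝ u p) (hv : DifferentiableAt ℝ v p) :
    dt (fun q => u q * v q) p = dt u p * v p + u p * dt v p := by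
  simp [dt, fderiv_fun_mul hu hv]; ring

theorem dx_mul (hu : DifferentiableAt ℝ u p) (hv : DifferentiableAt ℝ v p) :
    dx (fun q => u q * v q) p = dx u p * v p + u p * dx v p := by
  simp [dx, fderiv_fun_mul hu hv]; ring

theorem contDiffOn_fderiv_apply {E F : Type*} [NormedAddCommGroup E] [NormedSpace ℝ E]
    [NormedAddCommGroup F] [NormedSpace ℝ F] {S : Set E} {g : E → F} (hS : IsOpen S)
    (hg : ContDiffOn ℝ ∞ g S) (w : E) : ContDiffOn ℝ ∞ (fun z => fderiv ℝ g z w) S :=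
  (hg.fderiv_of_isOpen hS (m := ∞) (by simp)).clm_apply contDiffOn_const

theorem contDiffOn_dt (hU : IsOpen U) (hu : ContDiffOn ℝ ∞ u U) : ContDiffOn ℝ ∞ (dt u) U :=
  contDiffOn_fderiv_apply hU hu _

theorem contDiffOn_dx (hU : IsOpen U) (hu : ContDiffOn ℝ ∞ u U) : ContDiffOn ℝ ∞ (dx u) U :=
  contDiffOn_fderiv_apply hU hu _

theorem differentiableAt_of_contDiffOn {E F : Type*} [NormedAddCommGroup E] [NormedSpace ℝ E]
    [NormedAddCommGroup F] [NormedSpace ℝ F] {S : Set E} {g : E → F} (hS : IsOpen S)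
    (hg : ContDiffOn ℝ ∞ g S) {z : E} (hz : z ∈ S) : DifferentiableAt ℝ g z :=
  (hg.contDiffAt (hS.mem_nhds hz)).differentiableAt (by simp)

theorem fderiv_fderiv_apply {E F : Type*} [NormedAddCommGroup E] [NormedSpace ℝ E]
    [NormedAddCommGroup F] [NormedSpace ℝ F] {S : Set E} {g : E → F} (hS : IsOpen S)
    (hg : ContDiffOn ℝ ∞ g S) {z : E} (hz : z ∈ S) (v w : E) :
    fderiv ℝ (fun y => fderiv ℝ g y w) z v = fderiv ℝ (fderiv ℝ g) z v w := by
  have h := differentiableAt_of_contDiffOn hS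
    (hg.fderiv_of_isOpen hS (m := ∞) (by simp)) hz
  rw [fderiv_clm_apply h (differentiableAt_const w)]
  simp

theorem fderiv_fderiv_symm {E F : Type*} [NormedAddCommGroup E] [NormedSpace ℝ E]
    [NormedAddCommGroup F] [NormedSpace ℝ F] {S : Set E} {g : E → F} (hS : IsOpen S)
    (hg : ContDiffOn ℝ ∞ g S) {z : E} (hz : z ∈ S) (v w : E) :
    fderiv ℝ (fderiv ℝ g) z v w = fderiv ℝ (fderiv ℝ g) z w v :=
  (hg.contDiffAt (hS.mem_nhds hz)).isSymmSndFDerivAt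
    (by simpa using (ENat.LEInfty.out : (2 : ℕ∞ω) ≤ ∞)) v w

theorem dt_dx (hU : IsOpen U) (hu : ContDiffOn ℝ ∞ u U) (hp : p ∈ U) :
    dt (dx u) p = dx (dt u) p := by
  change fderiv ℝ (fun q => fderiv ℝ u q (0, 1)) p (1, 0) =
    fderiv ℝ (fun q => fderiv ℝ u q (1, 0)) p (0, 1)
  rw [fderiv_fderiv_apply hU hu hp, fderiv_fderiv_apply hU hu hp, fderiv_fderiv_symm hU hu hp]

theorem eventuallyEq_of_eqOn (hU : IsOpen U) {F : Type*} {g h : ℝ × ℝ → F}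
    (hgh : ∀ q ∈ U, g q = h q) (hp : p ∈ U) : g =ᶠ[𝓝 p] h := by
  filter_upwards [hU.mem_nhds hp] with q hq using hgh q hq

/-- The prolongation formula for `ψ_t`. -/
theorem dt_characteristic {H T X : ℝ × ℝ → ℂ} (hU : IsOpen U) (hu : ContDiffOn ℝ ∞ u U)
    (hH : ContDiffOn ℝ ∞ H U) (hT : ContDiffOn ℝ ∞ T U) (hX : ContDiffOn ℝ ∞ X U) (hp : p ∈ U) :
    dt (fun q => H q - T q * dt u q - X q * dx u q) p + T p * dt (dt u) p + X p * dx (dt u) p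
      = dt H p - dt T p * dt u p - dt X p * dx u p := by
  have d {g : ℝ × ℝ → ℂ} (hg : ContDiffOn ℝ ∞ g U) := differentiableAt_of_contDiffOn hU hg hp
  have ht := contDiffOn_dt hU hu
  have hx := contDiffOn_dx hU hu
  rw [dt_sub (d (hH.sub (hT.mul ht))) (d (hX.mul hx)), dt_sub (d hH) (d (hT.mul ht)),
    dt_mul (d hT) (d ht), dt_mul (d hX) (d hx), dt_dx hU hu hp]
  ring

theorem dx_dx_mul {g h : ℝ × ℝ → ℂ} (hU : IsOpen U) (hg : ContDiffOn ℝ ∞ g U)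
    (hh : ContDiffOn ℝ ∞ h U) (hp : p ∈ U) :
    dx (dx fun q => g q * h q) p
      = dx (dx g) p * h p + 2 * dx g p * dx h p + g p * dx (dx h) p := by
  have d {g : ℝ × ℝ → ℂ} (hg : ContDiffOn ℝ ∞ g U) {q} (hq : q ∈ U) :=
    differentiableAt_of_contDiffOn hU hg hq
  have hg' := contDiffOn_dx hU hg
  have hh' := contDiffOn_dx hU hh
  rw [dx_congr (eventuallyEq_of_eqOn hU (fun q hq => dx_mul (d hg hq) (d hh hq)) hp),
    dx_add (d (hg'.mul hh) hp) (d (hg.mul hh') hp), dx_mul (d hg' hp) (d hh hp),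
    dx_mul (d hg hp) (d hh' hp)]
  ring

theorem dx_dx_sub {g h : ℝ × ℝ → ℂ} (hU : IsOpen U) (hg : ContDiffOn ℝ ∞ g U)
    (hh : ContDiffOn ℝ ∞ h U) (hp : p ∈ U) :
    dx (dx fun q => g q - h q) p = dx (dx g) p - dx (dx h) p := by
  have d {g : ℝ × ℝ → ℂ} (hg : ContDiffOn ℝ ∞ g U) {q} (hq : q ∈ U) :=
    differentiableAt_of_contDiffOn hU hg hq
  rw [dx_congr (eventuallyEq_of_eqOn hU (fun q hq => dx_sub (d hg hq) (d hh hq)) hp),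
    dx_sub (d (contDiffOn_dx hU hg) hp) (d (contDiffOn_dx hU hh) hp)]

/-- The prolongation formula for `ψ_xx`. -/
theorem dx_dx_characteristic {H T X : ℝ × ℝ → ℂ} (hU : IsOpen U) (hu : ContDiffOn ℝ ∞ u U)
    (hH : ContDiffOn ℝ ∞ H U) (hT : ContDiffOn ℝ ∞ T U) (hX : ContDiffOn ℝ ∞ X U) (hp : p ∈ U) :
    dx (dx fun q => H q - T q * dt u q - X q * dx u q) p + T p * dt (dx (dx u)) p
        + X p * dx (dx (dx u)) p
      = dx (dx H) p - dx (dx T) p * dt u p - 2 * dx T p * dx (dt u) p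
        - dx (dx X) p * dx u p - 2 * dx X p * dx (dx u) p := by
  have ht := contDiffOn_dt hU hu
  have hx := contDiffOn_dx hU hu
  -- The third-order terms cancel only after ∂_t is commuted past both ∂_x.
  have h3 : dt (dx (dx u)) p = dx (dx (dt u)) p := by
    rw [dt_dx hU hx hp]
    exact dx_congr (eventuallyEq_of_eqOn hU (fun q hq => dt_dx hU hu hq) hp)
  rw [dx_dx_sub hU (hH.sub (hT.mul ht)) (hX.mul hx) hp, dx_dx_sub hU hH (hT.mul ht) hp,
    dx_dx_mul hU hT ht hp, dx_dx_mul hU hX hx hp, h3]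
  ring

end Plane

/-! ### Domains -/

section Domain

variable {Ω : Set (ℝ × ℝ)} {P : Set ℝ}

theorem IsTXDomain.isOpen_times (h : IsTXDomain Ω) : IsOpen (times Ω) :=
  isOpenMap_fst _ h.1

theorem IsTXDomain.nonempty_times (h : IsTXDomain Ω) : (times Ω).Nonempty :=
  h.2.1.image _

theorem IsTXDomain.ordConnected_times (h : IsTXDomain Ω) : (times Ω).OrdConnected := h.2.2.1

theorem mem_times {p : ℝ × ℝ} (hp : p ∈ Ω) : p.1 ∈ times Ω := mem_image_of_mem _ hp

theorem exists_of_mem_times {t : ℝ} (ht : t ∈ times Ω) : ∃ x, (t, x) ∈ Ω := by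
  obtain ⟨⟨s, x⟩, hp, rfl⟩ := ht
  exact ⟨x, hp⟩

theorem isOpen_slice (h : IsOpen Ω) (t : ℝ) : IsOpen {x : ℝ | (t, x) ∈ Ω} :=
  h.preimage (by fun_prop : Continuous fun x : ℝ => (t, x))

theorem eventually_mem_slice (h : IsOpen Ω) {t x : ℝ} (hp : (t, x) ∈ Ω) :
    ∀ᶠ s in 𝓝 t, (s, x) ∈ Ω :=
  (h.preimage (by fun_prop : Continuous fun s : ℝ => (s, x))).mem_nhds hp

theorem infinite_slice (h : IsOpen Ω) {t : ℝ} (ht : t ∈ times Ω) :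
    {x : ℝ | (t, x) ∈ Ω}.Infinite := by
  obtain ⟨x, hx⟩ := exists_of_mem_times ht
  exact infinite_of_mem_nhds x ((isOpen_slice h t).mem_nhds hx)

theorem IsTXDomain.eq_on_slice (h : IsTXDomain Ω) {E : Type*} [NormedAddCommGroup E]
    [NormedSpace ℝ E] {g : ℝ × ℝ → E} (hg : ContDiffOn ℝ ∞ g Ω)
    (h0 : ∀ p ∈ Ω, fderiv ℝ g p (0, 1) = 0) {t x y : ℝ} (hx : (t, x) ∈ Ω) (hy : (t, y) ∈ Ω) :
    g (t, x) = g (t, y) := by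
  refine eq_of_deriv_eq_zero (g := fun x => g (t, x)) (isOpen_slice h.1 t) (h.2.2.2 t)
    (fun r hr => ?_) hx hy
  have := hasDerivAt_slice_x (p := (t, r)) (differentiableAt_of_contDiffOn h.1 hg hr)
  rwa [h0 _ hr] at this

/-- A smooth function on a domain that does not depend on `x` is a function of `t`. -/
theorem IsTXDomain.exists_descent (h : IsTXDomain Ω) {E : Type*} [NormedAddCommGroup E]
    [NormedSpace ℝ E] {g : ℝ × ℝ → E} (hg : ContDiffOn ℝ ∞ g Ω)
    (h0 : ∀ p ∈ Ω, fderiv ℝ g p (0, 1) = 0) :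
    ∃ k : ℝ → E, ContDiffOn ℝ ∞ k (times Ω) ∧ ∀ p ∈ Ω, g p = k p.1 := by
  classical
  have hk : ∀ t : ℝ, ∃ e : E, ∀ x, (t, x) ∈ Ω → g (t, x) = e := by
    intro t
    by_cases ht : ∃ x, (t, x) ∈ Ω
    · obtain ⟨x, hx⟩ := ht
      exact ⟨g (t, x), fun y hy => h.eq_on_slice hg h0 hy hx⟩
    · exact ⟨0, fun x hx => absurd ⟨x, hx⟩ ht⟩
  choose k hk using hk
  refine ⟨k, fun t ht => ?_, fun p hp => hk p.1 p.2 hp⟩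
  obtain ⟨x, hx⟩ := exists_of_mem_times ht
  -- Near t the descended function is g along the horizontal segment s ↦ (s, x), which stays in `Ω`
  -- because `Ω` is open.
  have h1 : ContDiffAt ℝ ∞ (fun s => g (s, x)) t :=
    (hg.contDiffAt (h.1.mem_nhds hx)).comp t (by fun_prop)
  refine (h1.congr_of_eventuallyEq ?_).contDiffWithinAt
  filter_upwards [eventually_mem_slice h.1 hx] with s hs using (hk s x hs).symm

theorem isOpen_phaseDomain (hΩ : IsOpen Ω) (hP : IsOpen P) : IsOpen (phaseDomain Ω P) :=
  (hΩ.preimage (by fun_prop : Continuous fun z : Space => (z.1, z.2.1))).inter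
    (hP.preimage (by fun_prop : Continuous fun z : Space => ‖z.2.2‖))

/-- Polar coordinates present the annulus as a continuous image of P × ℝ. -/
theorem isPreconnected_annulus (hP : P.OrdConnected) (hP0 : P ⊆ Ioi 0) :
    IsPreconnected {ψ : ℂ | ‖ψ‖ ∈ P} := by
  have h : {ψ : ℂ | ‖ψ‖ ∈ P} =
      (fun z : ℝ × ℝ => (z.1 : ℂ) * Complex.exp (z.2 * Complex.I)) '' (P ×ˢ univ) := by
    ext ψ
    constructor
    · intro hψ
      exact ⟨(‖ψ‖, ψ.arg), ⟨hψ, mem_univ _⟩, Complex.norm_mul_exp_arg_mul_I ψ⟩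
    · rintro ⟨⟨ρ, θ⟩, ⟨hρ, -⟩, rfl⟩
      have : 0 ≤ ρ := (hP0 hρ).le
      simpa [Complex.norm_exp_ofReal_mul_I, abs_of_nonneg this] using hρ
  rw [h]
  exact (hP.isPreconnected.prod isPreconnected_univ).image _ (by fun_prop)

/-- This is how coefficients with vanishing ψ-derivative become functions of (t, x): the fibre over
each point of `Ω` is a connected annulus. -/
theorem eq_on_fibre (hΩ : IsOpen Ω) (hPo : IsOpen P) (hPc : P.OrdConnected) (hP0 : P ⊆ Ioi 0)
    {E : Type*} [NormedAddCommGroup E] [NormedSpace ℝ E] {g : Space → E}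
    (hg : ContDiffOn ℝ ∞ g (phaseDomain Ω P))
    (h0 : ∀ z ∈ phaseDomain Ω P, ∀ β : ℂ, fderiv ℝ g z (0, 0, β) = 0) {t x : ℝ} {ψ φ : ℂ}
    (hψ : (t, x, ψ) ∈ phaseDomain Ω P) (hφ : (t, x, φ) ∈ phaseDomain Ω P) :
    g (t, x, ψ) = g (t, x, φ) := by
  have hd : ∀ χ : ℂ, ‖χ‖ ∈ P → HasFDerivAt (fun y => g (t, x, y)) (0 : ℂ →L[ℝ] E) χ := by
    intro χ hχ
    have hz : (t, x, χ) ∈ phaseDomain Ω P := ⟨hψ.1, hχ⟩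
    have h1 := (differentiableAt_of_contDiffOn (isOpen_phaseDomain hΩ hPo) hg hz).hasFDerivAt
    have h2 : HasFDerivAt (fun y : ℂ => ((t, x, y) : Space))
        ((0 : ℂ →L[ℝ] ℝ).prod ((0 : ℂ →L[ℝ] ℝ).prod (ContinuousLinearMap.id ℝ ℂ))) χ :=
      (hasFDerivAt_const t χ).prodMk ((hasFDerivAt_const x χ).prodMk (hasFDerivAt_id χ))
    refine (h1.comp χ h2).congr_fderiv ?_
    refine ContinuousLinearMap.ext fun β => ?_
    exact h0 _ hz β
  have hopen : IsOpen {ψ : ℂ | ‖ψ‖ ∈ P} := hPo.preimage continuous_norm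
  exact hopen.is_const_of_fderiv_eq_zero (𝕜 := ℝ) (f := fun y => g (t, x, y))
    (isPreconnected_annulus hPc hP0)
    (fun χ hχ => (hd χ hχ).differentiableAt.differentiableWithinAt)
    (fun χ hχ => (hd χ hχ).fderiv) hψ.2 hφ.2

end Domain

/-! ### The determining equations -/

section Jets

variable {Ω : Set (ℝ × ℝ)} {P : Set ℝ} {f : ℝ → ℂ} {V : ℝ × ℝ → ℂ} {Q : Space → Space}

theorem hasDerivAt_norm_line {ψ η : ℂ} (hψ : ψ ≠ 0) :
    HasDerivAt (fun s : ℝ => ‖ψ + s • η‖) (inner ℝ ψ η / ‖ψ‖) 0 := by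
  have h1 : HasDerivAt (fun s : ℝ => ψ + s • η) η 0 := by
    simpa using! ((hasDerivAt_id (0 : ℝ)).smul_const η).const_add ψ
  have h2 := h1.norm_sq.sqrt (by simpa using hψ)
  simp only [Real.sqrt_sq (norm_nonneg _), zero_smul, add_zero] at h2
  refine h2.congr_deriv ?_
  have : ‖ψ‖ ≠ 0 := by simpa using hψ
  field_simp

theorem contDiffOn_lowerPart (hP0 : P ⊆ Ioi 0)
    (hf : ContDiffOn ℝ ∞ f P) (hV : ContDiffOn ℝ ∞ V Ω) :
    ContDiffOn ℝ ∞ (lowerPart f V) (phaseDomain Ω P) := by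
  have hψ : ContDiffOn ℝ ∞ (fun z : Space => z.2.2) (phaseDomain Ω P) := by fun_prop
  have hn : ContDiffOn ℝ ∞ (fun z : Space => ‖z.2.2‖) (phaseDomain Ω P) :=
    hψ.norm ℝ fun z hz => norm_pos_iff.1 (hP0 hz.2)
  have h1 : ContDiffOn ℝ ∞ (fun z : Space => f ‖z.2.2‖) (phaseDomain Ω P) :=
    hf.comp hn fun z hz => hz.2
  have h2 : ContDiffOn ℝ ∞ (fun z : Space => V (z.1, z.2.1)) (phaseDomain Ω P) :=
    hV.comp (by fun_prop) fun z hz => hz.1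
  exact (h1.mul hψ).add (h2.mul hψ)

/-- The differential is computed along the line z + s w. It is only real-linear in the ψ-direction,
since |ψ| enters through an inner product. -/
theorem fderiv_lowerPart (hΩ : IsOpen Ω) (hPo : IsOpen P) (hP0 : P ⊆ Ioi 0)
    (hf : ContDiffOn ℝ ∞ f P) (hV : ContDiffOn ℝ ∞ V Ω) {z : Space}
    (hz : z ∈ phaseDomain Ω P) (w : Space) :
    fderiv ℝ (lowerPart f V) z w =
      ((w.1 : ℂ) * dt V (z.1, z.2.1) + (w.2.1 : ℂ) * dx V (z.1, z.2.1)) * z.2.2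
      + (f ‖z.2.2‖ + V (z.1, z.2.1)) * w.2.2
      + deriv f ‖z.2.2‖ * ((inner ℝ z.2.2 w.2.2 / ‖z.2.2‖ : ℝ) : ℂ) * z.2.2 := by
  have hψ : z.2.2 ≠ 0 := norm_pos_iff.1 (hP0 hz.2)
  have hL := differentiableAt_of_contDiffOn (isOpen_phaseDomain hΩ hPo)
    (contDiffOn_lowerPart hP0 hf hV) hz
  have hline : HasDerivAt (fun s : ℝ => z + s • w) w 0 := by
    simpa using! ((hasDerivAt_id (0 : ℝ)).smul_const w).const_add z
  have h1 : HasDerivAt (fun s : ℝ => lowerPart f V (z + s • w))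
      (fderiv ℝ (lowerPart f V) z w) 0 := by
    have : HasFDerivAt (lowerPart f V) (fderiv ℝ (lowerPart f V) z) (z + (0 : ℝ) • w) := by
      simpa using hL.hasFDerivAt
    exact this.comp_hasDerivAt 0 hline
  refine h1.unique ?_
  have hφ : HasDerivAt (fun s : ℝ => z.2.2 + s • w.2.2) w.2.2 0 := by
    simpa using! ((hasDerivAt_id (0 : ℝ)).smul_const w.2.2).const_add z.2.2
  have hf' : HasDerivAt (fun s : ℝ => f ‖z.2.2 + s • w.2.2‖)
      ((inner ℝ z.2.2 w.2.2 / ‖z.2.2‖ : ℝ) • deriv f ‖z.2.2‖) 0 := by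
    have : HasDerivAt f (deriv f ‖z.2.2‖) ‖z.2.2 + (0 : ℝ) • w.2.2‖ := by
      simpa using hasDerivAt_of_contDiffOn hPo hf hz.2
    exact this.scomp (0 : ℝ) (hasDerivAt_norm_line hψ)
  have hV' : HasDerivAt (fun s : ℝ => V (z.1 + s * w.1, z.2.1 + s * w.2.1))
      (fderiv ℝ V (z.1, z.2.1) (w.1, w.2.1)) 0 := by
    have h2 : HasFDerivAt V (fderiv ℝ V (z.1, z.2.1))
        (z.1 + (0 : ℝ) * w.1, z.2.1 + (0 : ℝ) * w.2.1) := by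
      simpa using (differentiableAt_of_contDiffOn hΩ hV hz.1).hasFDerivAt
    have h3 : HasDerivAt (fun s : ℝ => (z.1 + s * w.1, z.2.1 + s * w.2.1)) (w.1, w.2.1) 0 := by
      refine HasDerivAt.prodMk ?_ ?_
      · simpa using! ((hasDerivAt_id (0 : ℝ)).mul_const w.1).const_add z.1
      · simpa using! ((hasDerivAt_id (0 : ℝ)).mul_const w.2.1).const_add z.2.1
    exact h2.comp_hasDerivAt 0 h3
  have hsplit : fderiv ℝ V (z.1, z.2.1) (w.1, w.2.1) =
      (w.1 : ℂ) * dt V (z.1, z.2.1) + (w.2.1 : ℂ) * dx V (z.1, z.2.1) := by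
    have : ((w.1, w.2.1) : ℝ × ℝ) = w.1 • (1, 0) + w.2.1 • (0, 1) := by simp
    rw [this, map_add, map_smul, map_smul]
    simp [dt, dx]
  refine ((hf'.mul hφ).add (hV'.mul hφ)).congr_deriv ?_
  rw [hsplit]
  simp only [zero_mul, add_zero, zero_smul, Complex.real_smul]
  ring

theorem fderiv_ofReal_comp {E : Type*} [NormedAddCommGroup E] [NormedSpace ℝ E] {g : E → ℝ}
    {z : E} (hg : DifferentiableAt ℝ g z) (w : E) :
    fderiv ℝ (fun y => (g y : ℂ)) z w = (fderiv ℝ g z w : ℂ) := by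
  have := (Complex.ofRealCLM.hasFDerivAt (x := g z)).comp z hg.hasFDerivAt
  have h2 : HasFDerivAt (fun y => (g y : ℂ)) (Complex.ofRealCLM.comp (fderiv ℝ g z)) z := this
  rw [h2.fderiv]; rfl

variable {u : ℝ × ℝ → ℂ} {p : ℝ × ℝ}

theorem fderiv_comp_graph {φ : Space → ℂ} {q : ℝ × ℝ} (hφ : DifferentiableAt ℝ φ (q.1, q.2, u q))
    (hu : DifferentiableAt ℝ u q) (v : ℝ × ℝ) :
    fderiv ℝ (fun q => φ (q.1, q.2, u q)) q v
      = fderiv ℝ φ (q.1, q.2, u q) (v.1, v.2, fderiv ℝ u q v) := by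
  have h : HasFDerivAt (fun q : ℝ × ℝ => ((q.1, q.2, u q) : Space))
      ((ContinuousLinearMap.fst ℝ ℝ ℝ).prod
        ((ContinuousLinearMap.snd ℝ ℝ ℝ).prod (fderiv ℝ u q))) q :=
    hasFDerivAt_fst.prodMk (hasFDerivAt_snd.prodMk hu.hasFDerivAt)
  have := HasFDerivAt.comp (f := fun q : ℝ × ℝ => ((q.1, q.2, u q) : Space)) q hφ.hasFDerivAt h
  have h2 : HasFDerivAt (fun q => φ (q.1, q.2, u q)) _ q := this
  rw [h2.fderiv]; rfl

/-- The points over which a function takes values in the domain of the equation. -/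
theorem isOpen_graph_preimage (hΩ : IsOpen Ω) (hPo : IsOpen P) (hu : Continuous u) :
    IsOpen {q : ℝ × ℝ | q ∈ Ω ∧ ‖u q‖ ∈ P} :=
  hΩ.inter (hPo.preimage hu.norm)

theorem contDiffOn_comp_graph {φ : Space → ℂ} (hφ : ContDiffOn ℝ ∞ φ (phaseDomain Ω P))
    (hu : ContDiff ℝ ∞ u) :
    ContDiffOn ℝ ∞ (fun q => φ (q.1, q.2, u q)) {q : ℝ × ℝ | q ∈ Ω ∧ ‖u q‖ ∈ P} :=
  hφ.comp (f := fun q : ℝ × ℝ => ((q.1, q.2, u q) : Space)) (by fun_prop) fun _ hq => hq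

theorem dx_dx_comp_graph (hΩ : IsOpen Ω) (hPo : IsOpen P) {φ : Space → ℂ}
    (hφ : ContDiffOn ℝ ∞ φ (phaseDomain Ω P)) (hu : ContDiff ℝ ∞ u) (hp : p ∈ Ω)
    (hpP : ‖u p‖ ∈ P) :
    dx (dx fun q => φ (q.1, q.2, u q)) p
      = fderiv ℝ (fderiv ℝ φ) (p.1, p.2, u p) (0, 1, dx u p) (0, 1, dx u p)
        + fderiv ℝ φ (p.1, p.2, u p) (0, 0, dx (dx u) p) := by
  have hD := isOpen_phaseDomain hΩ hPo
  have hU := isOpen_graph_preimage hΩ hPo hu.continuous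
  have hud : Differentiable ℝ u := hu.differentiable (by simp)
  have hu' : DifferentiableAt ℝ (dx u) p :=
    differentiableAt_of_contDiffOn isOpen_univ (contDiffOn_dx isOpen_univ hu.contDiffOn) (mem_univ p)
  have h1 : dx (fun q => φ (q.1, q.2, u q)) =ᶠ[𝓝 p]
      fun q => fderiv ℝ φ (q.1, q.2, u q) (0, 1, dx u q) :=
    eventuallyEq_of_eqOn hU (fun q hq => fderiv_comp_graph
      (differentiableAt_of_contDiffOn hD hφ hq) (hud q) (0, 1)) ⟨hp, hpP⟩
  rw [dx_congr h1]
  have hφ' : DifferentiableAt ℝ (fderiv ℝ φ) (p.1, p.2, u p) :=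
    differentiableAt_of_contDiffOn hD (hφ.fderiv_of_isOpen hD (m := ∞) (by simp)) ⟨hp, hpP⟩
  have hgr : HasFDerivAt (fun q : ℝ × ℝ => ((q.1, q.2, u q) : Space))
      ((ContinuousLinearMap.fst ℝ ℝ ℝ).prod
        ((ContinuousLinearMap.snd ℝ ℝ ℝ).prod (fderiv ℝ u p))) p :=
    hasFDerivAt_fst.prodMk (hasFDerivAt_snd.prodMk (hud p).hasFDerivAt)
  have hA := HasFDerivAt.comp (f := fun q : ℝ × ℝ => ((q.1, q.2, u q) : Space)) p
    hφ'.hasFDerivAt hgr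
  have hB : HasFDerivAt (fun q : ℝ × ℝ => ((0, 1, dx u q) : Space))
      ((0 : ℝ × ℝ →L[ℝ] ℝ).prod ((0 : ℝ × ℝ →L[ℝ] ℝ).prod (fderiv ℝ (dx u) p))) p :=
    (hasFDerivAt_const _ _).prodMk ((hasFDerivAt_const _ _).prodMk hu'.hasFDerivAt)
  have hAB := hA.clm_apply hB
  have h2 : HasFDerivAt (fun q => fderiv ℝ φ (q.1, q.2, u q) (0, 1, dx u q)) _ p := hAB
  rw [dx, h2.fderiv, add_comm]
  rfl

/-- The prolonged action in terms of the compositions of the coefficients with `u`. -/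
theorem prolongedAction_eq (hΩ : IsOpen Ω) (hPo : IsOpen P)
    (hQ : ContDiffOn ℝ ∞ Q (phaseDomain Ω P)) (hu : ContDiff ℝ ∞ u) (hp : p ∈ Ω)
    (hpP : ‖u p‖ ∈ P) {H T X : ℝ × ℝ → ℂ} (hH : H = fun q => (Q (q.1, q.2, u q)).2.2)
    (hT : T = fun q => ((Q (q.1, q.2, u q)).1 : ℂ))
    (hX : X = fun q => ((Q (q.1, q.2, u q)).2.1 : ℂ)) :
    prolongedAction f V Q u p =
      Complex.I * (dt H p - dt T p * dt u p - dt X p * dx u p)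
      + (dx (dx H) p - dx (dx T) p * dt u p - 2 * dx T p * dx (dt u) p
        - dx (dx X) p * dx u p - 2 * dx X p * dx (dx u) p)
      + fderiv ℝ (lowerPart f V) (p.1, p.2, u p) (Q (p.1, p.2, u p)) := by
  have hU := isOpen_graph_preimage (Ω := Ω) (P := P) hΩ hPo hu.continuous
  have hH' : ContDiffOn ℝ ∞ H {q : ℝ × ℝ | q ∈ Ω ∧ ‖u q‖ ∈ P} := by
    rw [hH]
    exact contDiffOn_comp_graph (φ := fun z => (Q z).2.2) hQ.snd.snd hu
  have hT' : ContDiffOn ℝ ∞ T {q : ℝ × ℝ | q ∈ Ω ∧ ‖u q‖ ∈ P} := by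
    rw [hT]
    exact contDiffOn_comp_graph (φ := fun z => ((Q z).1 : ℂ))
      (Complex.ofRealCLM.contDiff.comp_contDiffOn hQ.fst) hu
  have hX' : ContDiffOn ℝ ∞ X {q : ℝ × ℝ | q ∈ Ω ∧ ‖u q‖ ∈ P} := by
    rw [hX]
    exact contDiffOn_comp_graph (φ := fun z => ((Q z).2.1 : ℂ))
      (Complex.ofRealCLM.contDiff.comp_contDiffOn hQ.snd.fst) hu
  rw [← dt_characteristic hU hu.contDiffOn hH' hT' hX' ⟨hp, hpP⟩,
    ← dx_dx_characteristic hU hu.contDiffOn hH' hT' hX' ⟨hp, hpP⟩]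
  subst hH hT hX
  rfl

/-- A polynomial with prescribed derivatives `u`, `u_t`, `u_x`, `u_xx`, `u_tx` at a point. -/
def jetPoly (z : Space) (α β γ δ : ℂ) (q : ℝ × ℝ) : ℂ :=
  z.2.2 + α * ((q.1 - z.1 : ℝ) : ℂ) + β * ((q.2 - z.2.1 : ℝ) : ℂ)
    + γ / 2 * (((q.2 - z.2.1) ^ 2 : ℝ) : ℂ) + δ * (((q.1 - z.1) * (q.2 - z.2.1) : ℝ) : ℂ)

theorem contDiff_jetPoly (z : Space) (α β γ δ : ℂ) : ContDiff ℝ ∞ (jetPoly z α β γ δ) := by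
  have h : ∀ g : ℝ × ℝ → ℝ, ContDiff ℝ ∞ g → ContDiff ℝ ∞ fun q => (g q : ℂ) :=
    fun g hg => Complex.ofRealCLM.contDiff.comp hg
  unfold jetPoly
  refine (((contDiff_const.add (contDiff_const.mul (h _ ?_))).add
    (contDiff_const.mul (h _ ?_))).add (contDiff_const.mul (h _ ?_))).add
    (contDiff_const.mul (h _ ?_)) <;> fun_prop

theorem hasDerivAt_ofReal_poly (a b c r : ℝ) :
    HasDerivAt (fun s : ℝ => ((a + b * s + c * s ^ 2 : ℝ) : ℂ)) ((b + 2 * c * r : ℝ) : ℂ) r := by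
  refine HasDerivAt.ofReal_comp ?_
  refine ((((hasDerivAt_id r).const_mul b).const_add a).add
    ((hasDerivAt_pow 2 r).const_mul c)).congr_deriv ?_
  simp; ring

theorem dt_jetPoly (z : Space) (α β γ δ : ℂ) (q : ℝ × ℝ) :
    dt (jetPoly z α β γ δ) q = α + δ * ((q.2 - z.2.1 : ℝ) : ℂ) := by
  refine dt_eq ((contDiff_jetPoly z α β γ δ).differentiable (by simp) q) ?_
  have h := hasDerivAt_ofReal_poly (-z.1) 1 0 q.1
  have h2 := hasDerivAt_ofReal_poly (-z.1 * (q.2 - z.2.1)) (q.2 - z.2.1) 0 q.1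
  refine ((((h.const_mul α).const_add z.2.2).add_const (β * ((q.2 - z.2.1 : ℝ) : ℂ))).add_const
    (γ / 2 * (((q.2 - z.2.1) ^ 2 : ℝ) : ℂ)) |>.add (h2.const_mul δ)).congr_deriv ?_
    |>.congr_of_eventuallyEq (Eventually.of_forall fun s => ?_)
  · push_cast; ring
  · simp only [jetPoly, Pi.add_apply]; push_cast; ring

theorem dx_jetPoly (z : Space) (α β γ δ : ℂ) (q : ℝ × ℝ) :
    dx (jetPoly z α β γ δ) q
      = β + γ * ((q.2 - z.2.1 : ℝ) : ℂ) + δ * ((q.1 - z.1 : ℝ) : ℂ) := by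
  refine dx_eq ((contDiff_jetPoly z α β γ δ).differentiable (by simp) q) ?_
  have h := hasDerivAt_ofReal_poly (-z.2.1) 1 0 q.2
  have h1 := hasDerivAt_ofReal_poly (z.2.1 ^ 2) (-2 * z.2.1) 1 q.2
  have h2 := hasDerivAt_ofReal_poly (-z.2.1 * (q.1 - z.1)) (q.1 - z.1) 0 q.2
  refine (((h.const_mul β).const_add (z.2.2 + α * ((q.1 - z.1 : ℝ) : ℂ))).add
    (h1.const_mul (γ / 2)) |>.add (h2.const_mul δ)).congr_deriv ?_
    |>.congr_of_eventuallyEq (Eventually.of_forall fun s => ?_)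
  · push_cast; ring
  · simp only [jetPoly, Pi.add_apply]; push_cast; ring

theorem dx_affine (a b c : ℂ) (s y : ℝ) (q : ℝ × ℝ) :
    dx (fun q : ℝ × ℝ => a + b * ((q.2 - y : ℝ) : ℂ) + c * ((q.1 - s : ℝ) : ℂ)) q = b := by
  have hd : Differentiable ℝ
      (fun q : ℝ × ℝ => a + b * ((q.2 - y : ℝ) : ℂ) + c * ((q.1 - s : ℝ) : ℂ)) := by
    have h : ∀ g : ℝ × ℝ → ℝ, Differentiable ℝ g → Differentiable ℝ fun q => (g q : ℂ) :=
      fun g hg => Complex.ofRealCLM.differentiable.comp hg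
    exact ((differentiable_const _).add ((differentiable_const _).mul
      (h _ (by fun_prop)))).add ((differentiable_const _).mul (h _ (by fun_prop)))
  refine dx_eq (hd q) ?_
  have h := hasDerivAt_ofReal_poly (-y) 1 0 q.2
  refine (((h.const_mul b).const_add a).add_const (c * ((q.1 - s : ℝ) : ℂ))).congr_deriv ?_
    |>.congr_of_eventuallyEq (Eventually.of_forall fun s => ?_)
  · simp
  · push_cast; ring

/-- The infinitesimal invariance criterion in terms of jets. -/
theorem IsInvariant.jet_equation (hΩ : IsOpen Ω) (hPo : IsOpen P)
    (hQ : ContDiffOn ℝ ∞ Q (phaseDomain Ω P)) (hinv : IsInvariant f P V Ω Q) {z : Space}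
    (hz : z ∈ phaseDomain Ω P) {τ ξ : Space → ℝ} {η : Space → ℂ} (hτ : τ = fun z => (Q z).1)
    (hξ : ξ = fun z => (Q z).2.1) (hη : η = fun z => (Q z).2.2) (α β γ δ : ℂ)
    (hjet : Complex.I * α + γ + lowerPart f V z = 0) :
    Complex.I * (fderiv ℝ η z (1, 0, α) - (fderiv ℝ τ z (1, 0, α) : ℂ) * α
        - (fderiv ℝ ξ z (1, 0, α) : ℂ) * β)
      + (fderiv ℝ (fderiv ℝ η) z (0, 1, β) (0, 1, β) + fderiv ℝ η z (0, 0, γ)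
        - ((fderiv ℝ (fderiv ℝ τ) z (0, 1, β) (0, 1, β) + fderiv ℝ τ z (0, 0, γ) : ℝ) : ℂ) * α
        - 2 * (fderiv ℝ τ z (0, 1, β) : ℂ) * δ
        - ((fderiv ℝ (fderiv ℝ ξ) z (0, 1, β) (0, 1, β) + fderiv ℝ ξ z (0, 0, γ) : ℝ) : ℂ) * β
        - 2 * (fderiv ℝ ξ z (0, 1, β) : ℂ) * γ)
      + fderiv ℝ (lowerPart f V) z (Q z) = 0 := by
  have hD := isOpen_phaseDomain hΩ hPo
  -- This function has the jet (α, β, γ, δ) at p, and ψ_tt and the third derivatives drop out by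
  -- `prolongedAction_eq`. The criterion thus holds for all jets subject only to `hjet`.
  set u := jetPoly z α β γ δ with hu
  set p : ℝ × ℝ := (z.1, z.2.1)
  have hus : ContDiff ℝ ∞ u := contDiff_jetPoly z α β γ δ
  have hud : DifferentiableAt ℝ u p := hus.differentiable (by simp) p
  have hup : u p = z.2.2 := by simp [hu, jetPoly, p]
  have hzp : (p.1, p.2, u p) = z := by rw [hup]
  have hut : dt u p = α := by simp [hu, dt_jetPoly, p]
  have hux : dx u p = β := by simp [hu, dx_jetPoly, p]
  have huxx : dx (dx u) p = γ := by
    rw [show dx u = _ from funext fun q => dx_jetPoly z α β γ δ q]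
    exact dx_affine β γ δ z.1 z.2.1 p
  have hutx : dx (dt u) p = δ := by
    rw [show dt u = fun q => α + δ * ((q.2 - z.2.1 : ℝ) : ℂ) + 0 * ((q.1 - z.1 : ℝ) : ℂ) from
      funext fun q => by rw [hu, dt_jetPoly]; simp]
    exact dx_affine α δ 0 z.1 z.2.1 p
  have hpΩ : p ∈ Ω := hz.1
  have hpP : ‖u p‖ ∈ P := by rw [hup]; exact hz.2
  have hτs : ContDiffOn ℝ ∞ τ (phaseDomain Ω P) := by rw [hτ]; exact hQ.fst
  have hξs : ContDiffOn ℝ ∞ ξ (phaseDomain Ω P) := by rw [hξ]; exact hQ.snd.fst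
  have hηs : ContDiffOn ℝ ∞ η (phaseDomain Ω P) := by rw [hη]; exact hQ.snd.snd
  have hnls : nls f V u p = 0 := by
    rw [nls, hut, huxx, hup, ← hjet, lowerPart]; ring
  have key := hinv u hus p hpΩ hpP hnls
  rw [prolongedAction_eq hΩ hPo hQ hus hpΩ hpP rfl rfl rfl] at key
  have hofs : ∀ g : Space → ℝ, ContDiffOn ℝ ∞ g (phaseDomain Ω P) →
      ContDiffOn ℝ ∞ (fun y => (g y : ℂ)) (phaseDomain Ω P) := fun g hg =>
    Complex.ofRealCLM.contDiff.comp_contDiffOn hg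
  have hof : ∀ g : Space → ℝ, ContDiffOn ℝ ∞ g (phaseDomain Ω P) → ∀ v w : Space,
      fderiv ℝ (fderiv ℝ fun y => (g y : ℂ)) z v w = (fderiv ℝ (fderiv ℝ g) z v w : ℂ) := by
    intro g hg v w
    rw [← fderiv_fderiv_apply hD (hofs g hg) hz, ← fderiv_fderiv_apply hD hg hz,
      ← fderiv_ofReal_comp
        (differentiableAt_of_contDiffOn hD (contDiffOn_fderiv_apply hD hg w) hz)]
    congr 1
    refine Filter.EventuallyEq.fderiv_eq ?_
    filter_upwards [hD.mem_nhds hz] with y hy using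
      fderiv_ofReal_comp (differentiableAt_of_contDiffOn hD hg hy) w
  have h1 : ∀ φ : Space → ℂ, ContDiffOn ℝ ∞ φ (phaseDomain Ω P) →
      dt (fun q => φ (q.1, q.2, u q)) p = fderiv ℝ φ z (1, 0, α) ∧
      dx (fun q => φ (q.1, q.2, u q)) p = fderiv ℝ φ z (0, 1, β) ∧
      dx (dx (fun q => φ (q.1, q.2, u q))) p =
        fderiv ℝ (fderiv ℝ φ) z (0, 1, β) (0, 1, β) + fderiv ℝ φ z (0, 0, γ) := by
    intro φ hφ
    have hφd : DifferentiableAt ℝ φ (p.1, p.2, u p) := by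
      rw [hzp]; exact differentiableAt_of_contDiffOn hD hφ hz
    refine ⟨?_, ?_, ?_⟩
    · rw [dt, fderiv_comp_graph hφd hud, hzp, ← hut]; rfl
    · rw [dx, fderiv_comp_graph hφd hud, hzp, ← hux]; rfl
    · rw [dx_dx_comp_graph hΩ hPo hφ hus hpΩ hpP, hzp, hux, huxx]
  obtain ⟨a1, -, a3⟩ := h1 η hηs
  obtain ⟨b1, b2, b3⟩ := h1 (fun y => (τ y : ℂ)) (hofs τ hτs)
  obtain ⟨c1, c2, c3⟩ := h1 (fun y => (ξ y : ℂ)) (hofs ξ hξs)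
  have dτ := differentiableAt_of_contDiffOn hD hτs hz
  have dξ := differentiableAt_of_contDiffOn hD hξs hz
  rw [fderiv_ofReal_comp dτ] at b1 b2
  rw [fderiv_ofReal_comp dξ] at c1 c2
  rw [hof τ hτs, fderiv_ofReal_comp dτ] at b3
  rw [hof ξ hξs, fderiv_ofReal_comp dξ] at c3
  subst hτ hξ hη
  rw [a1, a3, b1, b2, b3, c1, c2, c3, hut, hux, huxx, hutx, hzp] at key
  rw [← key]
  push_cast
  ring

end Jets

/-! ### Splitting the criterion with respect to the free derivatives. -/

section Determining

variable {Ω : Set (ℝ × ℝ)} {P : Set ℝ} {f : ℝ → ℂ} {V : ℝ × ℝ → ℂ} {Q : Space → Space}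

theorem space_split_t (α : ℂ) : ((1, 0, α) : Space) = (1, 0, 0) + (0, 0, α) := by simp

theorem space_split_x (α : ℂ) : ((0, 1, α) : Space) = (0, 1, 0) + (0, 0, α) := by simp

theorem space_add (α β : ℂ) : ((0, 0, α + β) : Space) = (0, 0, α) + (0, 0, β) := by simp

theorem space_neg (α : ℂ) : ((0, 0, -α) : Space) = -(0, 0, α) := by simp

theorem eq_zero_of_re_im {a b : ℝ} (h : Complex.I * (a : ℂ) + (b : ℂ) = 0) : a = 0 ∧ b = 0 := by
  have h1 := congrArg Complex.re h
  have h2 := congrArg Complex.im h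
  simp at h1 h2
  exact ⟨h2, h1⟩

/-- Real linearity reduces everything to the basis 1, i. It serves to exclude a dependence of η on
ψ*. -/
theorem real_linear_eq_mul {E : ℂ →L[ℝ] ℂ} (h : E Complex.I = Complex.I * E 1) (α : ℂ) :
    E α = E 1 * α := by
  have : α = α.re • (1 : ℂ) + α.im • Complex.I := by
    simp only [Complex.real_smul, mul_one]; exact (Complex.re_add_im α).symm
  conv_lhs => rw [this]
  conv_rhs => rw [this]
  rw [map_add, map_smul, map_smul, h]
  simp only [Complex.real_smul]
  ring

/-- The component `ξᵗ` of an invariance field depends only on `t`. -/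
theorem IsInvariant.tau_eq (hΩ : IsOpen Ω) (hPo : IsOpen P)
    (hQ : ContDiffOn ℝ ∞ Q (phaseDomain Ω P)) (hinv : IsInvariant f P V Ω Q) {z : Space}
    (hz : z ∈ phaseDomain Ω P) (β : ℂ) : fderiv ℝ (fun z => (Q z).1) z (0, 1, β) = 0 := by
  -- With γ = 0 the equation fixes α = iL. The free δ = ψ_tx enters only through -2(D_x ξᵗ)δ, so
  -- comparing two values of δ suffices.
  have h := fun δ => hinv.jet_equation hΩ hPo hQ hz rfl rfl rfl
    (Complex.I * lowerPart f V z) β 0 δ (by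
      rw [← mul_assoc, Complex.I_mul_I]; ring)
  have h1 := h 1
  have h0 := h 0
  have h2 : ((fderiv ℝ (fun z => (Q z).1) z (0, 1, β) : ℝ) : ℂ) = 0 := by
    linear_combination (h0 - h1) / 2
  exact_mod_cast h2

theorem IsInvariant.tau_eq' (hΩ : IsOpen Ω) (hPo : IsOpen P)
    (hQ : ContDiffOn ℝ ∞ Q (phaseDomain Ω P)) (hinv : IsInvariant f P V Ω Q) {z : Space}
    (hz : z ∈ phaseDomain Ω P) (β : ℂ) : fderiv ℝ (fun z => (Q z).1) z (0, 0, β) = 0 := by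
  have h1 := hinv.tau_eq hΩ hPo hQ hz β
  rwa [space_split_x, map_add, hinv.tau_eq hΩ hPo hQ hz 0, zero_add] at h1

theorem fderiv_fderiv_eq_zero {E F : Type*} [NormedAddCommGroup E] [NormedSpace ℝ E]
    [NormedAddCommGroup F] [NormedSpace ℝ F] {S : Set E} {g : E → F} (hS : IsOpen S)
    (hg : ContDiffOn ℝ ∞ g S) {w : E} (h : ∀ y ∈ S, fderiv ℝ g y w = 0) {z : E} (hz : z ∈ S)
    (v : E) : fderiv ℝ (fderiv ℝ g) z v w = 0 := by
  rw [← fderiv_fderiv_apply hS hg hz]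
  have : (fun y => fderiv ℝ g y w) =ᶠ[𝓝 z] fun _ => 0 := by
    filter_upwards [hS.mem_nhds hz] with y hy using h y hy
  rw [this.fderiv_eq]
  simp

/-- The consequences of the vanishing of the coefficients of `ψ_t`. -/
theorem IsInvariant.first_order (hΩ : IsOpen Ω) (hPo : IsOpen P)
    (hQ : ContDiffOn ℝ ∞ Q (phaseDomain Ω P)) (hinv : IsInvariant f P V Ω Q) {z : Space}
    (hz : z ∈ phaseDomain Ω P) :
    (∀ β : ℂ, fderiv ℝ (fun z => (Q z).2.1) z (0, 0, β) = 0) ∧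
    fderiv ℝ (fun z => (Q z).1) z (1, 0, 0) = 2 * fderiv ℝ (fun z => (Q z).2.1) z (0, 1, 0) ∧
    (∀ α : ℂ, fderiv ℝ (fun z => (Q z).2.2) z (0, 0, α)
      = fderiv ℝ (fun z => (Q z).2.2) z (0, 0, 1) * α) := by
  have hD := isOpen_phaseDomain hΩ hPo
  set τ : Space → ℝ := fun z => (Q z).1 with hτ
  set ξ : Space → ℝ := fun z => (Q z).2.1 with hξ
  set η : Space → ℂ := fun z => (Q z).2.2 with hη
  set L := lowerPart f V z
  have hτ1 : ∀ β, fderiv ℝ τ z (0, 1, β) = 0 := hinv.tau_eq hΩ hPo hQ hz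
  have hτ0 : ∀ β, fderiv ℝ τ z (0, 0, β) = 0 := hinv.tau_eq' hΩ hPo hQ hz
  have hτ2 : ∀ v β, fderiv ℝ (fderiv ℝ τ) z v (0, 1, β) = 0 := fun v β =>
    fderiv_fderiv_eq_zero hD hQ.fst (fun y hy => hinv.tau_eq hΩ hPo hQ hy β) hz v
  set ι : ℂ →L[ℝ] Space :=
    (0 : ℂ →L[ℝ] ℝ).prod ((0 : ℂ →L[ℝ] ℝ).prod (ContinuousLinearMap.id ℝ ℂ))
  set E : ℂ →L[ℝ] ℂ := (fderiv ℝ η z).comp ι with hE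
  set Ξ : ℂ →L[ℝ] ℝ := (fderiv ℝ ξ z).comp ι with hΞ
  have eE : ∀ α, fderiv ℝ η z (0, 0, α) = E α := fun α => rfl
  have eΞ : ∀ α, fderiv ℝ ξ z (0, 0, α) = Ξ α := fun α => rfl
  -- The equation is used to eliminate γ = -(iα + L). Both α and β are now free.
  have key : ∀ α β : ℂ, Complex.I * (fderiv ℝ η z (1, 0, 0) + E α
        - (fderiv ℝ τ z (1, 0, 0) : ℂ) * α
        - ((fderiv ℝ ξ z (1, 0, 0) : ℂ) + (Ξ α : ℂ)) * β)
      + (fderiv ℝ (fderiv ℝ η) z (0, 1, β) (0, 1, β) - E (Complex.I * α) - E L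
        - ((fderiv ℝ (fderiv ℝ ξ) z (0, 1, β) (0, 1, β) : ℂ) - (Ξ (Complex.I * α) : ℂ)
          - (Ξ L : ℂ)) * β
        + 2 * ((fderiv ℝ ξ z (0, 1, 0) : ℂ) + (Ξ β : ℂ)) * (Complex.I * α + L))
      + fderiv ℝ (lowerPart f V) z (Q z) = 0 := by
    intro α β
    have h := hinv.jet_equation hΩ hPo hQ hz hτ hξ hη α β (-(Complex.I * α) + -L) 0 (by ring)
    rw [hτ1, hτ2, hτ0, space_split_t α, space_split_x β] at h
    simp only [map_add (fderiv ℝ η z), map_add (fderiv ℝ τ z), map_add (fderiv ℝ ξ z), hτ0] at h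
    rw [space_add, space_neg, space_neg, ← space_split_x β] at h
    simp only [map_add (fderiv ℝ η z), map_add (fderiv ℝ ξ z), map_neg, eE, eΞ] at h
    push_cast at h
    linear_combination h
  have h00 := key 0 0
  have h10 := key 1 0
  have hI0 := key Complex.I 0
  have h01 := key 0 1
  have h11 := key 1 1
  simp only [map_zero, mul_zero, mul_one, Complex.I_mul_I, map_neg, Complex.ofReal_neg,
    Complex.ofReal_zero] at h00 h10 hI0 h01 h11
  have hII := Complex.I_mul_I
  have e1 : Complex.I * E 1 - E Complex.I
      = Complex.I * ((fderiv ℝ τ z (1, 0, 0) : ℂ) - 2 * (fderiv ℝ ξ z (0, 1, 0) : ℂ)) := by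
    linear_combination h10 - h00
  have e2 : Complex.I * E Complex.I + E 1
      = -((fderiv ℝ τ z (1, 0, 0) : ℂ) - 2 * (fderiv ℝ ξ z (0, 1, 0) : ℂ)) := by
    linear_combination hI0 - h00 + (fderiv ℝ τ z (1, 0, 0) : ℂ) * hII
  -- Multiplying `e1` by i gives `e2` with the opposite right-hand side, so ξᵗ_t - 2ξˣ_x must
  -- vanish.
  have ek : ((fderiv ℝ τ z (1, 0, 0) : ℂ) - 2 * (fderiv ℝ ξ z (0, 1, 0) : ℂ)) = 0 := by
    linear_combination (1 / 2 : ℂ) * (Complex.I * e1 + e2) +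
      (1 / 2 : ℂ) * (((fderiv ℝ τ z (1, 0, 0) : ℂ) - 2 * (fderiv ℝ ξ z (0, 1, 0) : ℂ)) - E 1) * hII
  -- The mixed second difference in α and β isolates the terms bilinear in them, which sum to i Ξ(1)
  -- + Ξ(i) at α = β = 1.
  have eX := eq_zero_of_re_im (a := Ξ 1) (b := Ξ Complex.I) (by
    linear_combination h11 - h01 - h10 + h00)
  refine ⟨fun β => ?_, ?_, fun α => ?_⟩
  · rw [eΞ]
    have : β = β.re • (1 : ℂ) + β.im • Complex.I := by
      simp only [Complex.real_smul, mul_one]; exact (Complex.re_add_im β).symm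
    rw [this, map_add, map_smul, map_smul, eX.1, eX.2]
    simp
  · have : ((fderiv ℝ τ z (1, 0, 0) - 2 * fderiv ℝ ξ z (0, 1, 0) : ℝ) : ℂ) = 0 := by
      push_cast; exact ek
    have h2 : fderiv ℝ τ z (1, 0, 0) - 2 * fderiv ℝ ξ z (0, 1, 0) = 0 := by exact_mod_cast this
    linarith
  · rw [eE, eE]
    refine real_linear_eq_mul ?_ α
    linear_combination -e1 - Complex.I * ek

/-- The remaining determining equations. -/
theorem IsInvariant.second_order (hΩ : IsOpen Ω) (hPo : IsOpen P)
    (hQ : ContDiffOn ℝ ∞ Q (phaseDomain Ω P)) (hinv : IsInvariant f P V Ω Q) {A : Space → ℂ}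
    (hA : A = fun z => fderiv ℝ (fun z => (Q z).2.2) z (0, 0, 1)) {z : Space}
    (hz : z ∈ phaseDomain Ω P) :
    (∀ β : ℂ, fderiv ℝ A z (0, 0, β) = 0) ∧
    2 * fderiv ℝ A z (0, 1, 0) = Complex.I * (fderiv ℝ (fun z => (Q z).2.1) z (1, 0, 0) : ℂ) ∧
    Complex.I * fderiv ℝ (fun z => (Q z).2.2) z (1, 0, 0)
      + fderiv ℝ (fderiv ℝ fun z => (Q z).2.2) z (0, 1, 0) (0, 1, 0)
      + ((fderiv ℝ (fun z => (Q z).1) z (1, 0, 0) : ℂ) - A z) * lowerPart f V z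
      + fderiv ℝ (lowerPart f V) z (Q z) = 0 := by
  have hD := isOpen_phaseDomain hΩ hPo
  set τ : Space → ℝ := fun z => (Q z).1 with hτ
  set ξ : Space → ℝ := fun z => (Q z).2.1 with hξ
  set η : Space → ℂ := fun z => (Q z).2.2 with hη
  set L := lowerPart f V z
  have hτs : ContDiffOn ℝ ∞ τ (phaseDomain Ω P) := hQ.fst
  have hξs : ContDiffOn ℝ ∞ ξ (phaseDomain Ω P) := hQ.snd.fst
  have hηs : ContDiffOn ℝ ∞ η (phaseDomain Ω P) := hQ.snd.snd
  have hAs : ContDiffOn ℝ ∞ A (phaseDomain Ω P) := by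
    rw [hA]; exact contDiffOn_fderiv_apply hD hηs _
  have hfo := fun y (hy : y ∈ phaseDomain Ω P) => hinv.first_order hΩ hPo hQ hy
  have hτ1 : ∀ β, fderiv ℝ τ z (0, 1, β) = 0 := hinv.tau_eq hΩ hPo hQ hz
  have hτ0 : ∀ β, fderiv ℝ τ z (0, 0, β) = 0 := hinv.tau_eq' hΩ hPo hQ hz
  have hτ2 : ∀ v β, fderiv ℝ (fderiv ℝ τ) z v (0, 1, β) = 0 := fun v β =>
    fderiv_fderiv_eq_zero hD hτs (fun y hy => hinv.tau_eq hΩ hPo hQ hy β) hz v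
  have hξ0 : ∀ β, fderiv ℝ ξ z (0, 0, β) = 0 := (hfo z hz).1
  have hξ2 : ∀ v β, fderiv ℝ (fderiv ℝ ξ) z v (0, 0, β) = 0 := fun v β =>
    fderiv_fderiv_eq_zero hD hξs (fun y hy => (hfo y hy).1 β) hz v
  have hξx : (fderiv ℝ τ z (1, 0, 0) : ℂ) = 2 * (fderiv ℝ ξ z (0, 1, 0) : ℂ) := by
    rw [(hfo z hz).2.1]; push_cast; rfl
  -- This differentiates ξᵗ_t = 2ξˣ_x in x and uses that ξᵗ is independent of x.
  have hξxx : fderiv ℝ (fderiv ℝ ξ) z (0, 1, 0) (0, 1, 0) = 0 := by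
    have h1 : (fun y => fderiv ℝ τ y (1, 0, 0)) =ᶠ[𝓝 z] fun y => 2 * fderiv ℝ ξ y (0, 1, 0) := by
      filter_upwards [hD.mem_nhds hz] with y hy using (hfo y hy).2.1
    have h2 := congrArg (fun l : Space →L[ℝ] ℝ => l (0, 1, 0)) h1.fderiv_eq
    rw [fderiv_const_mul (differentiableAt_of_contDiffOn hD (contDiffOn_fderiv_apply hD hξs _) hz),
      smul_apply, fderiv_fderiv_apply hD hτs hz,
      fderiv_fderiv_apply hD hξs hz, fderiv_fderiv_symm hD hτs hz, hτ2] at h2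
    simpa using h2.symm
  have hηψ : ∀ y ∈ phaseDomain Ω P, ∀ α, fderiv ℝ η y (0, 0, α) = A y * α := by
    intro y hy α
    rw [(hfo y hy).2.2, hA]
  have hη2 : ∀ v β, fderiv ℝ (fderiv ℝ η) z v (0, 0, β) = fderiv ℝ A z v * β := by
    intro v β
    rw [← fderiv_fderiv_apply hD hηs hz]
    have h1 : (fun y => fderiv ℝ η y (0, 0, β)) =ᶠ[𝓝 z] fun y => A y * β := by
      filter_upwards [hD.mem_nhds hz] with y hy using hηψ y hy β
    rw [h1.fderiv_eq, fderiv_mul_const (differentiableAt_of_contDiffOn hD hAs hz)]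
    simp [mul_comm]
  -- With α = 0 and γ = -L what remains is a polynomial of degree two in β.
  have key : ∀ β : ℂ, Complex.I * fderiv ℝ η z (1, 0, 0)
      - Complex.I * (fderiv ℝ ξ z (1, 0, 0) : ℂ) * β
      + fderiv ℝ (fderiv ℝ η) z (0, 1, 0) (0, 1, 0) + 2 * fderiv ℝ A z (0, 1, 0) * β
      + fderiv ℝ A z (0, 0, β) * β
      + ((fderiv ℝ τ z (1, 0, 0) : ℂ) - A z) * L + fderiv ℝ (lowerPart f V) z (Q z) = 0 := by
    intro β
    have h := hinv.jet_equation hΩ hPo hQ hz hτ hξ hη 0 β (-L) 0 (by ring)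
    rw [space_neg, map_neg, map_neg, map_neg, hηψ z hz, hξ0, hτ0, space_split_x β] at h
    simp only [map_add, add_apply, hξ2, hη2, hξxx, hξ0] at h
    rw [fderiv_fderiv_symm hD hξs hz (0, 0, β), hξ2,
      fderiv_fderiv_symm hD hηs hz (0, 0, β), hη2] at h
    rw [hξx]
    push_cast at h
    linear_combination h
  have h2 : ∀ β : ℂ, fderiv ℝ A z (0, 0, β) = 0 := by
    intro β
    by_cases hβ : β = 0
    · rw [hβ]; exact map_zero (fderiv ℝ A z)
    have h1 := key β
    have h3 := key (-β)
    have h0 := key 0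
    rw [space_neg, map_neg] at h3
    -- The even part in β, less the value at 0, is the quadratic term.
    have : fderiv ℝ A z (0, 0, β) * β = 0 := by
      linear_combination h1 / 2 + h3 / 2 - h0
    exact (mul_eq_zero.1 this).resolve_right hβ
  refine ⟨h2, ?_, ?_⟩
  · have h1 := key 1
    have h0 := key 0
    rw [h2] at h1 h0
    linear_combination h1 - h0
  · have h0 := key 0
    rw [h2] at h0
    linear_combination h0

end Determining

/-! ### The Lie invariance algebra -/

/-- The vector field `τ ∂_t + G(χ) + σ M`. -/
def symField (τ : ℝ) (χ σ : ℝ → ℝ) : Space → Space := fun z =>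
  (τ, χ z.1, ((deriv χ z.1 * z.2.1 / 2 + σ z.1 : ℝ) : ℂ) * (Complex.I * z.2.2))

/-- The classifying condition for `τ ∂_t + G(χ) + σ M` to be an invariance field. -/
def IsSymmetry (Ω : Set (ℝ × ℝ)) (V : ℝ × ℝ → ℂ) (τ : ℝ) (χ σ : ℝ → ℝ) : Prop :=
  ContDiffOn ℝ ∞ χ (times Ω) ∧ ContDiffOn ℝ ∞ σ (times Ω) ∧
    ∀ p ∈ Ω, (τ : ℂ) * dt V p + (χ p.1 : ℂ) * dx V p
      = ((deriv (deriv χ) p.1 * p.2 / 2 + deriv σ p.1 : ℝ) : ℂ)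

section Algebra

variable {Ω : Set (ℝ × ℝ)} {P : Set ℝ} {f : ℝ → ℂ} {V : ℝ × ℝ → ℂ} {Q : Space → Space}

theorem fderiv_affine_in_fibre {S : Set Space} (hS : IsOpen S) (hSΩ : ∀ z ∈ S, (z.1, z.2.1) ∈ Ω)
    (hΩ : IsOpen Ω) {g : Space → ℂ} {a b : ℝ × ℝ → ℂ}
    (ha : ContDiffOn ℝ ∞ a Ω) (hb : ContDiffOn ℝ ∞ b Ω)
    (hg : ∀ z ∈ S, g z = a (z.1, z.2.1) * z.2.2 + b (z.1, z.2.1)) {z : Space} (hz : z ∈ S)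
    (w : ℝ × ℝ) :
    fderiv ℝ g z (w.1, w.2, 0) = fderiv ℝ a (z.1, z.2.1) w * z.2.2 + fderiv ℝ b (z.1, z.2.1) w := by
  have hpr : HasFDerivAt (fun z : Space => (z.1, z.2.1))
      ((ContinuousLinearMap.fst ℝ ℝ (ℝ × ℂ)).prod ((ContinuousLinearMap.fst ℝ ℝ ℂ).comp
        (ContinuousLinearMap.snd ℝ ℝ (ℝ × ℂ)))) z :=
    hasFDerivAt_fst.prodMk (hasFDerivAt_fst.comp z hasFDerivAt_snd)
  have hψ : HasFDerivAt (fun z : Space => z.2.2) ((ContinuousLinearMap.snd ℝ ℝ ℂ).comp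
      (ContinuousLinearMap.snd ℝ ℝ (ℝ × ℂ))) z := hasFDerivAt_snd.comp z hasFDerivAt_snd
  have h1 := HasFDerivAt.comp (f := fun z : Space => (z.1, z.2.1)) z
    (differentiableAt_of_contDiffOn hΩ ha (hSΩ z hz)).hasFDerivAt hpr
  have h2 := HasFDerivAt.comp (f := fun z : Space => (z.1, z.2.1)) z
    (differentiableAt_of_contDiffOn hΩ hb (hSΩ z hz)).hasFDerivAt hpr
  have h3 := (h1.mul hψ).add h2
  have h4 : HasFDerivAt g _ z := h3.congr_of_eventuallyEq (by
    filter_upwards [hS.mem_nhds hz] with y hy using hg y hy)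
  rw [h4.fderiv]
  simp [mul_comm]

/-- If f_ρ vanished identically, the excluded relation would hold with c = 0. So the single negated
statement also contains f_ρ ≢ 0, and with it that `P` is nonempty. -/
theorem exists_deriv_ne_zero
    (hPo : IsOpen P)
    (hfc : ¬ ∃ c : ℝ, ∀ ρ ∈ P, (ρ : ℂ) * deriv (deriv f) ρ = (c : ℂ) * deriv f ρ) :
    ∃ ρ ∈ P, deriv f ρ ≠ 0 := by
  by_contra! h
  refine hfc ⟨0, fun ρ hρ => ?_⟩
  have : deriv f =ᶠ[𝓝 ρ] fun _ => 0 := by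
    filter_upwards [hPo.mem_nhds hρ] with r hr using h r hr
  rw [this.deriv_eq]
  simp

/-- The nonlinearities `f` with constant `ρ f_ρρ / f_ρ` are the only ones for which `f` and
`ρ f_ρ` admit a nontrivial relation. -/
theorem coeffs_eq_zero (hPo : IsOpen P) (hf : ContDiffOn ℝ ∞ f P)
    (hfc : ¬ ∃ c : ℝ, ∀ ρ ∈ P, (ρ : ℂ) * deriv (deriv f) ρ = (c : ℂ) * deriv f ρ)
    {k r : ℝ} {c₀ : ℂ} (h : ∀ ρ ∈ P, c₀ + k * f ρ + r * (ρ * deriv f ρ) = 0) :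
    k = 0 ∧ r = 0 ∧ c₀ = 0 := by
  obtain ⟨ρ₁, hρ₁, hne⟩ := exists_deriv_ne_zero hPo hfc
  -- Differentiation removes c₀ and leaves k f_ρ + r(f_ρ + ρ f_ρρ) = 0.
  have hd : ∀ ρ ∈ P, (k : ℂ) * deriv f ρ + r * (deriv f ρ + ρ * deriv (deriv f) ρ) = 0 := by
    intro ρ hρ
    have h1 := hasDerivAt_of_contDiffOn hPo hf hρ
    have h2 := hasDerivAt_of_contDiffOn hPo (contDiffOn_deriv hPo hf) hρ
    have h3 := ((h1.const_mul (k : ℂ)).const_add c₀).add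
      ((((hasDerivAt_id ρ).ofReal_comp).mul h2).const_mul (r : ℂ))
    have h4 : HasDerivAt (fun _ : ℝ => (0 : ℂ)) _ ρ := h3.congr_of_eventuallyEq (by
      filter_upwards [hPo.mem_nhds hρ] with y hy using (h y hy).symm)
    have h5 := h4.unique (hasDerivAt_const ρ (0 : ℂ))
    simpa using h5
  have hr : r = 0 := by
    by_contra hr
    have hr' : (r : ℂ) ≠ 0 := by exact_mod_cast hr
    -- For r ≠ 0 the differentiated relation is ρ f_ρρ = -(1 + k/r) f_ρ. It matters that k and r are
    -- real, because only real constants are excluded.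
    refine hfc ⟨-(1 + k / r), fun ρ hρ => ?_⟩
    have := hd ρ hρ
    push_cast
    field_simp
    linear_combination this
  have hk : k = 0 := by
    have := hd ρ₁ hρ₁
    rw [hr] at this
    simp only [Complex.ofReal_zero, zero_mul, add_zero] at this
    exact_mod_cast (mul_eq_zero.1 this).resolve_right hne
  refine ⟨hk, hr, ?_⟩
  have := h ρ₁ hρ₁
  rw [hk, hr] at this
  simpa using this

/-- Splitting of the last determining equation with respect to `ψ`. -/
theorem split_fibre (hPo : IsOpen P) (hP0 : P ⊆ Ioi 0) (hf : ContDiffOn ℝ ∞ f P)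
    (hfc : ¬ ∃ c : ℝ, ∀ ρ ∈ P, (ρ : ℂ) * deriv (deriv f) ρ = (c : ℂ) * deriv f ρ)
    {k : ℝ} {c₀ l v A B : ℂ}
    (h : ∀ ψ : ℂ, ‖ψ‖ ∈ P → c₀ * ψ + l + k * f ‖ψ‖ * ψ + (v + f ‖ψ‖) * B
      + deriv f ‖ψ‖ * ((inner ℝ ψ (A * ψ + B) / ‖ψ‖ : ℝ) : ℂ) * ψ = 0) :
    k = 0 ∧ A.re = 0 ∧ c₀ = 0 ∧ B = 0 := by
  have key : ∀ ρ ∈ P, ∀ ε : ℂ, ‖ε‖ = 1 → c₀ * (ρ * ε) + l + k * f ρ * (ρ * ε) + (v + f ρ) * B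
      + deriv f ρ * ((A.re * ρ + inner ℝ ε B : ℝ) : ℂ) * (ρ * ε) = 0 := by
    intro ρ hρ ε hε
    have hρ0 : 0 < ρ := hP0 hρ
    have hn : ‖(ρ : ℂ) * ε‖ = ρ := by simp [hε, abs_of_pos hρ0]
    have h1 := h (ρ * ε) (by rw [hn]; exact hρ)
    rw [hn] at h1
    have h2 : inner ℝ ((ρ : ℂ) * ε) (A * (ρ * ε) + B) / ρ = A.re * ρ + inner ℝ ε B := by
      have h3 : ε.re ^ 2 + ε.im ^ 2 = 1 := by
        have := Complex.sq_norm ε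
        rw [hε, Complex.normSq_apply] at this
        linarith
      rw [div_eq_iff hρ0.ne']
      simp only [Complex.inner, Complex.mul_re, Complex.mul_im, Complex.add_re, Complex.add_im,
        Complex.conj_re, Complex.conj_im, Complex.ofReal_re, Complex.ofReal_im, map_mul]
      linear_combination (A.re * ρ ^ 2) * h3
    rw [h2] at h1
    exact h1
  have hB : B = 0 := by
    obtain ⟨ρ, hρ, hne⟩ := exists_deriv_ne_zero hPo hfc
    have hρ0 : (ρ : ℂ) ≠ 0 := by exact_mod_cast (show 0 < ρ from hP0 hρ).ne'
    have h1 := key ρ hρ 1 (by simp)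
    have h2 := key ρ hρ (-1) (by simp)
    have h3 := key ρ hρ Complex.I (by simp)
    have h4 := key ρ hρ (-Complex.I) (by simp)
    simp only [Complex.inner, map_neg, map_one, Complex.conj_I] at h1 h2 h3 h4
    simp at h1 h2 h3 h4
    -- The part even in the direction ε consists of l + (v + f)B and f_ρ ρ ⟨ε, B⟩ ε. The difference
    -- between ε = 1 and ε = i removes the former.
    have h5 : deriv f ρ * ρ * ((B.re : ℂ) - Complex.I * (B.im : ℂ)) = 0 := by
      linear_combination (h1 + h2 - h3 - h4) / 2
    have h6 : (B.re : ℂ) - Complex.I * (B.im : ℂ) = 0 :=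
      (mul_eq_zero.1 h5).resolve_left (mul_ne_zero hne hρ0)
    have h7 := congrArg Complex.re h6
    have h8 := congrArg Complex.im h6
    simp at h7 h8
    exact Complex.ext h7 h8
  subst hB
  -- With B = 0 the part odd in ε is ρ times a linear relation between 1, f and ρ f_ρ.
  have h1 : ∀ ρ ∈ P, c₀ + k * f ρ + A.re * (ρ * deriv f ρ) = 0 := by
    intro ρ hρ
    have hρ0 : (ρ : ℂ) ≠ 0 := by exact_mod_cast (show 0 < ρ from hP0 hρ).ne'
    have h1 := key ρ hρ 1 (by simp)
    have h2 := key ρ hρ (-1) (by simp)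
    simp only [inner_zero_right, add_zero] at h1 h2
    push_cast at h1 h2
    refine (mul_eq_zero.1 (?_ : _ * (ρ : ℂ) = 0)).resolve_right hρ0
    linear_combination (h1 - h2) / 2
  obtain ⟨a, b, c⟩ := coeffs_eq_zero hPo hf hfc h1
  exact ⟨a, b, c, rfl⟩

theorem IsTXDomain.deriv_descent {E : Type*} [NormedAddCommGroup E] [NormedSpace ℝ E]
    (h : IsTXDomain Ω) {g : ℝ × ℝ → E} {k : ℝ → E} (hg : ContDiffOn ℝ ∞ g Ω)
    (hk : ∀ p ∈ Ω, g p = k p.1) {p : ℝ × ℝ} (hp : p ∈ Ω) : fderiv ℝ g p (1, 0) = deriv k p.1 := by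
  have h1 := hasDerivAt_slice_t (differentiableAt_of_contDiffOn h.1 hg hp)
  have h2 : (fun s => g (s, p.2)) =ᶠ[𝓝 p.1] k := by
    filter_upwards [eventually_mem_slice h.1 (t := p.1) (x := p.2) hp] with s hs using hk _ hs
  exact (h1.congr_of_eventuallyEq h2.symm).deriv.symm

theorem IsTXDomain.exists_const {E : Type*} [NormedAddCommGroup E] [NormedSpace ℝ E]
    (h : IsTXDomain Ω) {g : ℝ × ℝ → E} (hg : ContDiffOn ℝ ∞ g Ω)
    (h0 : ∀ p ∈ Ω, fderiv ℝ g p (0, 1) = 0) (h1 : ∀ p ∈ Ω, fderiv ℝ g p (1, 0) = 0) :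
    ∃ e : E, ∀ p ∈ Ω, g p = e := by
  obtain ⟨k, hk, hgk⟩ := h.exists_descent hg h0
  obtain ⟨t₀, ht₀⟩ := h.nonempty_times
  refine ⟨k t₀, fun p hp => ?_⟩
  rw [hgk p hp]
  refine eq_of_deriv_eq_zero h.isOpen_times h.ordConnected_times (fun t ht => ?_)
    (mem_times hp) ht₀
  obtain ⟨x, hx⟩ := exists_of_mem_times ht
  have := hasDerivAt_of_contDiffOn h.isOpen_times hk ht
  rwa [← h.deriv_descent hg hgk hx, h1 _ hx] at this

/-- Every invariance field is of the form `τ ∂_t + G(χ) + σ M`. -/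
theorem IsInvariant.exists_symField (hΩ : IsTXDomain Ω) (hPo : IsOpen P) (hPc : P.OrdConnected)
    (hP0 : P ⊆ Ioi 0) (hf : ContDiffOn ℝ ∞ f P)
    (hfc : ¬ ∃ c : ℝ, ∀ ρ ∈ P, (ρ : ℂ) * deriv (deriv f) ρ = (c : ℂ) * deriv f ρ)
    (hV : ContDiffOn ℝ ∞ V Ω) (hQ : ContDiffOn ℝ ∞ Q (phaseDomain Ω P))
    (hinv : IsInvariant f P V Ω Q) :
    ∃ τ χ σ, IsSymmetry Ω V τ χ σ ∧ ∀ z ∈ phaseDomain Ω P, Q z = symField τ χ σ z := by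
  have hD := isOpen_phaseDomain hΩ.1 hPo
  obtain ⟨ρ₀, hρ₀, -⟩ := exists_deriv_ne_zero hPo hfc
  have hρ₀0 : 0 < ρ₀ := hP0 hρ₀
  set τ : Space → ℝ := fun z => (Q z).1 with hτ
  set ξ : Space → ℝ := fun z => (Q z).2.1 with hξ
  set η : Space → ℂ := fun z => (Q z).2.2 with hη
  have hτs : ContDiffOn ℝ ∞ τ (phaseDomain Ω P) := hQ.fst
  have hξs : ContDiffOn ℝ ∞ ξ (phaseDomain Ω P) := hQ.snd.fst
  have hηs : ContDiffOn ℝ ∞ η (phaseDomain Ω P) := hQ.snd.snd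
  set A : Space → ℂ := fun z => fderiv ℝ η z (0, 0, 1) with hA
  have hAs : ContDiffOn ℝ ∞ A (phaseDomain Ω P) := contDiffOn_fderiv_apply hD hηs _
  have hfo := fun y (hy : y ∈ phaseDomain Ω P) => hinv.first_order hΩ.1 hPo hQ hy
  have hso := fun y (hy : y ∈ phaseDomain Ω P) => hinv.second_order hΩ.1 hPo hQ hA hy
  have hτ0 := fun y (hy : y ∈ phaseDomain Ω P) => hinv.tau_eq' hΩ.1 hPo hQ hy
  -- Since η_ψ = A does not depend on ψ, the remainder η - Aψ does not either.
  set B : Space → ℂ := fun z => η z - A z * z.2.2 with hB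
  have hBs : ContDiffOn ℝ ∞ B (phaseDomain Ω P) := hηs.sub (hAs.mul (by fun_prop))
  have hB0 : ∀ z ∈ phaseDomain Ω P, ∀ β : ℂ, fderiv ℝ B z (0, 0, β) = 0 := by
    intro z hz β
    have hψ : HasFDerivAt (fun z : Space => z.2.2) ((ContinuousLinearMap.snd ℝ ℝ ℂ).comp
      (ContinuousLinearMap.snd ℝ ℝ (ℝ × ℂ))) z := hasFDerivAt_snd.comp z hasFDerivAt_snd
    have h1 := (differentiableAt_of_contDiffOn hD hηs hz).hasFDerivAt.sub
      ((differentiableAt_of_contDiffOn hD hAs hz).hasFDerivAt.mul hψ)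
    have h2 : HasFDerivAt B _ z := h1
    rw [h2.fderiv]
    have e1 : fderiv ℝ η z (0, 0, β) = A z * β := (hfo z hz).2.2 β
    have e2 : fderiv ℝ A z (0, 0, β) = 0 := (hso z hz).1 β
    change fderiv ℝ η z (0, 0, β) - (A z * β + z.2.2 * fderiv ℝ A z (0, 0, β)) = 0
    rw [e1, e2]
    ring
  -- all coefficients at a fixed value of `ψ`
  set e : ℝ × ℝ → Space := fun p => (p.1, p.2, (ρ₀ : ℂ)) with he
  have heD : ∀ p ∈ Ω, e p ∈ phaseDomain Ω P := fun p hp => ⟨hp, by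
    simpa [he, abs_of_pos hρ₀0] using hρ₀⟩
  have hes : ContDiff ℝ ∞ e := by fun_prop
  have hed : ∀ p : ℝ × ℝ, HasFDerivAt e ((ContinuousLinearMap.fst ℝ ℝ ℝ).prod
      ((ContinuousLinearMap.snd ℝ ℝ ℝ).prod (0 : ℝ × ℝ →L[ℝ] ℂ))) p := fun p =>
    hasFDerivAt_fst.prodMk (hasFDerivAt_snd.prodMk (hasFDerivAt_const _ _))
  -- A coefficient independent of ψ is recovered from its values at ψ = ρ₀, together with its
  -- derivatives in t and x.
  have res : ∀ {F : Type} [NormedAddCommGroup F] [NormedSpace ℝ F] {g : Space → F},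
      ContDiffOn ℝ ∞ g (phaseDomain Ω P) →
      (∀ z ∈ phaseDomain Ω P, ∀ β : ℂ, fderiv ℝ g z (0, 0, β) = 0) →
      ContDiffOn ℝ ∞ (g ∘ e) Ω ∧
      (∀ z ∈ phaseDomain Ω P, g z = (g ∘ e) (z.1, z.2.1)) ∧
      ∀ z ∈ phaseDomain Ω P, ∀ w : ℝ × ℝ,
        fderiv ℝ (g ∘ e) (z.1, z.2.1) w = fderiv ℝ g z (w.1, w.2, 0) := by
    intro F _ _ g hg h0
    have hval : ∀ z ∈ phaseDomain Ω P, g z = (g ∘ e) (z.1, z.2.1) := fun z hz =>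
      eq_on_fibre hΩ.1 hPo hPc hP0 hg h0 hz (heD _ hz.1)
    have hsm : ContDiffOn ℝ ∞ (g ∘ e) Ω := hg.comp hes.contDiffOn heD
    refine ⟨hsm, hval, fun z hz w => ?_⟩
    have hpr : HasFDerivAt (fun z : Space => (z.1, z.2.1))
        ((ContinuousLinearMap.fst ℝ ℝ (ℝ × ℂ)).prod ((ContinuousLinearMap.fst ℝ ℝ ℂ).comp
          (ContinuousLinearMap.snd ℝ ℝ (ℝ × ℂ)))) z :=
      hasFDerivAt_fst.prodMk (hasFDerivAt_fst.comp z hasFDerivAt_snd)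
    have h1 := HasFDerivAt.comp (f := fun z : Space => (z.1, z.2.1)) z
      (differentiableAt_of_contDiffOn hΩ.1 hsm hz.1).hasFDerivAt hpr
    have h2 : HasFDerivAt g _ z := h1.congr_of_eventuallyEq (by
      filter_upwards [hD.mem_nhds hz] with y hy using hval y hy)
    rw [h2.fderiv]
    rfl
  obtain ⟨τs, τv, τd⟩ := res hτs hτ0
  obtain ⟨ξs, ξv, ξd⟩ := res hξs fun y hy => (hfo y hy).1
  obtain ⟨As, Av, Ad⟩ := res hAs fun y hy => (hso y hy).1
  obtain ⟨Bs, Bv, Bd⟩ := res hBs hB0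
  set τ₀ := τ ∘ e
  set ξ₀ := ξ ∘ e
  set A₀ := A ∘ e
  set B₀ := B ∘ e
  have ηv : ∀ z ∈ phaseDomain Ω P, η z = A₀ (z.1, z.2.1) * z.2.2 + B₀ (z.1, z.2.1) := by
    intro z hz
    rw [← Av z hz, ← Bv z hz, hB]; ring
  have hsub : ∀ z ∈ phaseDomain Ω P, (z.1, z.2.1) ∈ Ω := fun z hz => hz.1
  have ηt : ∀ z ∈ phaseDomain Ω P, fderiv ℝ η z (1, 0, 0)
      = dt A₀ (z.1, z.2.1) * z.2.2 + dt B₀ (z.1, z.2.1) := fun z hz =>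
    fderiv_affine_in_fibre hD hsub hΩ.1 As Bs ηv hz (1, 0)
  have ηx : ∀ z ∈ phaseDomain Ω P, fderiv ℝ η z (0, 1, 0)
      = dx A₀ (z.1, z.2.1) * z.2.2 + dx B₀ (z.1, z.2.1) := fun z hz =>
    fderiv_affine_in_fibre hD hsub hΩ.1 As Bs ηv hz (0, 1)
  have ηxx : ∀ z ∈ phaseDomain Ω P, fderiv ℝ (fderiv ℝ η) z (0, 1, 0) (0, 1, 0)
      = dx (dx A₀) (z.1, z.2.1) * z.2.2 + dx (dx B₀) (z.1, z.2.1) := fun z hz => by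
    rw [← fderiv_fderiv_apply hD hηs hz]
    exact fderiv_affine_in_fibre hD hsub hΩ.1 (contDiffOn_dx hΩ.1 As) (contDiffOn_dx hΩ.1 Bs)
      ηx hz (0, 1)
  -- At a fixed point of `Ω` the last determining equation is an identity in ψ, and the genericity
  -- of f applies.
  have main : ∀ p ∈ Ω, fderiv ℝ τ₀ p (1, 0) = 0 ∧ (A₀ p).re = 0 ∧
      Complex.I * dt A₀ p + dx (dx A₀) p + (fderiv ℝ τ₀ p (1, 0) : ℂ) * V p
        + ((τ₀ p : ℂ) * dt V p + (ξ₀ p : ℂ) * dx V p) = 0 ∧ B₀ p = 0 := by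
    intro p hp
    refine split_fibre hPo hP0 hf hfc (l := Complex.I * dt B₀ p + dx (dx B₀) p) (v := V p) ?_
    intro ψ hψ
    have hz : (p.1, p.2, ψ) ∈ phaseDomain Ω P := ⟨hp, hψ⟩
    have h := (hso _ hz).2.2
    rw [ηt _ hz, ηxx _ hz, fderiv_lowerPart hΩ.1 hPo hP0 hf hV hz] at h
    have e1 : fderiv ℝ τ (p.1, p.2, ψ) (1, 0, 0) = fderiv ℝ τ₀ p (1, 0) := (τd _ hz (1, 0)).symm
    have e2 : (Q (p.1, p.2, ψ)).2.2 = A₀ p * ψ + B₀ p := ηv _ hz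
    have e3 : (Q (p.1, p.2, ψ)).1 = τ₀ p := τv _ hz
    have e4 : (Q (p.1, p.2, ψ)).2.1 = ξ₀ p := ξv _ hz
    have e5 : A (p.1, p.2, ψ) = A₀ p := Av _ hz
    rw [e1, e2, e3, e4, e5] at h
    simp only [lowerPart] at h
    linear_combination h
  have hτc : ∃ c : ℝ, ∀ p ∈ Ω, τ₀ p = c := by
    refine hΩ.exists_const τs (fun p hp => ?_) (fun p hp => (main p hp).1)
    rw [τd _ (heD p hp)]
    exact hinv.tau_eq hΩ.1 hPo hQ (heD p hp) 0
  obtain ⟨c, hc⟩ := hτc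
  have hξx : ∀ p ∈ Ω, fderiv ℝ ξ₀ p (0, 1) = 0 := by
    intro p hp
    have h1 := (hfo _ (heD p hp)).2.1
    have h2 := (main p hp).1
    rw [τd _ (heD p hp)] at h2
    rw [ξd _ (heD p hp)]
    have h3 : 2 * fderiv ℝ ξ (e p) (0, 1, 0) = 0 := h1.symm.trans h2
    simpa using h3
  obtain ⟨χ, hχ, hξχ⟩ := hΩ.exists_descent ξs hξx
  set S : ℝ × ℝ → ℝ := fun p => (A₀ p).im with hS
  have Ss : ContDiffOn ℝ ∞ S Ω := Complex.imCLM.contDiff.comp_contDiffOn As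
  have hAS : ∀ p ∈ Ω, A₀ p = Complex.I * (S p : ℂ) := fun p hp =>
    Complex.ext (by simp [(main p hp).2.1]) (by simp [hS])
  have hSc : ContDiffOn ℝ ∞ (fun q => Complex.I * (S q : ℂ)) Ω :=
    contDiffOn_const.mul (Complex.ofRealCLM.contDiff.comp_contDiffOn Ss)
  have hAd : ∀ p ∈ Ω, ∀ w, fderiv ℝ A₀ p w = Complex.I * (fderiv ℝ S p w : ℂ) := by
    intro p hp w
    have hSd := differentiableAt_of_contDiffOn hΩ.1 Ss hp
    have hSd' : DifferentiableAt ℝ (fun q => (S q : ℂ)) p :=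
      Complex.ofRealCLM.differentiableAt.comp p hSd
    rw [(eventuallyEq_of_eqOn hΩ.1 hAS hp).fderiv_eq, fderiv_const_mul hSd',
      ← fderiv_ofReal_comp hSd]
    rfl
  have hSx : ∀ p ∈ Ω, fderiv ℝ S p (0, 1) = deriv χ p.1 / 2 := by
    intro p hp
    have h1 := (hso _ (heD p hp)).2.1
    have h2 : fderiv ℝ A (e p) (0, 1, 0) = fderiv ℝ A₀ p (0, 1) := (Ad _ (heD p hp) (0, 1)).symm
    have h3 : fderiv ℝ ξ (e p) (1, 0, 0) = deriv χ p.1 :=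
      (ξd _ (heD p hp) (1, 0)).symm.trans (hΩ.deriv_descent ξs hξχ hp)
    rw [h2, h3, hAd p hp] at h1
    have h4 := congrArg Complex.im h1
    simp at h4
    linarith
  have hχd : ContDiffOn ℝ ∞ (deriv χ) (times Ω) := contDiffOn_deriv hΩ.isOpen_times hχ
  have hχΩ : ContDiffOn ℝ ∞ (fun p : ℝ × ℝ => deriv χ p.1 * p.2 / 2) Ω :=
    ((hχd.comp contDiffOn_fst fun p hp => mem_times hp).mul contDiffOn_snd).div_const 2
  have hχt : ∀ p ∈ Ω, fderiv ℝ (fun p : ℝ × ℝ => deriv χ p.1 * p.2 / 2) p (0, 1) = deriv χ p.1 / 2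
      ∧ fderiv ℝ (fun p : ℝ × ℝ => deriv χ p.1 * p.2 / 2) p (1, 0)
        = deriv (deriv χ) p.1 * p.2 / 2 := by
    intro p hp
    have hd := differentiableAt_of_contDiffOn hΩ.1 hχΩ hp
    constructor
    · refine (hasDerivAt_slice_x hd).unique ?_
      simpa using! ((hasDerivAt_id p.2).const_mul (deriv χ p.1)).div_const 2
    · exact (hasDerivAt_slice_t hd).unique
        (((hasDerivAt_of_contDiffOn hΩ.isOpen_times hχd (mem_times hp)).mul_const p.2).div_const 2)
  -- By `hSx` the part of S = Im A that depends on x is χ_t x/2. What is left is a function of t,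
  -- the coefficient σ of M.
  have hσΩ : ContDiffOn ℝ ∞ (fun p : ℝ × ℝ => S p - deriv χ p.1 * p.2 / 2) Ω := Ss.sub hχΩ
  have hσd : ∀ p ∈ Ω, ∀ w, fderiv ℝ (fun p : ℝ × ℝ => S p - deriv χ p.1 * p.2 / 2) p w
      = fderiv ℝ S p w - fderiv ℝ (fun p : ℝ × ℝ => deriv χ p.1 * p.2 / 2) p w := by
    intro p hp w
    rw [fderiv_fun_sub (differentiableAt_of_contDiffOn hΩ.1 Ss hp)
      (differentiableAt_of_contDiffOn hΩ.1 hχΩ hp)]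
    rfl
  obtain ⟨σ, hσ, hSσ⟩ := hΩ.exists_descent hσΩ fun p hp => by
    rw [hσd p hp, hSx p hp, (hχt p hp).1, sub_self]
  refine ⟨c, χ, σ, ⟨hχ, hσ, fun p hp => ?_⟩, fun z hz => ?_⟩
  · have h1 := (main p hp).2.2.1
    have h2 : dx (dx A₀) p = 0 := by
      have h3 : dx A₀ =ᶠ[𝓝 p] fun q => (fun t => Complex.I * ((deriv χ t / 2 : ℝ) : ℂ)) q.1 :=
        eventuallyEq_of_eqOn hΩ.1 (fun q hq => by
          change fderiv ℝ A₀ q (0, 1) = _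
          rw [hAd q hq, hSx q hq]) hp
      have h4 : ContDiffOn ℝ ∞ (dx A₀) Ω := contDiffOn_dx hΩ.1 As
      refine dx_eq (differentiableAt_of_contDiffOn hΩ.1 h4 hp) ?_
      refine (hasDerivAt_const p.2 (Complex.I * ((deriv χ p.1 / 2 : ℝ) : ℂ))).congr_of_eventuallyEq ?_
      filter_upwards [(isOpen_slice hΩ.1 p.1).mem_nhds (show p.2 ∈ {x | (p.1, x) ∈ Ω} from hp)]
        with y hy
      change fderiv ℝ A₀ (p.1, y) (0, 1) = _
      rw [hAd _ hy, hSx _ hy]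
    have h3 : dt A₀ p = Complex.I * ((deriv (deriv χ) p.1 * p.2 / 2 + deriv σ p.1 : ℝ) : ℂ) := by
      change fderiv ℝ A₀ p (1, 0) = _
      rw [hAd p hp]
      have h4 := hΩ.deriv_descent hσΩ hSσ hp
      rw [hσd p hp, (hχt p hp).2] at h4
      rw [← h4]; simp
    rw [(main p hp).1, hc p hp, hξχ p hp, h2, h3] at h1
    have hII := Complex.I_mul_I
    simp only [Complex.ofReal_zero] at h1
    linear_combination h1 -
      ((deriv (deriv χ) p.1 * p.2 / 2 + deriv σ p.1 : ℝ) : ℂ) * hII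
  · have e1 : (Q z).1 = c := (τv z hz).trans (hc _ hz.1)
    have e2 : (Q z).2.1 = χ z.1 := (ξv z hz).trans (hξχ _ hz.1)
    have e3 : (Q z).2.2 = ((deriv χ z.1 * z.2.1 / 2 + σ z.1 : ℝ) : ℂ) * (Complex.I * z.2.2) := by
      rw [show (Q z).2.2 = _ from ηv z hz, (main _ hz.1).2.2.2, hAS _ hz.1, ← hSσ _ hz.1]
      push_cast; ring
    exact Prod.ext e1 (Prod.ext e2 e3)

end Algebra

/-! ### Potentials quadratic in x and the converse of the splitting. -/

section Algebra

variable {Ω : Set (ℝ × ℝ)} {P : Set ℝ} {f : ℝ → ℂ} {V : ℝ × ℝ → ℂ}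

theorem contDiffOn_comp_fst {E : Type*} [NormedAddCommGroup E] [NormedSpace ℝ E] {k : ℝ → E}
    (hk : ContDiffOn ℝ ∞ k (times Ω)) : ContDiffOn ℝ ∞ (fun p : ℝ × ℝ => k p.1) Ω :=
  hk.comp contDiffOn_fst fun _ hp => mem_times hp

theorem contDiffOn_ofReal {E : Type*} [NormedAddCommGroup E] [NormedSpace ℝ E] {S : Set E}
    {g : E → ℝ} (hg : ContDiffOn ℝ ∞ g S) : ContDiffOn ℝ ∞ (fun z => (g z : ℂ)) S :=
  Complex.ofRealCLM.contDiff.comp_contDiffOn hg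

theorem dt_quadratic (hΩ : IsOpen Ω) {v b c : ℝ → ℂ} (hI : IsOpen (times Ω))
    (hv : ContDiffOn ℝ ∞ v (times Ω)) (hb : ContDiffOn ℝ ∞ b (times Ω))
    (hc : ContDiffOn ℝ ∞ c (times Ω))
    (h : ∀ p ∈ Ω, V p = v p.1 * (p.2 : ℂ) ^ 2 + b p.1 * p.2 + c p.1) {p : ℝ × ℝ} (hp : p ∈ Ω) :
    dt V p = deriv v p.1 * (p.2 : ℂ) ^ 2 + deriv b p.1 * p.2 + deriv c p.1 := by
  have hx : ContDiffOn ℝ ∞ (fun p : ℝ × ℝ => (p.2 : ℂ)) Ω := contDiffOn_ofReal contDiffOn_snd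
  have hs : ContDiffOn ℝ ∞ (fun p : ℝ × ℝ => v p.1 * (p.2 : ℂ) ^ 2 + b p.1 * p.2 + c p.1) Ω :=
    (((contDiffOn_comp_fst hv).mul (hx.pow 2)).add ((contDiffOn_comp_fst hb).mul hx)).add
      (contDiffOn_comp_fst hc)
  rw [dt_congr (eventuallyEq_of_eqOn hΩ h hp)]
  refine dt_eq (differentiableAt_of_contDiffOn hΩ hs hp) ?_
  have d {k : ℝ → ℂ} (hk : ContDiffOn ℝ ∞ k (times Ω)) :=
    hasDerivAt_of_contDiffOn hI hk (mem_times hp)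
  exact (((d hv).mul_const ((p.2 : ℂ) ^ 2)).add ((d hb).mul_const (p.2 : ℂ))).add (d hc)

theorem dx_quadratic (hΩ : IsOpen Ω) {v b c : ℝ → ℂ}
    (hv : ContDiffOn ℝ ∞ v (times Ω)) (hb : ContDiffOn ℝ ∞ b (times Ω))
    (hc : ContDiffOn ℝ ∞ c (times Ω))
    (h : ∀ p ∈ Ω, V p = v p.1 * (p.2 : ℂ) ^ 2 + b p.1 * p.2 + c p.1) {p : ℝ × ℝ} (hp : p ∈ Ω) :
    dx V p = 2 * v p.1 * p.2 + b p.1 := by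
  have hx : ContDiffOn ℝ ∞ (fun p : ℝ × ℝ => (p.2 : ℂ)) Ω := contDiffOn_ofReal contDiffOn_snd
  have hs : ContDiffOn ℝ ∞ (fun p : ℝ × ℝ => v p.1 * (p.2 : ℂ) ^ 2 + b p.1 * p.2 + c p.1) Ω :=
    (((contDiffOn_comp_fst hv).mul (hx.pow 2)).add ((contDiffOn_comp_fst hb).mul hx)).add
      (contDiffOn_comp_fst hc)
  rw [dx_congr (eventuallyEq_of_eqOn hΩ h hp)]
  refine dx_eq (differentiableAt_of_contDiffOn hΩ hs hp) ?_
  have hid : HasDerivAt (fun y : ℝ => (y : ℂ)) 1 p.2 := Complex.ofRealCLM.hasDerivAt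
  refine ((((hid.pow 2).const_mul (v p.1)).add (hid.const_mul (b p.1))).add_const
    (c p.1)).congr_deriv ?_
  simp; ring

/-- Only a neighbourhood of one point of the slice is available. The values at x and x ± ε/2 give
the three coefficients by a second difference, a first difference and one value. -/
theorem quadratic_eq_zero (hΩ : IsOpen Ω) {t : ℝ} (ht : t ∈ times Ω) {a b c : ℂ}
    (h : ∀ x : ℝ, (t, x) ∈ Ω → a * (x : ℂ) ^ 2 + b * x + c = 0) : a = 0 ∧ b = 0 ∧ c = 0 := by
  obtain ⟨x, hx⟩ := exists_of_mem_times ht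
  obtain ⟨ε, hε, hb⟩ := Metric.isOpen_iff.1 (isOpen_slice hΩ t) x hx
  have hm : ∀ r : ℝ, |r| < ε → (t, x + r) ∈ Ω := fun r hr => hb (by
    rw [Metric.mem_ball, Real.dist_eq]; simpa using hr)
  have h0 := h x hx
  have h1 := h _ (hm (ε / 2) (by rw [abs_of_pos (half_pos hε)]; linarith))
  have h2 := h _ (hm (-(ε / 2)) (by rw [abs_neg, abs_of_pos (half_pos hε)]; linarith))
  have hε' : (ε : ℂ) ≠ 0 := by exact_mod_cast hε.ne'
  push_cast at h1 h2
  have ha : a = 0 := by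
    refine (mul_eq_zero.1 (?_ : a * (ε : ℂ) ^ 2 = 0)).resolve_right (pow_ne_zero 2 hε')
    linear_combination 2 * (h1 + h2 - 2 * h0)
  have hb : b = 0 := by
    refine (mul_eq_zero.1 (?_ : b * (ε : ℂ) = 0)).resolve_right hε'
    rw [ha] at h1 h2
    linear_combination h1 - h2
  refine ⟨ha, hb, ?_⟩
  rw [ha, hb] at h0
  linear_combination h0

/-! ### Invariance of the fields `τ ∂_t + G(χ) + σ M` -/

theorem contDiffOn_symField (hI : IsOpen (times Ω)) {τ : ℝ} {χ σ : ℝ → ℝ}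
    (hχ : ContDiffOn ℝ ∞ χ (times Ω)) (hσ : ContDiffOn ℝ ∞ σ (times Ω)) :
    ContDiffOn ℝ ∞ (symField τ χ σ) (phaseDomain Ω P) := by
  have hm : MapsTo (fun z : Space => z.1) (phaseDomain Ω P) (times Ω) := fun z hz => mem_times hz.1
  have h1 : ContDiffOn ℝ ∞ (fun z : Space => χ z.1) (phaseDomain Ω P) :=
    hχ.comp contDiffOn_fst hm
  have h2 : ContDiffOn ℝ ∞ (fun z : Space => deriv χ z.1) (phaseDomain Ω P) :=
    (contDiffOn_deriv hI hχ).comp contDiffOn_fst hm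
  have h3 : ContDiffOn ℝ ∞ (fun z : Space => σ z.1) (phaseDomain Ω P) :=
    hσ.comp contDiffOn_fst hm
  refine contDiffOn_const.prodMk (h1.prodMk ?_)
  exact (contDiffOn_ofReal (((h2.mul (by fun_prop)).div_const 2).add h3)).mul (by fun_prop)

/-- The prolonged action equals iS times the left-hand side of the equation plus ψ times the
classifying condition, where S = χ_t x/2 + σ. -/
theorem IsSymmetry.isInvariant (hΩ : IsTXDomain Ω) (hPo : IsOpen P)
    (hP0 : P ⊆ Ioi 0) (hf : ContDiffOn ℝ ∞ f P) (hV : ContDiffOn ℝ ∞ V Ω) {τ : ℝ} {χ σ : ℝ → ℝ}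
    (h : IsSymmetry Ω V τ χ σ) : IsInvariant f P V Ω (symField τ χ σ) := by
  obtain ⟨hχ, hσ, h⟩ := h
  intro u hu p hp hpP hnls
  have hI := hΩ.isOpen_times
  have hχ' := contDiffOn_deriv hI hχ
  have hr {k : ℝ → ℝ} (hk : ContDiffOn ℝ ∞ k (times Ω)) :
      ContDiffOn ℝ ∞ (fun t => (k t : ℂ)) (times Ω) := contDiffOn_ofReal hk
  have dr {k : ℝ → ℝ} (hk : ContDiffOn ℝ ∞ k (times Ω)) :
      deriv (fun t => (k t : ℂ)) p.1 = ((deriv k p.1 : ℝ) : ℂ) :=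
    (hasDerivAt_of_contDiffOn hI hk (mem_times hp)).ofReal_comp.deriv
  have hz0 : ContDiffOn ℝ ∞ (fun _ : ℝ => (0 : ℂ)) (times Ω) := contDiffOn_const
  set S : ℝ × ℝ → ℂ := fun q => ((deriv χ q.1 * q.2 / 2 + σ q.1 : ℝ) : ℂ) with hS
  have hb : ContDiffOn ℝ ∞ (fun t => ((deriv χ t / 2 : ℝ) : ℂ)) (times Ω) := hr (hχ'.div_const 2)
  have hSq : ∀ q ∈ Ω, S q = (fun _ => (0 : ℂ)) q.1 * (q.2 : ℂ) ^ 2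
      + (fun t => ((deriv χ t / 2 : ℝ) : ℂ)) q.1 * q.2 + (fun t => (σ t : ℂ)) q.1 := by
    intro q _
    simp only [hS]; push_cast; ring
  have hSs : ContDiffOn ℝ ∞ S Ω := contDiffOn_ofReal
    ((((contDiffOn_comp_fst hχ').mul contDiffOn_snd).div_const 2).add (contDiffOn_comp_fst hσ))
  have hSt : dt S p = ((deriv (deriv χ) p.1 * p.2 / 2 + deriv σ p.1 : ℝ) : ℂ) := by
    rw [dt_quadratic hΩ.1 hI hz0 hb (hr hσ) hSq hp, dr hσ, dr (hχ'.div_const 2)]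
    simp; ring
  have hSx : ∀ q ∈ Ω, dx S q = ((deriv χ q.1 / 2 : ℝ) : ℂ) := by
    intro q hq
    rw [dx_quadratic hΩ.1 hz0 hb (hr hσ) hSq hq]; simp
  have hq0 : ∀ k : ℝ → ℂ, ContDiffOn ℝ ∞ k (times Ω) → ∀ q ∈ Ω, dx (fun q => k q.1) q = 0 := by
    intro k hk q hq
    rw [dx_quadratic hΩ.1 hz0 hz0 hk (fun q _ => by simp) hq]; simp
  have hSxx : dx (dx S) p = 0 := by
    rw [dx_congr (eventuallyEq_of_eqOn hΩ.1 hSx hp)]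
    exact hq0 _ hb p hp
  have hu' : ContDiffOn ℝ ∞ (fun q => Complex.I * u q) Ω := contDiffOn_const.mul hu.contDiffOn
  have hud := hu.differentiable (by simp)
  have hdc : Differentiable ℝ fun _ : ℝ × ℝ => Complex.I := differentiable_const _
  have hIx : ∀ q, dx (fun q => Complex.I * u q) q = Complex.I * dx u q := by
    intro q
    rw [dx_mul (hdc q) (hud q)]; simp [dx]
  have hIt : dt (fun q => Complex.I * u q) p = Complex.I * dt u p := by
    rw [dt_mul (hdc p) (hud p)]; simp [dt]
  have hIxx : dx (dx fun q => Complex.I * u q) p = Complex.I * dx (dx u) p := by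
    rw [funext hIx]
    have : DifferentiableAt ℝ (dx u) p := differentiableAt_of_contDiffOn isOpen_univ
      (contDiffOn_dx isOpen_univ hu.contDiffOn) (mem_univ p)
    rw [dx_mul (hdc p) this]; simp [dx]
  have hH1 : dt (fun q => S q * (Complex.I * u q)) p
      = dt S p * (Complex.I * u p) + S p * (Complex.I * dt u p) := by
    rw [dt_mul (differentiableAt_of_contDiffOn hΩ.1 hSs hp)
      (differentiableAt_of_contDiffOn hΩ.1 hu' hp), hIt]
  have hH2 : dx (dx fun q => S q * (Complex.I * u q)) p
      = 2 * ((deriv χ p.1 / 2 : ℝ) : ℂ) * (Complex.I * dx u p)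
        + S p * (Complex.I * dx (dx u) p) := by
    rw [dx_dx_mul hΩ.1 hSs hu' hp, hSxx, hSx p hp, hIx, hIxx]; ring
  have hX1 : dt (fun q => (χ q.1 : ℂ)) p = ((deriv χ p.1 : ℝ) : ℂ) := by
    rw [dt_quadratic hΩ.1 hI hz0 hz0 (hr hχ) (fun q _ => by simp) hp, dr hχ]; simp
  have hX2 : ∀ q ∈ Ω, dx (fun q => (χ q.1 : ℂ)) q = 0 := hq0 _ (hr hχ)
  have hX3 : dx (dx fun q => (χ q.1 : ℂ)) p = 0 := by
    rw [dx_congr (eventuallyEq_of_eqOn hΩ.1 hX2 hp)]; simp [dx]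
  have hT2 : dx (fun _ : ℝ × ℝ => (τ : ℂ)) = fun _ => 0 := by funext q; simp [dx]
  have hT1 : dt (fun _ : ℝ × ℝ => (τ : ℂ)) p = 0 := by simp [dt]
  have hT3 : dx (dx fun _ : ℝ × ℝ => (τ : ℂ)) p = 0 := by rw [hT2]; simp [dx]
  rw [prolongedAction_eq hΩ.1 hPo (contDiffOn_symField hI hχ hσ) hu hp hpP
    (H := fun q => S q * (Complex.I * u q)) (T := fun _ => (τ : ℂ)) (X := fun q => (χ q.1 : ℂ))
    rfl rfl rfl, fderiv_lowerPart hΩ.1 hPo hP0 hf hV (z := (p.1, p.2, u p)) ⟨hp, hpP⟩,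
    hH1, hH2, hX1, hX2 p hp, hX3, hT1, hT3, hT2, hSt]
  -- The ψ-component is a real multiple of iψ, hence orthogonal to ψ: the field preserves |ψ| and f
  -- is not differentiated.
  have hin : inner ℝ (u p) (symField τ χ σ (p.1, p.2, u p)).2.2 = 0 := by
    simp only [symField, Complex.inner]
    simp; ring
  rw [hin]
  have h1 := h p hp
  have e1 : (symField τ χ σ (p.1, p.2, u p)).1 = τ := rfl
  have e2 : (symField τ χ σ (p.1, p.2, u p)).2.1 = χ p.1 := rfl
  have e3 : (symField τ χ σ (p.1, p.2, u p)).2.2 = S p * (Complex.I * u p) := rfl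
  have e4 : V ((p.1, p.2, u p).1, (p.1, p.2, u p).2.1) = V p := rfl
  simp only [e1, e2, e3]
  rw [nls] at hnls
  simp only [Prod.mk.eta, zero_div, Complex.ofReal_zero]
  push_cast at h1 ⊢
  linear_combination (u p) * h1 + S p * Complex.I * hnls +
    (((deriv (deriv χ) p.1 : ℝ) : ℂ) * p.2 / 2 + ((deriv σ p.1 : ℝ) : ℂ)) * u p * Complex.I_mul_I

theorem mem_lieAlgebra_iff (hΩ : IsTXDomain Ω) (hPo : IsOpen P) (hPc : P.OrdConnected)
    (hP0 : P ⊆ Ioi 0) (hf : ContDiffOn ℝ ∞ f P)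
    (hfc : ¬ ∃ c : ℝ, ∀ ρ ∈ P, (ρ : ℂ) * deriv (deriv f) ρ = (c : ℂ) * deriv f ρ)
    (hV : ContDiffOn ℝ ∞ V Ω) {R : phaseDomain Ω P → Space} :
    R ∈ lieAlgebra f P Ω V ↔
      ∃ τ χ σ, IsSymmetry Ω V τ χ σ ∧ (phaseDomain Ω P).domRestrict (symField τ χ σ) = R := by
  constructor
  · rintro ⟨Q, hQ, rfl, hinv⟩
    obtain ⟨τ, χ, σ, h, he⟩ := hinv.exists_symField hΩ hPo hPc hP0 hf hfc hV hQ
    exact ⟨τ, χ, σ, h, funext fun z => (he z z.2).symm⟩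
  · rintro ⟨τ, χ, σ, h, rfl⟩
    exact ⟨_, contDiffOn_symField hΩ.isOpen_times h.1 h.2.1, rfl,
      h.isInvariant hΩ hPo hP0 hf hV⟩

theorem exists_mem_phaseDomain (hP : P.Nonempty) (hP0 : P ⊆ Ioi 0) :
    ∃ ψ : ℂ, ψ ≠ 0 ∧ ∀ p ∈ Ω, (p.1, p.2, ψ) ∈ phaseDomain Ω P := by
  obtain ⟨ρ, hρ⟩ := hP
  have h0 : 0 < ρ := hP0 hρ
  exact ⟨ρ, by exact_mod_cast h0.ne', fun p hp => ⟨hp, by simpa [abs_of_pos h0] using hρ⟩⟩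

theorem deriv_congr_of_isOpen {E : Type*} [NormedAddCommGroup E] [NormedSpace ℝ E] {I : Set ℝ}
    (hI : IsOpen I) {g h : ℝ → E} (hgh : ∀ t ∈ I, g t = h t) {t : ℝ} (ht : t ∈ I) :
    deriv g t = deriv h t := by
  refine Filter.EventuallyEq.deriv_eq ?_
  filter_upwards [hI.mem_nhds ht] with s hs using hgh s hs

/-- One nonzero ψ suffices. On the open set of times χ determines χ_t, after which σ can be read off
the ψ-component. -/
theorem symField_inj (hI : IsOpen (times Ω)) (hN : Ω.Nonempty) (hP : P.Nonempty)
    (hP0 : P ⊆ Ioi 0) {τ τ' : ℝ} {χ χ' σ σ' : ℝ → ℝ}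
    (h : (phaseDomain Ω P).domRestrict (symField τ χ σ)
      = (phaseDomain Ω P).domRestrict (symField τ' χ' σ')) :
    τ = τ' ∧ ∀ t ∈ times Ω, χ t = χ' t ∧ σ t = σ' t := by
  obtain ⟨ψ, hψ, hψΩ⟩ := exists_mem_phaseDomain (Ω := Ω) hP hP0
  have hp : ∀ p ∈ Ω, symField τ χ σ (p.1, p.2, ψ) = symField τ' χ' σ' (p.1, p.2, ψ) :=
    fun p hp => congrFun h ⟨_, hψΩ p hp⟩
  have hχ : ∀ t ∈ times Ω, χ t = χ' t := by
    rintro t ⟨p, hpΩ, rfl⟩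
    exact congrArg (fun z => z.2.1) (hp p hpΩ)
  obtain ⟨q, hq⟩ := hN
  refine ⟨congrArg (fun z => z.1) (hp q hq), fun t ht => ⟨hχ t ht, ?_⟩⟩
  obtain ⟨p, hpΩ, rfl⟩ := ht
  have h3 := congrArg (fun z => z.2.2) (hp p hpΩ)
  simp only [symField] at h3
  have h4 := mul_right_cancel₀ (mul_ne_zero Complex.I_ne_zero hψ) h3
  rw [deriv_congr_of_isOpen hI hχ (mem_times hpΩ)] at h4
  have h5 := Complex.ofReal_injective h4
  linarith

theorem symField_congr (hI : IsOpen (times Ω)) {τ τ' : ℝ} {χ χ' σ σ' : ℝ → ℝ} (hτ : τ = τ')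
    (h : ∀ t ∈ times Ω, χ t = χ' t ∧ σ t = σ' t) :
    (phaseDomain Ω P).domRestrict (symField τ χ σ)
      = (phaseDomain Ω P).domRestrict (symField τ' χ' σ') := by
  funext z
  have hz := mem_times z.2.1
  have h1 := deriv_congr_of_isOpen hI (fun t ht => (h t ht).1) hz
  simp only [domRestrict_apply, symField, hτ]
  simp only at hz h1
  rw [(h _ hz).1, (h _ hz).2, h1]

theorem isBasisOf_of {U : Set Space} {n : ℕ} {b : Fin n → Space → Space} {S : Set (U → Space)}
    (h1 : ∀ c : Fin n → ℝ, (∀ z ∈ U, ∑ i, c i • b i z = 0) → ∀ i, c i = 0)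
    (h2 : ∀ R, R ∈ S ↔ ∃ c : Fin n → ℝ, U.domRestrict (fun z => ∑ i, c i • b i z) = R) :
    IsBasisOf b S := by
  have hsum : ∀ c : Fin n → ℝ, ∑ i, c i • U.domRestrict (b i)
      = U.domRestrict (fun z => ∑ i, c i • b i z) := by
    intro c
    funext z
    simp
  refine ⟨?_, ?_⟩
  · rw [Fintype.linearIndependent_iff]
    intro c hc
    rw [hsum] at hc
    exact h1 c fun z hz => congrFun hc ⟨z, hz⟩
  · ext R
    rw [h2, SetLike.mem_coe, Submodule.mem_span_range_iff_exists_fun]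
    simp only [hsum]

end Algebra

/-- The nonlinearities under consideration. -/
structure IsNonlinearity (f : ℝ → ℂ) (P : Set ℝ) : Prop where
  isOpen : IsOpen P
  ordConnected : P.OrdConnected
  pos : P ⊆ Ioi 0
  contDiffOn : ContDiffOn ℝ ∞ f P
  generic : ¬ ∃ c : ℝ, ∀ ρ ∈ P, (ρ : ℂ) * deriv (deriv f) ρ = (c : ℂ) * deriv f ρ

/-! ### The kernel algebra and the bases of the extended algebras. -/

section Bases

variable {Ω : Set (ℝ × ℝ)} {P : Set ℝ} {f : ℝ → ℂ} {V : ℝ × ℝ → ℂ}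

theorem IsNonlinearity.nonempty (hf : IsNonlinearity f P) : P.Nonempty := by
  obtain ⟨ρ, hρ, -⟩ := exists_deriv_ne_zero hf.isOpen hf.generic
  exact ⟨ρ, hρ⟩

theorem IsNonlinearity.mem_lieAlgebra_iff (hf : IsNonlinearity f P) (hΩ : IsTXDomain Ω)
    (hV : ContDiffOn ℝ ∞ V Ω) {R : phaseDomain Ω P → Space} :
    R ∈ lieAlgebra f P Ω V ↔
      ∃ τ χ σ, IsSymmetry Ω V τ χ σ ∧ (phaseDomain Ω P).domRestrict (symField τ χ σ) = R :=
  NLS.mem_lieAlgebra_iff hΩ hf.isOpen hf.ordConnected hf.pos hf.contDiffOn hf.generic hV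

theorem exists_const_of_deriv_eq_zero {I : Set ℝ} (ho : IsOpen I) (hc : I.OrdConnected)
    (hn : I.Nonempty) {E : Type*} [NormedAddCommGroup E] [NormedSpace ℝ E] {k : ℝ → E}
    (hk : ContDiffOn ℝ ∞ k I) (h0 : ∀ t ∈ I, deriv k t = 0) : ∃ c, ∀ t ∈ I, k t = c := by
  obtain ⟨t₀, h₀⟩ := hn
  refine ⟨k t₀, fun t ht => eq_of_deriv_eq_zero ho hc (fun s hs => ?_) ht h₀⟩
  have := hasDerivAt_of_contDiffOn ho hk hs
  rwa [h0 s hs] at this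

theorem isSymmetry_M (c : ℝ) : IsSymmetry Ω V 0 (fun _ => 0) (fun _ => c) :=
  ⟨contDiffOn_const, contDiffOn_const, fun p _ => by simp⟩

theorem symField_M (c : ℝ) (z : Space) : symField 0 (fun _ => 0) (fun _ => c) z = c • fieldM z := by
  simp [symField, fieldM]

theorem IsNonlinearity.M_mem (hf : IsNonlinearity f P) (hΩ : IsTXDomain Ω) (c : ℝ) :
    (phaseDomain Ω P).domRestrict (symField 0 (fun _ => 0) (fun _ => c)) ∈ kernelAlgebra f P Ω :=
  mem_iInter₂.2 fun _ hV => (hf.mem_lieAlgebra_iff hΩ hV).2 ⟨_, _, _, isSymmetry_M c, rfl⟩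

/-- Two test potentials suffice. The right-hand side of the classifying condition is real, so V = it
gives τ = 0 and V = ix gives χ = 0. Then σ_t = 0 follows. -/
theorem IsNonlinearity.mem_kernelAlgebra_iff (hf : IsNonlinearity f P) (hΩ : IsTXDomain Ω)
    {R : phaseDomain Ω P → Space} :
    R ∈ kernelAlgebra f P Ω ↔
      ∃ c : ℝ, (phaseDomain Ω P).domRestrict (symField 0 (fun _ => 0) (fun _ => c)) = R := by
  constructor
  · intro hR
    have hI := hΩ.isOpen_times
    have hR' : ∀ V : ℝ × ℝ → ℂ, ContDiffOn ℝ ∞ V Ω → R ∈ lieAlgebra f P Ω V := fun V hV =>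
      mem_iInter₂.1 hR V hV
    have hlin : ∀ a b : ℂ, ∃ τ χ σ, (phaseDomain Ω P).domRestrict (symField τ χ σ) = R ∧
        ContDiffOn ℝ ∞ χ (times Ω) ∧ ContDiffOn ℝ ∞ σ (times Ω) ∧
        ∀ p ∈ Ω, (τ : ℂ) * a + (χ p.1 : ℂ) * b
          = ((deriv (deriv χ) p.1 * p.2 / 2 + deriv σ p.1 : ℝ) : ℂ) := by
      intro a b
      have ht : ContDiffOn ℝ ∞ (fun t : ℝ => a * (t : ℂ)) (times Ω) :=
        contDiffOn_const.mul (contDiffOn_ofReal contDiffOn_id)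
      have hV : ContDiffOn ℝ ∞ (fun p : ℝ × ℝ => a * (p.1 : ℂ) + b * (p.2 : ℂ)) Ω :=
        (contDiffOn_const.mul (contDiffOn_ofReal contDiffOn_fst)).add
          (contDiffOn_const.mul (contDiffOn_ofReal contDiffOn_snd))
      obtain ⟨τ, χ, σ, ⟨hχ, hσ, h⟩, hR⟩ := (hf.mem_lieAlgebra_iff hΩ hV).1 (hR' _ hV)
      refine ⟨τ, χ, σ, hR, hχ, hσ, fun p hp => ?_⟩
      have hq : ∀ q ∈ Ω, a * (q.1 : ℂ) + b * (q.2 : ℂ)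
          = (fun _ => (0 : ℂ)) q.1 * (q.2 : ℂ) ^ 2 + (fun _ => b) q.1 * q.2
            + (fun t : ℝ => a * (t : ℂ)) q.1 := fun q _ => by ring
      have hd : deriv (fun t : ℝ => a * (t : ℂ)) p.1 = a := by
        have hid : HasDerivAt (fun y : ℝ => (y : ℂ)) 1 p.1 := Complex.ofRealCLM.hasDerivAt
        simpa using (hid.const_mul a).deriv
      rw [← h p hp, dt_quadratic hΩ.1 hI contDiffOn_const contDiffOn_const ht hq hp,
        dx_quadratic hΩ.1 contDiffOn_const contDiffOn_const ht hq hp, hd]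
      simp
    obtain ⟨τ, χ, σ, hR₁, hχ, hσ, h₁⟩ := hlin Complex.I 0
    obtain ⟨τ₂, χ₂, σ₂, hR₂, -, -, h₂⟩ := hlin 0 Complex.I
    obtain ⟨p₀, hp₀⟩ := hΩ.2.1
    have hτ : τ = 0 := by
      have := congrArg Complex.im (h₁ p₀ hp₀)
      simpa using this
    obtain ⟨-, he⟩ := symField_inj hI hΩ.2.1 hf.nonempty hf.pos (hR₁.trans hR₂.symm)
    have hχ0 : ∀ t ∈ times Ω, χ t = 0 := by
      rintro t ⟨p, hp, rfl⟩
      rw [(he _ (mem_times hp)).1]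
      have := congrArg Complex.im (h₂ p hp)
      simpa using this
    have hχ1 : ∀ t ∈ times Ω, deriv χ t = 0 := fun t ht => by
      rw [deriv_congr_of_isOpen hI hχ0 ht]; simp
    have hσ0 : ∀ t ∈ times Ω, deriv σ t = 0 := by
      rintro t ⟨p, hp, rfl⟩
      have h := h₁ p hp
      rw [hτ, hχ0 _ (mem_times hp), deriv_congr_of_isOpen hI hχ1 (mem_times hp)] at h
      have h2 := congrArg Complex.re h
      simpa using h2.symm
    obtain ⟨c, hc⟩ := exists_const_of_deriv_eq_zero hI hΩ.ordConnected_times hΩ.nonempty_times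
      hσ hσ0
    exact ⟨c, by rw [← hR₁]; exact symField_congr hI hτ.symm fun t ht => ⟨(hχ0 t ht).symm, (hc t ht).symm⟩⟩
  · rintro ⟨c, rfl⟩
    exact hf.M_mem hΩ c

theorem IsNonlinearity.isBasisOf_kernelAlgebra (hf : IsNonlinearity f P) (hΩ : IsTXDomain Ω) :
    IsBasisOf ![fieldM] (kernelAlgebra f P Ω) := by
  refine isBasisOf_of (fun c h => ?_) fun R => ?_
  · obtain ⟨ψ, hψ, hψΩ⟩ := exists_mem_phaseDomain (Ω := Ω) hf.nonempty hf.pos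
    obtain ⟨p, hp⟩ := hΩ.2.1
    have := congrArg (fun z => z.2.2) (h _ (hψΩ p hp))
    intro i
    fin_cases i
    simpa [fieldM, hψ] using this
  · rw [hf.mem_kernelAlgebra_iff hΩ]
    constructor
    · rintro ⟨c, rfl⟩
      exact ⟨fun _ => c, by funext z; simp [symField_M]⟩
    · rintro ⟨c, rfl⟩
      exact ⟨c 0, by funext z; simp [symField_M]⟩

/-- The algebra is extended exactly if there is an invariance field outside `⟨M⟩`. -/
theorem IsNonlinearity.lieAlgebra_ne_iff (hf : IsNonlinearity f P) (hΩ : IsTXDomain Ω)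
    (hV : ContDiffOn ℝ ∞ V Ω) :
    lieAlgebra f P Ω V ≠ kernelAlgebra f P Ω ↔
      ∃ τ χ σ, IsSymmetry Ω V τ χ σ ∧ (τ ≠ 0 ∨ ∃ t ∈ times Ω, χ t ≠ 0) := by
  have hI := hΩ.isOpen_times
  constructor
  · intro hne
    by_contra! hcon
    refine hne (Subset.antisymm (fun R hR => ?_) fun R hR => mem_iInter₂.1 hR V hV)
    obtain ⟨τ, χ, σ, h, rfl⟩ := (hf.mem_lieAlgebra_iff hΩ hV).1 hR
    obtain ⟨hτ, hχ0⟩ := hcon τ χ σ h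
    have hχ1 : ∀ t ∈ times Ω, deriv χ t = 0 := fun t ht => by
      rw [deriv_congr_of_isOpen hI hχ0 ht]; simp
    have hσ0 : ∀ t ∈ times Ω, deriv σ t = 0 := by
      rintro t ⟨p, hp, rfl⟩
      have h := h.2.2 p hp
      rw [hτ, hχ0 _ (mem_times hp), deriv_congr_of_isOpen hI hχ1 (mem_times hp)] at h
      have h2 := congrArg Complex.re h
      simpa using h2.symm
    obtain ⟨c, hc⟩ := exists_const_of_deriv_eq_zero hI hΩ.ordConnected_times hΩ.nonempty_times
      h.2.1 hσ0
    rw [hf.mem_kernelAlgebra_iff hΩ]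
    exact ⟨c, symField_congr hI hτ.symm fun t ht => ⟨(hχ0 t ht).symm, (hc t ht).symm⟩⟩
  · rintro ⟨τ, χ, σ, h, hne⟩ heq
    have hR : (phaseDomain Ω P).domRestrict (symField τ χ σ) ∈ lieAlgebra f P Ω V :=
      (hf.mem_lieAlgebra_iff hΩ hV).2 ⟨τ, χ, σ, h, rfl⟩
    rw [heq, hf.mem_kernelAlgebra_iff hΩ] at hR
    obtain ⟨c, hc⟩ := hR
    obtain ⟨h1, h2⟩ := symField_inj hI hΩ.2.1 hf.nonempty hf.pos hc
    rcases hne with hτ | ⟨t, ht, hχ⟩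
    · exact hτ h1.symm
    · exact hχ (h2 t ht).1.symm

/-! ### Fundamental systems -/

/-- A vanishing combination also has vanishing derivative at t₀, so Cramer's rule applies at this
one point. -/
theorem IsFundamentalSystem.of_wronskian {I : Set ℝ} (ho : IsOpen I) {v χ₁ χ₂ : ℝ → ℝ}
    (h1 : ContDiffOn ℝ ∞ χ₁ I) (h2 : ContDiffOn ℝ ∞ χ₂ I)
    (e1 : ∀ t ∈ I, deriv (deriv χ₁) t = 4 * v t * χ₁ t)
    (e2 : ∀ t ∈ I, deriv (deriv χ₂) t = 4 * v t * χ₂ t) {t₀ : ℝ} (h₀ : t₀ ∈ I)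
    (hW : χ₁ t₀ * deriv χ₂ t₀ - deriv χ₁ t₀ * χ₂ t₀ ≠ 0) : IsFundamentalSystem v I χ₁ χ₂ := by
  refine ⟨h1, h2, e1, e2, fun c₁ c₂ hc => ?_⟩
  have a := hc t₀ h₀
  have b : c₁ * deriv χ₁ t₀ + c₂ * deriv χ₂ t₀ = 0 := by
    have hd := ((hasDerivAt_of_contDiffOn ho h1 h₀).const_mul c₁).add
      ((hasDerivAt_of_contDiffOn ho h2 h₀).const_mul c₂)
    have hz : HasDerivAt (fun _ : ℝ => (0 : ℝ)) _ t₀ := hd.congr_of_eventuallyEq (by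
      filter_upwards [ho.mem_nhds h₀] with s hs using (hc s hs).symm)
    exact hz.unique (hasDerivAt_const t₀ 0)
  constructor
  · refine (mul_eq_zero.1 (?_ : c₁ * _ = 0)).resolve_right hW
    linear_combination deriv χ₂ t₀ * a - χ₂ t₀ * b
  · refine (mul_eq_zero.1 (?_ : c₂ * _ = 0)).resolve_right hW
    linear_combination χ₁ t₀ * b - deriv χ₁ t₀ * a

theorem exists_isFundamentalSystem {I : Set ℝ} (ho : IsOpen I) (hc : I.OrdConnected)
    (hn : I.Nonempty) {v : ℝ → ℝ} (hv : ContDiffOn ℝ ∞ v I) :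
    ∃ χ₁ χ₂, IsFundamentalSystem v I χ₁ χ₂ := by
  obtain ⟨t₀, h₀⟩ := hn
  have hh : ContDiffOn ℝ ∞ (fun t => 4 * v t) I := contDiffOn_const.mul hv
  obtain ⟨χ₁, s1, a1, b1, e1⟩ := exists_second_order ho hc hh (k := fun _ => 0) contDiffOn_const
    h₀ 1 0
  obtain ⟨χ₂, s2, a2, b2, e2⟩ := exists_second_order ho hc hh (k := fun _ => 0) contDiffOn_const
    h₀ 0 1
  exact ⟨χ₁, χ₂, .of_wronskian ho s1 s2 (fun t ht => by rw [e1 t ht, add_zero])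
    (fun t ht => by rw [e2 t ht, add_zero]) h₀ (by rw [a1, b1, a2, b2]; norm_num)⟩

/-- The coefficients are given by Cramer's rule from the Cauchy data at t₀, once linear independence
has made the Wronskian there nonzero. -/
theorem IsFundamentalSystem.exists_combination {I : Set ℝ} (ho : IsOpen I) (hc : I.OrdConnected)
    (hn : I.Nonempty) {v χ₁ χ₂ χ : ℝ → ℝ} (hv : ContDiffOn ℝ ∞ v I)
    (h : IsFundamentalSystem v I χ₁ χ₂) (hχ : ContDiffOn ℝ ∞ χ I)
    (e : ∀ t ∈ I, deriv (deriv χ) t = 4 * v t * χ t) :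
    ∃ c₁ c₂ : ℝ, ∀ t ∈ I, χ t = c₁ * χ₁ t + c₂ * χ₂ t := by
  obtain ⟨t₀, h₀⟩ := hn
  obtain ⟨h1, h2, e1, e2, hind⟩ := h
  -- a combination of solutions is determined by its Cauchy data
  have key : ∀ a b c : ℝ, a * χ t₀ + b * χ₁ t₀ + c * χ₂ t₀ = 0 →
      a * deriv χ t₀ + b * deriv χ₁ t₀ + c * deriv χ₂ t₀ = 0 →
      ∀ t ∈ I, a * χ t + b * χ₁ t + c * χ₂ t = 0 := by
    intro a b c hz hz' t ht
    have hd1 : ∀ s ∈ I, HasDerivAt (fun t => a * χ t + b * χ₁ t + c * χ₂ t)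
        (a * deriv χ s + b * deriv χ₁ s + c * deriv χ₂ s) s := fun s hs =>
      (((hasDerivAt_of_contDiffOn ho hχ hs).const_mul a).add
        ((hasDerivAt_of_contDiffOn ho h1 hs).const_mul b)).add
        ((hasDerivAt_of_contDiffOn ho h2 hs).const_mul c)
    have hd2 : ∀ s ∈ I, HasDerivAt (fun t => a * deriv χ t + b * deriv χ₁ t + c * deriv χ₂ t)
        (a * deriv (deriv χ) s + b * deriv (deriv χ₁) s + c * deriv (deriv χ₂) s) s := fun s hs =>
      (((hasDerivAt_of_contDiffOn ho (contDiffOn_deriv ho hχ) hs).const_mul a).add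
        ((hasDerivAt_of_contDiffOn ho (contDiffOn_deriv ho h1) hs).const_mul b)).add
        ((hasDerivAt_of_contDiffOn ho (contDiffOn_deriv ho h2) hs).const_mul c)
    refine eq_zero_of_second_order (h := fun t => 4 * v t) ho hc
      (continuousOn_const.mul hv.continuousOn)
      (χ := fun t => a * χ t + b * χ₁ t + c * χ₂ t)
      (((contDiffOn_const.mul hχ).add (contDiffOn_const.mul h1)).add (contDiffOn_const.mul h2))
      (fun s hs => ?_) h₀ hz (by rw [(hd1 t₀ h₀).deriv, hz']) ht
    rw [deriv_congr_of_isOpen ho (fun r hr => (hd1 r hr).deriv) hs, (hd2 s hs).deriv, e s hs,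
      e1 s hs, e2 s hs]
    ring
  set W := χ₁ t₀ * deriv χ₂ t₀ - deriv χ₁ t₀ * χ₂ t₀ with hWdef
  -- If W = 0, the combinations with coefficients (χ₂', -χ₁') and (χ₂, -χ₁) taken at t₀ have zero
  -- Cauchy data and hence vanish. Independence makes all data of χ₁ and χ₂ zero, so χ₁ ≡ 0, a
  -- contradiction.
  have hW : W ≠ 0 := by
    intro hW
    have k1 := hind (deriv χ₂ t₀) (-deriv χ₁ t₀) fun t ht => by
      linear_combination
        key 0 (deriv χ₂ t₀) (-deriv χ₁ t₀) (by linear_combination hW) (by ring) t ht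
    have k2 := hind (χ₂ t₀) (-χ₁ t₀) fun t ht => by
      linear_combination key 0 (χ₂ t₀) (-χ₁ t₀) (by ring) (by linear_combination -hW) t ht
    have k3 := hind 1 0 fun t ht => by
      linear_combination key 0 1 0 (by linear_combination -k2.2) (by linear_combination -k1.2) t ht
    exact one_ne_zero k3.1
  refine ⟨(χ t₀ * deriv χ₂ t₀ - deriv χ t₀ * χ₂ t₀) / W,
    (χ₁ t₀ * deriv χ t₀ - deriv χ₁ t₀ * χ t₀) / W, fun t ht => ?_⟩
  have := key W (-(χ t₀ * deriv χ₂ t₀ - deriv χ t₀ * χ₂ t₀))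
    (-(χ₁ t₀ * deriv χ t₀ - deriv χ₁ t₀ * χ t₀)) (by rw [hWdef]; ring) (by rw [hWdef]; ring) t ht
  field_simp
  linear_combination this

/-! ### Quadratic potentials -/

/-- The classifying condition is compared power by power in x. Its x-free part splits once more: the
imaginary part contains τ w_t, the real part σ_t. -/
theorem isSymmetry_quadratic_iff (hΩ : IsTXDomain Ω) {v w : ℝ → ℝ}
    (hv : ContDiffOn ℝ ∞ v (times Ω)) (hw : ContDiffOn ℝ ∞ w (times Ω))
    (hV : ∀ p ∈ Ω, V p = ((v p.1 * p.2 ^ 2 : ℝ) : ℂ) + Complex.I * (w p.1 : ℂ))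
    {τ : ℝ} {χ σ : ℝ → ℝ} :
    IsSymmetry Ω V τ χ σ ↔ ContDiffOn ℝ ∞ χ (times Ω) ∧ ContDiffOn ℝ ∞ σ (times Ω) ∧
      ∀ t ∈ times Ω, τ * deriv v t = 0 ∧ τ * deriv w t = 0 ∧
        deriv (deriv χ) t = 4 * v t * χ t ∧ deriv σ t = 0 := by
  have hI := hΩ.isOpen_times
  have hc : ContDiffOn ℝ ∞ (fun t => Complex.I * (w t : ℂ)) (times Ω) :=
    contDiffOn_const.mul (contDiffOn_ofReal hw)
  have hq : ∀ p ∈ Ω, V p = (fun t => (v t : ℂ)) p.1 * (p.2 : ℂ) ^ 2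
      + (fun _ => (0 : ℂ)) p.1 * p.2 + (fun t => Complex.I * (w t : ℂ)) p.1 := by
    intro p hp
    rw [hV p hp]; push_cast; ring
  have hdt : ∀ p ∈ Ω, dt V p = ((deriv v p.1 : ℝ) : ℂ) * (p.2 : ℂ) ^ 2
      + Complex.I * ((deriv w p.1 : ℝ) : ℂ) := by
    intro p hp
    have ev : deriv (fun t => (v t : ℂ)) p.1 = ((deriv v p.1 : ℝ) : ℂ) :=
      (hasDerivAt_of_contDiffOn hI hv (mem_times hp)).ofReal_comp.deriv
    have ew : deriv (fun t => Complex.I * (w t : ℂ)) p.1 = Complex.I * ((deriv w p.1 : ℝ) : ℂ) :=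
      ((hasDerivAt_of_contDiffOn hI hw (mem_times hp)).ofReal_comp.const_mul Complex.I).deriv
    rw [dt_quadratic hΩ.1 hI (contDiffOn_ofReal hv) contDiffOn_const hc hq hp, ev, ew]
    simp
  have hdx : ∀ p ∈ Ω, dx V p = 2 * (v p.1 : ℂ) * p.2 := by
    intro p hp
    rw [dx_quadratic hΩ.1 (contDiffOn_ofReal hv) contDiffOn_const hc hq hp]
    simp
  refine and_congr_right fun hχ => and_congr_right fun hσ => ⟨fun h t ht => ?_, fun h p hp => ?_⟩
  · have h1 := quadratic_eq_zero hΩ.1 ht (a := ((τ * deriv v t : ℝ) : ℂ))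
      (b := ((2 * v t * χ t - deriv (deriv χ) t / 2 : ℝ) : ℂ))
      (c := Complex.I * ((τ * deriv w t : ℝ) : ℂ) + ((-deriv σ t : ℝ) : ℂ)) (by
        intro x hx
        have := h _ hx
        rw [hdt _ hx, hdx _ hx] at this
        push_cast at this ⊢
        linear_combination this)
    obtain ⟨a, b, c⟩ := h1
    have a' : τ * deriv v t = 0 := by exact_mod_cast a
    have b' : 2 * v t * χ t - deriv (deriv χ) t / 2 = 0 := by exact_mod_cast b
    obtain ⟨c1, c2⟩ := eq_zero_of_re_im c
    exact ⟨a', c1, by linarith, by linarith⟩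
  · obtain ⟨a, b, c, d⟩ := h _ (mem_times hp)
    have a' : (τ : ℂ) * ((deriv v p.1 : ℝ) : ℂ) = 0 := by exact_mod_cast a
    have b' : (τ : ℂ) * ((deriv w p.1 : ℝ) : ℂ) = 0 := by exact_mod_cast b
    rw [hdt p hp, hdx p hp, c, d]
    push_cast
    linear_combination (p.2 : ℂ) ^ 2 * a' + Complex.I * b'

theorem sum_fields (hI : IsOpen (times Ω)) {χ₁ χ₂ : ℝ → ℝ} (h1 : ContDiffOn ℝ ∞ χ₁ (times Ω))
    (h2 : ContDiffOn ℝ ∞ χ₂ (times Ω)) (c τ c₁ c₂ : ℝ) {z : Space} (hz : z.1 ∈ times Ω) :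
    c • fieldM z + τ • fieldDt z + c₁ • fieldG χ₁ z + c₂ • fieldG χ₂ z
      = symField τ (fun t => c₁ * χ₁ t + c₂ * χ₂ t) (fun _ => c) z := by
  have hd : deriv (fun t => c₁ * χ₁ t + c₂ * χ₂ t) z.1 = c₁ * deriv χ₁ z.1 + c₂ * deriv χ₂ z.1 :=
    (((hasDerivAt_of_contDiffOn hI h1 hz).const_mul c₁).add
      ((hasDerivAt_of_contDiffOn hI h2 hz).const_mul c₂)).deriv
  simp only [symField, hd, fieldM, fieldDt, fieldG, Prod.smul_mk, Prod.mk_add_mk, smul_eq_mul,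
    mul_zero, zero_add, add_zero, mul_one, Complex.real_smul]
  refine Prod.ext rfl (Prod.ext rfl ?_)
  push_cast
  ring

theorem fields_independent (hf : IsNonlinearity f P) (hΩ : IsTXDomain Ω) {v χ₁ χ₂ : ℝ → ℝ}
    (h : IsFundamentalSystem v (times Ω) χ₁ χ₂) {c τ c₁ c₂ : ℝ}
    (h0 : ∀ z ∈ phaseDomain Ω P,
      c • fieldM z + τ • fieldDt z + c₁ • fieldG χ₁ z + c₂ • fieldG χ₂ z = 0) :
    c = 0 ∧ τ = 0 ∧ c₁ = 0 ∧ c₂ = 0 := by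
  have hI := hΩ.isOpen_times
  have he : (phaseDomain Ω P).domRestrict
      (symField τ (fun t => c₁ * χ₁ t + c₂ * χ₂ t) (fun _ => c))
      = (phaseDomain Ω P).domRestrict (symField 0 (fun _ => 0) (fun _ => 0)) := by
    funext z
    have := h0 z z.2
    rw [sum_fields hI h.1 h.2.1 c τ c₁ c₂ (mem_times z.2.1)] at this
    simp only [domRestrict_apply]
    rw [this, symField_M, zero_smul]
  obtain ⟨a, b⟩ := symField_inj hI hΩ.2.1 hf.nonempty hf.pos he
  obtain ⟨t, ht⟩ := hΩ.nonempty_times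
  obtain ⟨c1, c2⟩ := h.2.2.2.2 c₁ c₂ fun t ht => (b t ht).1
  exact ⟨(b t ht).2, a, c1, c2⟩

/-- Since τ is constant, a single time with (v_t, w_t) ≠ 0 forces τ = 0. -/
theorem IsNonlinearity.isBasisOf_isQuadratic (hf : IsNonlinearity f P) (hΩ : IsTXDomain Ω)
    (hVs : ContDiffOn ℝ ∞ V Ω) {v w χ₁ χ₂ : ℝ → ℝ} (hV : IsQuadratic v w Ω V)
    (h : IsFundamentalSystem v (times Ω) χ₁ χ₂) :
    IsBasisOf ![fieldM, fieldG χ₁, fieldG χ₂] (lieAlgebra f P Ω V) := by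
  obtain ⟨hv, hw, ⟨t₁, ht₁, hne⟩, hV⟩ := hV
  have hI := hΩ.isOpen_times
  refine isBasisOf_of (fun c h0 => ?_) fun R => ?_
  · obtain ⟨a, -, b, d⟩ := fields_independent hf hΩ h (c := c 0) (τ := 0) (c₁ := c 1) (c₂ := c 2)
      (fun z hz => by simpa [Fin.sum_univ_three] using h0 z hz)
    intro i
    fin_cases i <;> assumption
  · rw [hf.mem_lieAlgebra_iff hΩ hVs]
    simp only [isSymmetry_quadratic_iff hΩ hv hw hV]
    constructor
    · rintro ⟨τ, χ, σ, ⟨hχ, hσ, he⟩, rfl⟩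
      have hτ : τ = 0 := by
        obtain ⟨a, b, -⟩ := he t₁ ht₁
        rcases hne with hn | hn
        · exact (mul_eq_zero.1 a).resolve_right hn
        · exact (mul_eq_zero.1 b).resolve_right hn
      obtain ⟨c₁, c₂, hc⟩ := h.exists_combination hI hΩ.ordConnected_times hΩ.nonempty_times hv hχ
        fun t ht => (he t ht).2.2.1
      obtain ⟨c, hcσ⟩ := exists_const_of_deriv_eq_zero hI hΩ.ordConnected_times hΩ.nonempty_times
        hσ fun t ht => (he t ht).2.2.2
      refine ⟨![c, c₁, c₂], ?_⟩
      rw [symField_congr hI hτ fun t ht => ⟨hc t ht, hcσ t ht⟩]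
      funext z
      have := sum_fields hI h.1 h.2.1 c 0 c₁ c₂ (mem_times z.2.1)
      simpa [Fin.sum_univ_three] using this
    · rintro ⟨c, rfl⟩
      refine ⟨0, fun t => c 1 * χ₁ t + c 2 * χ₂ t, fun _ => c 0,
        ⟨(contDiffOn_const.mul h.1).add (contDiffOn_const.mul h.2.1), contDiffOn_const,
          fun t ht => ⟨by simp, by simp, ?_, by simp⟩⟩, ?_⟩
      · have hd1 : ∀ s ∈ times Ω, deriv (fun t => c 1 * χ₁ t + c 2 * χ₂ t) s
            = c 1 * deriv χ₁ s + c 2 * deriv χ₂ s := fun s hs =>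
          (((hasDerivAt_of_contDiffOn hI h.1 hs).const_mul _).add
            ((hasDerivAt_of_contDiffOn hI h.2.1 hs).const_mul _)).deriv
        have hd2 := (((hasDerivAt_of_contDiffOn hI (contDiffOn_deriv hI h.1) ht).const_mul
          (c 1)).add ((hasDerivAt_of_contDiffOn hI (contDiffOn_deriv hI h.2.1) ht).const_mul
          (c 2))).deriv
        rw [deriv_congr_of_isOpen hI hd1 ht]
        refine hd2.trans ?_
        rw [h.2.2.1 t ht, h.2.2.2.1 t ht]
        ring
      · funext z
        have := sum_fields hI h.1 h.2.1 (c 0) 0 (c 1) (c 2) (mem_times z.2.1)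
        simpa [Fin.sum_univ_three] using this.symm

/-- With constant coefficients the conditions on τ are void, so τ is a fourth free parameter. -/
theorem IsNonlinearity.isBasisOf_isOscillator (hf : IsNonlinearity f P) (hΩ : IsTXDomain Ω)
    (hVs : ContDiffOn ℝ ∞ V Ω) {s ν : ℝ} {χ₁ χ₂ : ℝ → ℝ} (hV : IsOscillator s ν Ω V)
    (h : IsFundamentalSystem (fun _ => s) (times Ω) χ₁ χ₂) :
    IsBasisOf ![fieldM, fieldDt, fieldG χ₁, fieldG χ₂] (lieAlgebra f P Ω V) := by
  have hI := hΩ.isOpen_times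
  have hv : ContDiffOn ℝ ∞ (fun _ : ℝ => s) (times Ω) := contDiffOn_const
  have hw : ContDiffOn ℝ ∞ (fun _ : ℝ => ν) (times Ω) := contDiffOn_const
  refine isBasisOf_of (fun c h0 => ?_) fun R => ?_
  · obtain ⟨a, b, d, e⟩ := fields_independent hf hΩ h (c := c 0) (τ := c 1) (c₁ := c 2)
      (c₂ := c 3) (fun z hz => by simpa [Fin.sum_univ_four] using h0 z hz)
    intro i
    fin_cases i <;> assumption
  · rw [hf.mem_lieAlgebra_iff hΩ hVs]
    simp only [isSymmetry_quadratic_iff hΩ hv hw hV]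
    constructor
    · rintro ⟨τ, χ, σ, ⟨hχ, hσ, he⟩, rfl⟩
      obtain ⟨c₁, c₂, hc⟩ := h.exists_combination hI hΩ.ordConnected_times hΩ.nonempty_times hv hχ
        fun t ht => (he t ht).2.2.1
      obtain ⟨c, hcσ⟩ := exists_const_of_deriv_eq_zero hI hΩ.ordConnected_times hΩ.nonempty_times
        hσ fun t ht => (he t ht).2.2.2
      refine ⟨![c, τ, c₁, c₂], ?_⟩
      rw [symField_congr hI rfl fun t ht => ⟨hc t ht, hcσ t ht⟩]
      funext z
      have := sum_fields hI h.1 h.2.1 c τ c₁ c₂ (mem_times z.2.1)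
      simpa [Fin.sum_univ_four] using this
    · rintro ⟨c, rfl⟩
      refine ⟨c 1, fun t => c 2 * χ₁ t + c 3 * χ₂ t, fun _ => c 0,
        ⟨(contDiffOn_const.mul h.1).add (contDiffOn_const.mul h.2.1), contDiffOn_const,
          fun t ht => ⟨by simp, by simp, ?_, by simp⟩⟩, ?_⟩
      · have hd1 : ∀ s ∈ times Ω, deriv (fun t => c 2 * χ₁ t + c 3 * χ₂ t) s
            = c 2 * deriv χ₁ s + c 3 * deriv χ₂ s := fun s hs =>
          (((hasDerivAt_of_contDiffOn hI h.1 hs).const_mul _).add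
            ((hasDerivAt_of_contDiffOn hI h.2.1 hs).const_mul _)).deriv
        have hd2 := (((hasDerivAt_of_contDiffOn hI (contDiffOn_deriv hI h.1) ht).const_mul
          (c 2)).add ((hasDerivAt_of_contDiffOn hI (contDiffOn_deriv hI h.2.1) ht).const_mul
          (c 3))).deriv
        rw [deriv_congr_of_isOpen hI hd1 ht]
        refine hd2.trans ?_
        rw [h.2.2.1 t ht, h.2.2.2.1 t ht]
        ring
      · funext z
        have := sum_fields hI h.1 h.2.1 (c 0) (c 1) (c 2) (c 3) (mem_times z.2.1)
        simpa [Fin.sum_univ_four] using this.symm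

theorem isFundamentalSystem_of_hasDerivAt {I : Set ℝ} (ho : IsOpen I) (hn : I.Nonempty) {s : ℝ}
    {χ₁ χ₂ χ₁' χ₂' : ℝ → ℝ} (hs₁ : ContDiff ℝ ∞ χ₁) (hs₂ : ContDiff ℝ ∞ χ₂)
    (h1 : ∀ t, HasDerivAt χ₁ (χ₁' t) t) (h2 : ∀ t, HasDerivAt χ₂ (χ₂' t) t)
    (h1' : ∀ t, HasDerivAt χ₁' (4 * s * χ₁ t) t) (h2' : ∀ t, HasDerivAt χ₂' (4 * s * χ₂ t) t)
    (hW : ∀ t, χ₁ t * χ₂' t - χ₁' t * χ₂ t ≠ 0) :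
    IsFundamentalSystem (fun _ => s) I χ₁ χ₂ := by
  obtain ⟨t₀, h₀⟩ := hn
  have d1 : deriv χ₁ = χ₁' := funext fun t => (h1 t).deriv
  have d2 : deriv χ₂ = χ₂' := funext fun t => (h2 t).deriv
  refine .of_wronskian ho hs₁.contDiffOn hs₂.contDiffOn (fun t _ => ?_) (fun t _ => ?_) h₀ ?_
  · rw [d1, (h1' t).deriv]
  · rw [d2, (h2' t).deriv]
  · rw [d1, d2]; exact hW t₀

theorem isFundamentalSystem_free {I : Set ℝ} (ho : IsOpen I) (hn : I.Nonempty) :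
    IsFundamentalSystem (fun _ => 0) I (fun _ => 1) (fun t => t) :=
  isFundamentalSystem_of_hasDerivAt ho hn contDiff_const contDiff_id
    (χ₁' := fun _ => 0) (χ₂' := fun _ => 1) (fun t => hasDerivAt_const t 1) (fun t => hasDerivAt_id t)
    (fun t => by simpa using hasDerivAt_const t (0 : ℝ))
    (fun t => by simpa using hasDerivAt_const t (1 : ℝ)) (fun t => by norm_num)

theorem isFundamentalSystem_exp {I : Set ℝ} (ho : IsOpen I) (hn : I.Nonempty) :
    IsFundamentalSystem (fun _ => 1) I (fun t => Real.exp (-2 * t)) (fun t => Real.exp (2 * t)) := by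
  have he : ∀ a t : ℝ, HasDerivAt (fun t => Real.exp (a * t)) (a * Real.exp (a * t)) t := by
    intro a t
    refine (((hasDerivAt_id t).const_mul a).exp).congr_deriv ?_
    simp; ring
  refine isFundamentalSystem_of_hasDerivAt ho hn (by fun_prop) (by fun_prop) (he (-2)) (he 2)
    (fun t => ((he (-2) t).const_mul (-2)).congr_deriv (by ring))
    (fun t => ((he 2 t).const_mul 2).congr_deriv (by ring)) fun t => ?_
  have : 0 < Real.exp (-2 * t) * Real.exp (2 * t) := by positivity
  nlinarith

theorem isFundamentalSystem_trig {I : Set ℝ} (ho : IsOpen I) (hn : I.Nonempty) :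
    IsFundamentalSystem (fun _ => -1) I (fun t => Real.cos (2 * t)) (fun t => Real.sin (2 * t)) := by
  have hl : ∀ t : ℝ, HasDerivAt (fun t => 2 * t) 2 t := fun t => by
    simpa using! (hasDerivAt_id t).const_mul (2 : ℝ)
  have hc : ∀ t : ℝ, HasDerivAt (fun t => Real.cos (2 * t)) (-2 * Real.sin (2 * t)) t := fun t =>
    (hl t).cos.congr_deriv (by ring)
  have hs : ∀ t : ℝ, HasDerivAt (fun t => Real.sin (2 * t)) (2 * Real.cos (2 * t)) t := fun t =>
    (hl t).sin.congr_deriv (by ring)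
  refine isFundamentalSystem_of_hasDerivAt ho hn (by fun_prop) (by fun_prop) hc hs
    (fun t => ((hs t).const_mul (-2)).congr_deriv (by ring))
    (fun t => ((hc t).const_mul 2).congr_deriv (by ring)) fun t => ?_
  nlinarith [Real.sin_sq_add_cos_sq (2 * t)]

end Bases

/-! ### Point transformations -/

section Hat

variable (a : ℝ)

/-- `hat` as a continuous real-linear map. -/
def hatL : ℂ →L[ℝ] ℂ :=
  if 0 < a then ContinuousLinearMap.id ℝ ℂ else Complex.conjCLE.toContinuousLinearMap

theorem hatL_apply (z : ℂ) : hatL a z = hat a z := by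
  unfold hatL hat
  split_ifs <;> simp

theorem hat_add (z w : ℂ) : hat a (z + w) = hat a z + hat a w := by
  unfold hat; split_ifs <;> simp

theorem hat_mul (z w : ℂ) : hat a (z * w) = hat a z * hat a w := by
  unfold hat; split_ifs <;> simp

theorem hat_ofReal (r : ℝ) : hat a (r : ℂ) = r := by
  unfold hat; split_ifs <;> simp

theorem hat_hat (z : ℂ) : hat a (hat a z) = z := by
  unfold hat; split_ifs <;> simp

theorem hat_zero : hat a 0 = 0 := by simp [← hatL_apply]

theorem hat_eq_zero {z : ℂ} : hat a z = 0 ↔ z = 0 := by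
  unfold hat; split_ifs <;> simp

theorem norm_hat (z : ℂ) : ‖hat a z‖ = ‖z‖ := by
  unfold hat; split_ifs <;> simp

variable {a}

/-- Conjugating i under time reversal compensates the sign that ψ_t acquires from t' = at + b. -/
theorem hat_I (ha : a ≠ 0) : hat a Complex.I = (SignType.sign a : ℝ) * Complex.I := by
  rcases lt_or_gt_of_ne ha with h | h
  · simp [hat, not_lt.2 h.le, sign_neg h]
  · simp [hat, h, sign_pos h]

theorem hat_inv (z : ℂ) : hat a⁻¹ z = hat a z := by
  simp [hat]

end Hat

/-! ### Second derivatives at a single point. -/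

section C2

variable {u v : ℝ × ℝ → ℂ} {p : ℝ × ℝ}

theorem eventually_differentiableAt (hu : ContDiffAt ℝ 2 u p) :
    ∀ᶠ q in 𝓝 p, DifferentiableAt ℝ u q := by
  filter_upwards [hu.eventually (by simp)] with q hq using hq.differentiableAt (by simp)

theorem differentiableAt_dx (hu : ContDiffAt ℝ 2 u p) : DifferentiableAt ℝ (dx u) p := by
  have h1 : ContDiffAt ℝ 1 (fderiv ℝ u) p := hu.fderiv_right (by norm_num)
  exact (h1.differentiableAt (by simp)).clm_apply (differentiableAt_const _)

/-- In `MapsEquation` the functions are smooth only at the point considered, so the product rule is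
needed without an open set of smoothness given in advance. -/
theorem dx_dx_mul_of_contDiffAt (hu : ContDiffAt ℝ 2 u p) (hv : ContDiffAt ℝ 2 v p) :
    dx (dx fun q => u q * v q) p = dx (dx u) p * v p + 2 * dx u p * dx v p + u p * dx (dx v) p := by
  have h : dx (fun q => u q * v q) =ᶠ[𝓝 p] fun q => dx u q * v q + u q * dx v q := by
    filter_upwards [eventually_differentiableAt hu, eventually_differentiableAt hv] with q h1 h2
      using dx_mul h1 h2
  have du := hu.differentiableAt (by simp)
  have dv := hv.differentiableAt (by simp)
  have du' := differentiableAt_dx hu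
  have dv' := differentiableAt_dx hv
  rw [dx_congr h, dx_add (u := fun q => dx u q * v q) (v := fun q => u q * dx v q) (du'.mul dv) (du.mul dv'), dx_mul du' dv, dx_mul du dv']
  ring

theorem fderiv_hat (a : ℝ) (hu : DifferentiableAt ℝ u p) (w : ℝ × ℝ) :
    fderiv ℝ (fun q => hat a (u q)) p w = hat a (fderiv ℝ u p w) := by
  have h := (hatL a).hasFDerivAt.comp p hu.hasFDerivAt
  have h2 : HasFDerivAt (fun q => hat a (u q)) ((hatL a).comp (fderiv ℝ u p)) p :=
    h.congr_of_eventuallyEq (Eventually.of_forall fun q => (hatL_apply a (u q)).symm)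
  rw [h2.fderiv]
  exact hatL_apply a _

theorem dx_dx_hat (a : ℝ) (hu : ContDiffAt ℝ 2 u p) :
    dx (dx fun q => hat a (u q)) p = hat a (dx (dx u) p) := by
  have h : dx (fun q => hat a (u q)) =ᶠ[𝓝 p] fun q => hat a (dx u q) := by
    filter_upwards [eventually_differentiableAt hu] with q h1 using fderiv_hat a h1 _
  rw [dx_congr h]
  exact fderiv_hat a (differentiableAt_dx hu) _

theorem contDiffAt_hat {E : Type*} [NormedAddCommGroup E] [NormedSpace ℝ E] {u : E → ℂ} {p : E}
    (a : ℝ) {n : WithTop ℕ∞} (hu : ContDiffAt ℝ n u p) :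
    ContDiffAt ℝ n (fun q => hat a (u q)) p :=
  ((hatL a).contDiff.contDiffAt.comp p hu).congr_of_eventuallyEq
    (Eventually.of_forall fun q => (hatL_apply a (u q)).symm)

end C2

/-! ### Action of a point transformation on the equation. -/

namespace Transf

variable {g : Transf} {Ω : Set (ℝ × ℝ)} {P : Set ℝ} {f : ℝ → ℂ} {V V' : ℝ × ℝ → ℂ}

/-- The phase of a transformation. -/
def phase (g : Transf) (p : ℝ × ℝ) : ℝ :=
  g.ε * SignType.sign g.a / (2 * √|g.a|) * deriv g.X p.1 * p.2 + g.Ψ p.1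

/-- The real summand in the transformation of the potential. -/
def shift (g : Transf) (p : ℝ × ℝ) : ℝ :=
  g.ε * deriv (deriv g.X) p.1 * p.2 / (2 * √|g.a|) + SignType.sign g.a * deriv g.Ψ p.1
    - deriv g.X p.1 ^ 2 / (4 * |g.a|)

/-- The inverse of the transformation of the independent variables. -/
def baseInv (g : Transf) (q : ℝ × ℝ) : ℝ × ℝ :=
  ((q.1 - g.b) / g.a, g.ε * (q.2 - g.X ((q.1 - g.b) / g.a)) / √|g.a|)

theorem sq_eq_one_of {ε : ℝ} (h : ε = 1 ∨ ε = -1) : ε ^ 2 = 1 := by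
  rcases h with rfl | rfl <;> norm_num

theorem baseInv_base {I : Set ℝ} (hg : g.IsAdmitted I) (p : ℝ × ℝ) : g.baseInv (g.base p) = p := by
  have ha := hg.1
  have hε := sq_eq_one_of hg.2.1
  have hs : √|g.a| ≠ 0 := (Real.sqrt_pos.2 (abs_pos.2 ha)).ne'
  have h1 : (g.a * p.1 + g.b - g.b) / g.a = p.1 := by field_simp; ring
  refine Prod.ext h1 ?_
  simp only [baseInv, base, h1]
  field_simp
  linear_combination (√|g.a| * p.2) * hε

theorem base_baseInv {I : Set ℝ} (hg : g.IsAdmitted I) (q : ℝ × ℝ) : g.base (g.baseInv q) = q := by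
  have ha := hg.1
  have hε := sq_eq_one_of hg.2.1
  have hs : √|g.a| ≠ 0 := (Real.sqrt_pos.2 (abs_pos.2 ha)).ne'
  refine Prod.ext ?_ ?_
  · simp only [baseInv, base]; field_simp; ring
  · simp only [baseInv, base]
    field_simp
    linear_combination (q.2 - g.X ((q.1 - g.b) / g.a)) * hε

theorem contDiffAt_base (hg : g.IsAdmitted (times Ω)) (hI : IsOpen (times Ω)) {p : ℝ × ℝ}
    (hp : p ∈ Ω) : ContDiffAt ℝ ∞ g.base p := by
  have hX : ContDiffAt ℝ ∞ (fun q : ℝ × ℝ => g.X q.1) p :=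
    (hg.2.2.1.contDiffAt (hI.mem_nhds (mem_times hp))).comp p contDiffAt_fst
  exact ((contDiffAt_const.mul contDiffAt_fst).add contDiffAt_const).prodMk
    ((contDiffAt_const.mul contDiffAt_snd).add hX)

theorem contDiffAt_baseInv (hg : g.IsAdmitted (times Ω)) (hI : IsOpen (times Ω)) {p : ℝ × ℝ}
    (hp : p ∈ Ω) : ContDiffAt ℝ ∞ g.baseInv (g.base p) := by
  have h1 : ContDiffAt ℝ ∞ (fun q : ℝ × ℝ => (q.1 - g.b) / g.a) (g.base p) :=
    (contDiffAt_fst.sub contDiffAt_const).div_const _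
  have e1 : ((g.base p).1 - g.b) / g.a = p.1 := congrArg Prod.fst (baseInv_base hg p)
  have hX : ContDiffAt ℝ ∞ (fun q : ℝ × ℝ => g.X ((q.1 - g.b) / g.a)) (g.base p) := by
    have : ContDiffAt ℝ ∞ g.X (((g.base p).1 - g.b) / g.a) := by
      rw [e1]; exact hg.2.2.1.contDiffAt (hI.mem_nhds (mem_times hp))
    exact this.comp (g.base p) h1
  exact h1.prodMk ((contDiffAt_const.mul (contDiffAt_snd.sub hX)).div_const _)

/-- The algebra of the chain rule, with s = |a|^{1/2}, m = 1/s, e = sign a, h = hat u and E the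
exponential factor. The hypotheses `qx`, `qt`, `qxx` are the derivatives of U∘base = hE. The
coefficient εem/2 of X_t x in the phase is the one for which the terms with h_x cancel. -/
theorem nls_transform_algebra {ε s m e X₁ X₂ Q x Ut Ux Uxx h hx ht hxx E F V' W i : ℂ}
    (hi : i ^ 2 = -1) (hm : s * m = 1) (hε : ε ^ 2 = 1) (he : e ^ 2 = 1)
    (qx : ε * s * Ux = hx * E + h * (i * (ε * e * m / 2 * X₁) * E))
    (qt : e * s ^ 2 * Ut + X₁ * Ux = ht * E + h * (i * (ε * e * m / 2 * X₂ * x + Q) * E))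
    (qxx : ε * s * (ε * s * Uxx) = hxx * E + 2 * hx * (i * (ε * e * m / 2 * X₁) * E)
      + h * ((i * (ε * e * m / 2 * X₁)) ^ 2 * E)) :
    s ^ 2 * (i * Ut + Uxx + F * m ^ 2 * (h * E) + V' * (h * E)) =
      E * (e * i * ht + hxx + F * h + W * h
        + h * (s ^ 2 * V' - W - (ε * X₂ * x * m / 2 + e * Q - X₁ ^ 2 * m ^ 2 / 4))) := by
  have h1 : s ^ 2 * Ut = e * (ht * E + h * (i * (ε * e * m / 2 * X₂ * x + Q) * E) - X₁ * Ux) := by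
    linear_combination e * qt - s ^ 2 * Ut * he
  have h2 : Ux = ε * m * (hx * E + h * (i * (ε * e * m / 2 * X₁) * E)) := by
    linear_combination ε * m * qx - Ux * hε - ε ^ 2 * Ux * hm
  have h3 : s ^ 2 * Uxx = hxx * E + 2 * hx * (i * (ε * e * m / 2 * X₁) * E)
      + h * ((i * (ε * e * m / 2 * X₁)) ^ 2 * E) := by
    linear_combination qxx - s ^ 2 * Uxx * hε
  have h4 : s ^ 2 * m ^ 2 = 1 := by rw [← mul_pow, hm, one_pow]
  have : s ^ 2 * (i * Ut + Uxx + F * m ^ 2 * (h * E) + V' * (h * E)) =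
     i * (s ^ 2 * Ut) + s ^ 2 * Uxx + F * (s ^ 2 * m ^ 2) * (h * E) + s ^ 2 * V' * (h * E) := by ring
  rw [this, h1, h3, h2, h4]
  linear_combination
    h * E * (e * Q + e ^ 2 * ε * m / 2 * X₂ * x - e ^ 2 * ε ^ 2 * m ^ 2 / 4 * X₁ ^ 2) * hi
    - h * E * (ε * m / 2 * X₂ * x) * he + h * E * m ^ 2 / 4 * X₁ ^ 2 * (ε ^ 2 * he + hε)

/-- The transformed equation in the old variables. -/
theorem nls_transform (hg : g.IsAdmitted (times Ω)) (hΩ : IsOpen Ω) (hI : IsOpen (times Ω))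
    {u u' : ℝ × ℝ → ℂ} {p : ℝ × ℝ} (hp : p ∈ Ω) (hu : ContDiffAt ℝ ∞ u p)
    (hu' : ContDiffAt ℝ ∞ u' (g.base p))
    (he : ∀ᶠ q in 𝓝 p, u' (g.base q) = g.fibre q (u q)) :
    (|g.a| : ℝ) * nls (g.actF f) V' u' (g.base p) =
      Complex.exp (Complex.I * (g.phase p : ℂ)) * (hat g.a (nls f V u p)
        + hat g.a (u p) * ((|g.a| : ℝ) * V' (g.base p) - hat g.a (V p) - (g.shift p : ℂ))) := by
  obtain ⟨ha, hε, hX, hΨ⟩ := id hg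
  have hε2 := sq_eq_one_of hε
  set s := √|g.a| with hs
  have hs0 : s ≠ 0 := (Real.sqrt_pos.2 (abs_pos.2 ha)).ne'
  have hs2 : s ^ 2 = |g.a| := Real.sq_sqrt (abs_nonneg _)
  set e : ℝ := (SignType.sign g.a : ℝ) with he'
  have hea : e * |g.a| = g.a := sign_mul_abs g.a
  have he2 : e ^ 2 = 1 := by
    rcases lt_or_gt_of_ne ha with h | h
    · simp [he', sign_neg h]
    · simp [he', sign_pos h]
  have hX' := contDiffOn_deriv hI hX
  have hu2 : ContDiffAt ℝ 2 u p := hu.of_le ENat.LEInfty.out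
  have hu'2 : ContDiffAt ℝ 2 u' (g.base p) := hu'.of_le ENat.LEInfty.out
  -- derivatives of the base map along the coordinate lines
  have hbx : ∀ q : ℝ × ℝ, HasDerivAt (fun y => g.base (q.1, y)) (0, g.ε * s) q.2 := fun q =>
    (hasDerivAt_const q.2 (g.a * q.1 + g.b)).prodMk
      ((((hasDerivAt_id q.2).const_mul (g.ε * s)).add_const (g.X q.1)).congr_deriv (by simp))
  have hbt : HasDerivAt (fun t => g.base (t, p.2)) (g.a, deriv g.X p.1) p.1 :=
    HasDerivAt.prodMk
      ((((hasDerivAt_id p.1).const_mul g.a).add_const g.b).congr_deriv (by simp))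
      ((hasDerivAt_of_contDiffOn hI hX (mem_times hp)).const_add (g.ε * s * p.2))
  have hbc := contDiffAt_base hg hI hp
  have split : ∀ (w : ℝ × ℝ → ℂ) (q : ℝ × ℝ) (x y : ℝ),
      fderiv ℝ w q (x, y) = (x : ℂ) * dt w q + (y : ℂ) * dx w q := by
    intro w q x y
    have : ((x, y) : ℝ × ℝ) = x • (1, 0) + y • (0, 1) := by simp
    rw [this, map_add, map_smul, map_smul]
    simp [dt, dx]
  have hdb : ∀ᶠ q in 𝓝 p, DifferentiableAt ℝ g.base q := by
    filter_upwards [hΩ.mem_nhds hp] with q hq using (contDiffAt_base hg hI hq).differentiableAt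
      (by simp)
  have cx : ∀ w : ℝ × ℝ → ℂ, ∀ q, DifferentiableAt ℝ w (g.base q) → DifferentiableAt ℝ g.base q →
      dx (fun q => w (g.base q)) q = ((g.ε * s : ℝ) : ℂ) * dx w (g.base q) := by
    intro w q hw hb
    refine dx_eq (DifferentiableAt.comp q hw hb) ?_
    refine (HasFDerivAt.comp_hasDerivAt (f := fun y => g.base (q.1, y)) q.2 hw.hasFDerivAt
      (hbx q)).congr_deriv ?_
    rw [split]; simp
  have ct : dt (fun q => u' (g.base q)) p
      = (g.a : ℂ) * dt u' (g.base p) + ((deriv g.X p.1 : ℝ) : ℂ) * dx u' (g.base p) := by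
    have hw : DifferentiableAt ℝ u' (g.base p) := hu'.differentiableAt (by simp)
    refine dt_eq (DifferentiableAt.comp p hw (hbc.differentiableAt (by simp))) ?_
    refine (HasFDerivAt.comp_hasDerivAt (f := fun t => g.base (t, p.2)) p.1 hw.hasFDerivAt
      hbt).congr_deriv ?_
    rw [split]
  have cxx : dx (dx fun q => u' (g.base q)) p
      = ((g.ε * s : ℝ) : ℂ) * (((g.ε * s : ℝ) : ℂ) * dx (dx u') (g.base p)) := by
    have h1 : dx (fun q => u' (g.base q)) =ᶠ[𝓝 p]
        fun q => ((g.ε * s : ℝ) : ℂ) * dx u' (g.base q) := by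
      filter_upwards [hdb, hbc.continuousAt.eventually (eventually_differentiableAt hu'2)]
        with q h1 h2 using cx u' q h2 h1
    have h2 : DifferentiableAt ℝ (fun q => dx u' (g.base q)) p :=
      DifferentiableAt.comp p (differentiableAt_dx hu'2) (hbc.differentiableAt (by simp))
    rw [dx_congr h1, dx_mul (differentiableAt_const _) h2,
      cx (dx u') p (differentiableAt_dx hu'2) (hbc.differentiableAt (by simp))]
    simp [dx]
  -- the exponential factor
  set E : ℝ × ℝ → ℂ := fun q => Complex.exp (Complex.I * (g.phase q : ℂ)) with hE
  set k : ℝ := g.ε * e / (2 * s) with hk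
  have hph : ContDiffOn ℝ ∞ g.phase Ω :=
    ((contDiffOn_const.mul (contDiffOn_comp_fst hX')).mul contDiffOn_snd).add
      (contDiffOn_comp_fst hΨ)
  have hEs : ContDiffOn ℝ ∞ E Ω := (contDiffOn_const.mul (contDiffOn_ofReal hph)).cexp
  have hEx : ∀ q ∈ Ω, dx E q = Complex.I * ((k * deriv g.X q.1 : ℝ) : ℂ) * E q := by
    intro q hq
    refine dx_eq (differentiableAt_of_contDiffOn hΩ hEs hq) ?_
    have h1 : HasDerivAt (fun y => g.phase (q.1, y)) (k * deriv g.X q.1) q.2 := by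
      exact (((hasDerivAt_id q.2).const_mul (k * deriv g.X q.1)).add_const (g.Ψ q.1)).congr_deriv
        (by simp)
    refine ((h1.ofReal_comp.const_mul Complex.I).cexp).congr_deriv ?_
    simp only [hE]; ring
  have hEt : dt E p = Complex.I *
      ((k * deriv (deriv g.X) p.1 * p.2 + deriv g.Ψ p.1 : ℝ) : ℂ) * E p := by
    refine dt_eq (differentiableAt_of_contDiffOn hΩ hEs hp) ?_
    have h1 : HasDerivAt (fun t => g.phase (t, p.2))
        (k * deriv (deriv g.X) p.1 * p.2 + deriv g.Ψ p.1) p.1 :=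
      (((hasDerivAt_of_contDiffOn hI hX' (mem_times hp)).const_mul k).mul_const p.2).add
        (hasDerivAt_of_contDiffOn hI hΨ (mem_times hp))
    refine ((h1.ofReal_comp.const_mul Complex.I).cexp).congr_deriv ?_
    simp only [hE]; ring
  have hEd := differentiableAt_of_contDiffOn hΩ hEs hp
  have hExx : dx (dx E) p = (Complex.I * ((k * deriv g.X p.1 : ℝ) : ℂ)) ^ 2 * E p := by
    have hc : ContDiffOn ℝ ∞ (fun q : ℝ × ℝ => Complex.I * ((k * deriv g.X q.1 : ℝ) : ℂ)) Ω :=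
      contDiffOn_const.mul (contDiffOn_ofReal (contDiffOn_const.mul (contDiffOn_comp_fst hX')))
    have hc0 : dx (fun q : ℝ × ℝ => Complex.I * ((k * deriv g.X q.1 : ℝ) : ℂ)) p = 0 :=
      dx_eq (differentiableAt_of_contDiffOn hΩ hc hp)
        (hasDerivAt_const p.2 (Complex.I * ((k * deriv g.X p.1 : ℝ) : ℂ)))
    rw [dx_congr (eventuallyEq_of_eqOn hΩ hEx hp),
      dx_mul (differentiableAt_of_contDiffOn hΩ hc hp) hEd, hc0, hEx p hp]
    ring
  -- both expressions of the transformed function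
  have heq : (fun q => u' (g.base q)) =ᶠ[𝓝 p] fun q => hat g.a (u q) * E q := he
  have hhu2 : ContDiffAt ℝ 2 (fun q => hat g.a (u q)) p := contDiffAt_hat g.a hu2
  have hhud := hhu2.differentiableAt (by simp)
  have hud := hu.differentiableAt (by simp)
  have hE2 : ContDiffAt ℝ 2 E p := (hEs.contDiffAt (hΩ.mem_nhds hp)).of_le ENat.LEInfty.out
  have hx1 : dx (fun q => hat g.a (u q)) p = hat g.a (dx u p) := fderiv_hat _ hud _
  have ht1 : dt (fun q => hat g.a (u q)) p = hat g.a (dt u p) := fderiv_hat _ hud _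
  have q0 : u' (g.base p) = hat g.a (u p) * E p := heq.eq_of_nhds
  have qx : ((g.ε * s : ℝ) : ℂ) * dx u' (g.base p) = hat g.a (dx u p) * E p
      + hat g.a (u p) * (Complex.I * ((k * deriv g.X p.1 : ℝ) : ℂ) * E p) := by
    rw [← cx u' p (hu'.differentiableAt (by simp)) (hbc.differentiableAt (by simp)),
      dx_congr heq, dx_mul hhud hEd, hx1, hEx p hp]
  have qt := dt_congr heq
  rw [ct, dt_mul hhud hEd, ht1, hEt] at qt
  have qxx := dx_congr (dx_eventuallyEq heq)
  rw [cxx, dx_dx_mul_of_contDiffAt hhu2 hE2, dx_dx_hat _ hu2, hExx, hx1, hEx p hp] at qxx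
  have hnorm : ‖u' (g.base p)‖ = ‖u p‖ := by
    rw [q0, norm_mul, norm_hat, hE]
    simp only [mul_comm Complex.I]
    rw [Complex.norm_exp_ofReal_mul_I, mul_one]
  have hhn : hat g.a (nls f V u p) = e * Complex.I * hat g.a (dt u p) + hat g.a (dx (dx u) p)
      + hat g.a (f ‖u p‖) * hat g.a (u p) + hat g.a (V p) * hat g.a (u p) := by
    simp only [nls, hat_add, hat_mul, hat_I ha]
    rfl
  change _ = E p * _
  rw [hhn, nls, hnorm, q0]
  simp only [actF, shift, ← hs, ← he']
  have ce2 : (e : ℂ) ^ 2 = 1 := by exact_mod_cast he2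
  have cε2 : (g.ε : ℂ) ^ 2 = 1 := by exact_mod_cast hε2
  have hm : (s : ℂ) * (s : ℂ)⁻¹ = 1 := mul_inv_cancel₀ (by exact_mod_cast hs0)
  rw [← hs2]
  have cea : (g.a : ℂ) = (e : ℂ) * (s : ℂ) ^ 2 := by rw [← hs2] at hea; exact_mod_cast hea.symm
  rw [cea] at qt
  have h := nls_transform_algebra (F := hat g.a (f ‖u p‖)) (V' := V' (g.base p))
    (W := hat g.a (V p)) (i := Complex.I) (ε := g.ε) (s := s) (m := (s : ℂ)⁻¹) (e := e)
    (X₁ := (deriv g.X p.1 : ℝ)) (X₂ := (deriv (deriv g.X) p.1 : ℝ)) (Q := (deriv g.Ψ p.1 : ℝ))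
    (x := (p.2 : ℝ)) (Ut := dt u' (g.base p)) (Ux := dx u' (g.base p))
    (Uxx := dx (dx u') (g.base p)) (h := hat g.a (u p)) (hx := hat g.a (dx u p))
    (ht := hat g.a (dt u p)) (hxx := hat g.a (dx (dx u) p)) (E := E p) Complex.I_sq hm cε2 ce2
    (by rw [hk] at qx; push_cast at qx; linear_combination (norm := (field_simp; ring)) qx)
    (by rw [hk] at qt; push_cast at qt; linear_combination (norm := (field_simp; ring)) qt)
    (by rw [hk] at qxx; push_cast at qxx; linear_combination (norm := (field_simp; ring)) qxx)
  push_cast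
  linear_combination (norm := (field_simp; ring)) h

end Transf

variable {Ω Ω' : Set (ℝ × ℝ)} {P : Set ℝ} {f : ℝ → ℂ} {V V' : ℝ × ℝ → ℂ}

/-! ### Action of transformations on domains and potentials. -/

namespace Transf

variable {g : Transf}

theorem sqrt_pos (ha : g.a ≠ 0) : 0 < √|g.a| := Real.sqrt_pos.2 (abs_pos.2 ha)

/-- The part of the shift of the potential that does not depend on `x`. -/
def shiftTime (g : Transf) (t : ℝ) : ℝ :=
  SignType.sign g.a * deriv g.Ψ t - deriv g.X t ^ 2 / (4 * |g.a|)

theorem shift_eq (g : Transf) (p : ℝ × ℝ) :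
    g.shift p = g.ε * deriv (deriv g.X) p.1 * p.2 / (2 * √|g.a|) + g.shiftTime p.1 := by
  simp only [shift, shiftTime]; ring

theorem contDiffOn_shiftTime {I : Set ℝ} (hI : IsOpen I) (hg : g.IsAdmitted I) :
    ContDiffOn ℝ ∞ g.shiftTime I :=
  (contDiffOn_const.mul (contDiffOn_deriv hI hg.2.2.2)).sub
    (((contDiffOn_deriv hI hg.2.2.1).pow 2).div_const _)

theorem contDiffOn_shift (hI : IsOpen (times Ω)) (hg : g.IsAdmitted (times Ω)) :
    ContDiffOn ℝ ∞ g.shift Ω :=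
  ((((contDiffOn_const.mul (contDiffOn_comp_fst
    (contDiffOn_deriv hI (contDiffOn_deriv hI hg.2.2.1)))).mul contDiffOn_snd).div_const _).add
    (contDiffOn_comp_fst (contDiffOn_shiftTime hI hg))).congr fun p _ => g.shift_eq p

/-- The part of the shift that does not depend on `x` can be prescribed. -/
theorem exists_shiftTime_eq {I : Set ℝ} (ho : IsOpen I) (hc : I.OrdConnected) (hn : I.Nonempty)
    {a b ε : ℝ} {X r : ℝ → ℝ} (ha : a ≠ 0) (hε : ε = 1 ∨ ε = -1) (hX : ContDiffOn ℝ ∞ X I)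
    (hr : ContDiffOn ℝ ∞ r I) :
    ∃ Ψ : ℝ → ℝ, (Transf.mk a b ε X Ψ).IsAdmitted I ∧
      ∀ t ∈ I, (Transf.mk a b ε X Ψ).shiftTime t = r t := by
  obtain ⟨Ψ, hΨ, hd⟩ := exists_primitive ho hc hn
    (g := fun t => SignType.sign a * (r t + deriv X t ^ 2 / (4 * |a|)))
    (contDiffOn_const.mul (hr.add (((contDiffOn_deriv ho hX).pow 2).div_const _)))
  refine ⟨Ψ, ⟨ha, hε, hX, hΨ⟩, fun t ht => ?_⟩
  have he : (SignType.sign a : ℝ) * (SignType.sign a : ℝ) = 1 := by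
    rcases lt_or_gt_of_ne ha with h | h
    · simp [sign_neg h]
    · simp [sign_pos h]
  simp only [shiftTime, (hd t ht).deriv]
  linear_combination (r t + deriv X t ^ 2 / (4 * |a|)) * he

theorem image_base_eq {I : Set ℝ} (hg : g.IsAdmitted I) : g.base '' Ω = g.baseInv ⁻¹' Ω := by
  ext q
  constructor
  · rintro ⟨p, hp, rfl⟩
    rwa [mem_preimage, baseInv_base hg]
  · intro hq
    exact ⟨_, hq, base_baseInv hg q⟩

/-- Nothing is assumed on `g.X` outside `times Ω`, so the inverse is continuous only at points of
the image. This local continuity is enough. -/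
theorem isOpen_image_base (hΩ : IsOpen Ω) (hI : IsOpen (times Ω)) (hg : g.IsAdmitted (times Ω)) :
    IsOpen (g.base '' Ω) := by
  rw [isOpen_iff_mem_nhds]
  rintro _ ⟨p, hp, rfl⟩
  rw [image_base_eq hg]
  refine (contDiffAt_baseInv hg hI hp).continuousAt.preimage_mem_nhds ?_
  rw [baseInv_base hg]
  exact hΩ.mem_nhds hp

theorem times_image_base (g : Transf) (Ω : Set (ℝ × ℝ)) :
    times (g.base '' Ω) = (fun t => g.a * t + g.b) '' times Ω := by
  simp only [times, image_image]
  rfl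

theorem isTXDomain_image (hΩ : IsTXDomain Ω) (hg : g.IsAdmitted (times Ω)) :
    IsTXDomain (g.base '' Ω) := by
  refine ⟨isOpen_image_base hΩ.1 hΩ.isOpen_times hg, hΩ.2.1.image _, ?_, fun t => ?_⟩
  · change (times _).OrdConnected
    rw [times_image_base, ← isPreconnected_iff_ordConnected]
    exact (isPreconnected_iff_ordConnected.2 hΩ.ordConnected_times).image _
      (by fun_prop : Continuous fun t => g.a * t + g.b).continuousOn
  · have : {x : ℝ | (t, x) ∈ g.base '' Ω}
        = (fun x => g.ε * √|g.a| * x + g.X ((t - g.b) / g.a)) '' {x | ((t - g.b) / g.a, x) ∈ Ω} := by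
      ext y
      constructor
      · rintro ⟨p, hp, h⟩
        have h1 : g.a * p.1 + g.b = t := congrArg Prod.fst h
        have h2 : g.ε * √|g.a| * p.2 + g.X p.1 = y := congrArg Prod.snd h
        have h3 : (t - g.b) / g.a = p.1 := by
          rw [← h1]; field_simp [hg.1]; ring
        exact ⟨p.2, by rw [mem_ofPred_eq, h3]; exact hp, by simp only [h3]; exact h2⟩
      · rintro ⟨x, hx, rfl⟩
        refine ⟨_, hx, Prod.ext ?_ rfl⟩
        have := hg.1
        simp only [base]; field_simp; ring
    rw [this, ← isPreconnected_iff_ordConnected]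
    exact (isPreconnected_iff_ordConnected.2 (hΩ.2.2.2 _)).image _
      (by fun_prop : Continuous fun x => g.ε * √|g.a| * x + g.X ((t - g.b) / g.a)).continuousOn

/-- The transformation of potentials. -/
theorem carries_iff (hf : IsNonlinearity f P) (hΩ : IsTXDomain Ω) (hV : ContDiffOn ℝ ∞ V Ω) :
    g.Carries f P Ω V Ω' V' ↔ g.IsAdmitted (times Ω) ∧ Ω' = g.base '' Ω ∧
      ∀ p ∈ Ω, (|g.a| : ℝ) * V' (g.base p) = hat g.a (V p) + (g.shift p : ℂ) := by
  have hI := hΩ.isOpen_times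
  constructor
  · rintro ⟨hg, hΩ', -, hm⟩
    refine ⟨hg, hΩ', fun p hp => ?_⟩
    obtain ⟨ρ, hρ⟩ := hf.nonempty
    have hρ0 : 0 < ρ := hf.pos hρ
    have hρn : ‖(ρ : ℂ)‖ = ρ := by simp [abs_of_pos hρ0]
    -- A test function with value ρ ∈ P at p, whose ψ_xx is chosen so that the first equation holds
    -- there.
    set u := jetPoly (p.1, p.2, (ρ : ℂ)) 0 0 (-(f ρ * ρ + V p * ρ)) 0 with hu
    have hus : ContDiff ℝ ∞ u := contDiff_jetPoly _ _ _ _ _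
    have hup : u p = ρ := by simp [hu, jetPoly]
    have hxx : dx (dx u) p = -(f ρ * ρ + V p * ρ) := by
      rw [show dx u = _ from funext fun q => dx_jetPoly _ 0 0 _ 0 q]
      refine dx_eq (by fun_prop) ?_
      have h1 : HasDerivAt (fun y : ℝ => ((y - p.2 : ℝ) : ℂ)) ((1 : ℝ) : ℂ) p.2 :=
        ((hasDerivAt_id p.2).sub_const p.2).ofReal_comp
      refine ((h1.const_mul (-(f ρ * ρ + V p * ρ))).congr_deriv (by simp)).congr_of_eventuallyEq
        (Eventually.of_forall fun y => ?_)
      simp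
    have hn : nls f V u p = 0 := by
      have hut : dt u p = 0 := by simp [hu, dt_jetPoly]
      rw [nls, hut, hxx, hup, hρn]; ring
    -- The push-forward of u. As u' solves the second equation at the image point, only hat ψ times
    -- the defect of the potentials is left in the transformation formula, and ψ = ρ ≠ 0.
    set u' : ℝ × ℝ → ℂ := fun q => g.fibre (g.baseInv q) (u (g.baseInv q)) with hu'
    have hinv := contDiffAt_baseInv hg hI hp
    have hph : ContDiffAt ℝ ∞ g.phase p := by
      have h1 : ContDiffOn ℝ ∞ g.phase Ω :=
        ((contDiffOn_const.mul (contDiffOn_comp_fst (contDiffOn_deriv hI hg.2.2.1))).mul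
          contDiffOn_snd).add (contDiffOn_comp_fst hg.2.2.2)
      exact h1.contDiffAt (hΩ.1.mem_nhds hp)
    have hu's : ContDiffAt ℝ ∞ u' (g.base p) := by
      have h2 : ContDiffAt ℝ ∞ (fun q => g.fibre q (u q)) (g.baseInv (g.base p)) := by
        rw [baseInv_base hg]
        exact (contDiffAt_hat g.a hus.contDiffAt).mul
          (contDiffAt_const.mul (Complex.ofRealCLM.contDiff.contDiffAt.comp p hph)).cexp
      exact h2.comp (g.base p) hinv
    have he : ∀ᶠ q in 𝓝 p, u' (g.base q) = g.fibre q (u q) :=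
      Eventually.of_forall fun q => by simp only [hu', baseInv_base hg]
    have hn' := (hm u u' p hp (by rwa [hup, hρn]) hus.contDiffAt hu's he).1 hn
    have key := nls_transform (f := f) (V := V) (V' := V') hg hΩ.1 hI hp hus.contDiffAt hu's he
    rw [hn', hn, hat_zero, hup, hat_ofReal, mul_zero, zero_add] at key
    have hρc : (ρ : ℂ) ≠ 0 := by exact_mod_cast hρ0.ne'
    have := (mul_eq_zero.1 ((mul_eq_zero.1 key.symm).resolve_left (Complex.exp_ne_zero _))
      ).resolve_left hρc
    linear_combination this
  · rintro ⟨hg, rfl, h⟩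
    have hA : ((|g.a| : ℝ) : ℂ) ≠ 0 := by exact_mod_cast (abs_pos.2 hg.1).ne'
    refine ⟨hg, rfl, ?_, ?_⟩
    · rintro _ ⟨p, hp, rfl⟩
      refine ContDiffAt.contDiffWithinAt ?_
      have h2 : ContDiffAt ℝ ∞ (fun q => (hat g.a (V q) + (g.shift q : ℂ)) / ((|g.a| : ℝ) : ℂ))
          (g.baseInv (g.base p)) := by
        rw [baseInv_base hg]
        exact ((contDiffAt_hat g.a (hV.contDiffAt (hΩ.1.mem_nhds hp))).add
          ((contDiffOn_ofReal (contDiffOn_shift hI hg)).contDiffAt (hΩ.1.mem_nhds hp))).div_const _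
      refine (h2.comp (g.base p) (contDiffAt_baseInv hg hI hp)).congr_of_eventuallyEq ?_
      filter_upwards [(isOpen_image_base hΩ.1 hI hg).mem_nhds (mem_image_of_mem _ hp)] with q hq
      obtain ⟨r, hr, rfl⟩ := hq
      simp only [Function.comp_apply, baseInv_base hg, ← h r hr]
      field_simp
    · intro u u' p hp _ hu hu' he
      have key := nls_transform (f := f) (V := V) (V' := V') hg hΩ.1 hI hp hu hu' he
      rw [h p hp, add_sub_cancel_left, sub_self, mul_zero, add_zero] at key
      constructor
      · intro h0
        rw [h0, hat_zero, mul_zero] at key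
        exact (mul_eq_zero.1 key).resolve_left hA
      · intro h0
        rw [h0, mul_zero] at key
        exact (hat_eq_zero g.a).1 ((mul_eq_zero.1 key.symm).resolve_left (Complex.exp_ne_zero _))

end Transf

/-- Equivalence of potentials from a relation in which the summand of the transformed potential
that depends on `t` only is prescribed. -/
theorem exists_carries (hf : IsNonlinearity f P) (hΩ : IsTXDomain Ω) (hV : ContDiffOn ℝ ∞ V Ω)
    {a b ε : ℝ} {X r : ℝ → ℝ} (ha : a ≠ 0) (hε : ε = 1 ∨ ε = -1)
    (hX : ContDiffOn ℝ ∞ X (times Ω)) (hr : ContDiffOn ℝ ∞ r (times Ω))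
    (hΩ' : Ω' = (fun p : ℝ × ℝ => (a * p.1 + b, ε * √|a| * p.2 + X p.1)) '' Ω)
    (h : ∀ p ∈ Ω, (|a| : ℝ) * V' (a * p.1 + b, ε * √|a| * p.2 + X p.1)
      = hat a (V p) + ((ε * deriv (deriv X) p.1 * p.2 / (2 * √|a|) + r p.1 : ℝ) : ℂ)) :
    ∃ g : Transf, g.a = a ∧ g.Carries f P Ω V Ω' V' := by
  obtain ⟨Ψ, hg, hs⟩ := Transf.exists_shiftTime_eq (b := b) hΩ.isOpen_times hΩ.ordConnected_times
    hΩ.nonempty_times ha hε hX hr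
  refine ⟨_, rfl, (Transf.carries_iff hf hΩ hV).2 ⟨hg, hΩ', fun p hp => ?_⟩⟩
  rw [Transf.shift_eq, hs _ (mem_times hp)]
  exact h p hp

theorem Transf.Carries.isTXDomain {g : Transf} (h : g.Carries f P Ω V Ω' V') (hΩ : IsTXDomain Ω) :
    IsTXDomain Ω' := by
  obtain ⟨hg, rfl, -⟩ := h
  exact isTXDomain_image hΩ hg

theorem PotEquiv.isTXDomain (h : PotEquiv f P Ω V Ω' V') (hΩ : IsTXDomain Ω) : IsTXDomain Ω' := by
  obtain ⟨g, hg⟩ := h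
  exact hg.isTXDomain hΩ

theorem PotEquiv.contDiffOn (h : PotEquiv f P Ω V Ω' V') : ContDiffOn ℝ ∞ V' Ω' := by
  obtain ⟨g, hg⟩ := h
  exact hg.2.2.1

theorem StrictPotEquiv.potEquiv (h : StrictPotEquiv f P Ω V Ω' V') : PotEquiv f P Ω V Ω' V' := by
  obtain ⟨g, -, hg⟩ := h
  exact ⟨g, hg⟩

/-! ### Pullback of invariance fields. -/

variable {Ω Ω' : Set (ℝ × ℝ)} {P : Set ℝ} {f : ℝ → ℂ} {V V' : ℝ × ℝ → ℂ}

/-- `V` admits an invariance field that does not belong to the kernel algebra. -/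
def HasExtension (Ω : Set (ℝ × ℝ)) (V : ℝ × ℝ → ℂ) : Prop :=
  ∃ τ χ σ, IsSymmetry Ω V τ χ σ ∧ (τ ≠ 0 ∨ ∃ t ∈ times Ω, χ t ≠ 0)

theorem fderiv_pair (w : ℝ × ℝ → ℂ) (q : ℝ × ℝ) (x y : ℝ) :
    fderiv ℝ w q (x, y) = (x : ℂ) * dt w q + (y : ℂ) * dx w q := by
  have : ((x, y) : ℝ × ℝ) = x • (1, 0) + y • (0, 1) := by simp
  rw [this, map_add, map_smul, map_smul]
  simp [dt, dx]

/-- Invariance fields are pulled back by equivalence transformations. -/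
theorem Transf.Carries.pullback {g : Transf} (hf : IsNonlinearity f P) (hΩ : IsTXDomain Ω)
    (hV : ContDiffOn ℝ ∞ V Ω) (h : g.Carries f P Ω V Ω' V') {τ : ℝ} {χ σ : ℝ → ℝ}
    (hs : IsSymmetry Ω' V' τ χ σ) :
    ∃ σ', IsSymmetry Ω V (τ / g.a)
      (fun t => g.ε * (χ (g.a * t + g.b) - τ / g.a * deriv g.X t) / √|g.a|) σ' := by
  have hΩ'd := h.isTXDomain hΩ
  have hV's := h.2.2.1
  obtain ⟨hg, rfl, hfor⟩ := (Transf.carries_iff hf hΩ hV).1 h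
  have hI := hΩ.isOpen_times
  obtain ⟨ha, hε, hX, -⟩ := id hg
  obtain ⟨hχ, hσ, heq⟩ := hs
  have hX' := contDiffOn_deriv hI hX
  have hX'' := contDiffOn_deriv hI hX'
  have hX3 := contDiffOn_deriv hI hX''
  have hI' : IsOpen (times (g.base '' Ω)) := hΩ'd.isOpen_times
  have hr := Transf.contDiffOn_shiftTime hI hg
  have hmap : MapsTo (fun t => g.a * t + g.b) (times Ω) (times (g.base '' Ω)) := by
    rw [Transf.times_image_base]; exact mapsTo_image _ _
  have haff : ContDiffOn ℝ ∞ (fun t => g.a * t + g.b) (times Ω) :=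
    (by fun_prop : ContDiff ℝ ∞ fun t => g.a * t + g.b).contDiffOn
  have hχc := hχ.comp haff hmap
  have hχ1 := contDiffOn_deriv hI' hχ
  have hχ2c := (contDiffOn_deriv hI' hχ1).comp haff hmap
  have hσ1c := (contDiffOn_deriv hI' hσ).comp haff hmap
  set s := √|g.a| with hsdef
  have hs0 : s ≠ 0 := (Transf.sqrt_pos ha).ne'
  have hs2 : s ^ 2 = |g.a| := Real.sq_sqrt (abs_nonneg _)
  have ha2 : s ^ 4 = g.a ^ 2 := by rw [← sq_abs, ← hs2]; ring
  set τ' := τ / g.a with hτ'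
  -- The push-forward has x'-component τ' X_t + ε s χ', which must equal χ at t' = at + b.
  set χ' : ℝ → ℝ := fun t => g.ε * (χ (g.a * t + g.b) - τ' * deriv g.X t) / s with hχ'
  have hχ's : ContDiffOn ℝ ∞ χ' (times Ω) :=
    (contDiffOn_const.mul (hχc.sub (contDiffOn_const.mul hX'))).div_const _
  have dcomp : ∀ k : ℝ → ℝ, ContDiffOn ℝ ∞ k (times (g.base '' Ω)) → ∀ t ∈ times Ω,
      HasDerivAt (fun t => k (g.a * t + g.b)) (g.a * deriv k (g.a * t + g.b)) t := by
    intro k hk t ht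
    have h1 : HasDerivAt (fun t => g.a * t + g.b) g.a t :=
      (((hasDerivAt_id t).const_mul g.a).add_const g.b).congr_deriv (by simp)
    refine (HasDerivAt.comp t (hasDerivAt_of_contDiffOn hI' hk (hmap ht)) h1).congr_deriv ?_
    ring
  have d1 : ∀ t ∈ times Ω, deriv χ' t
      = g.ε * (g.a * deriv χ (g.a * t + g.b) - τ' * deriv (deriv g.X) t) / s := fun t ht =>
    ((((dcomp χ hχ t ht).sub ((hasDerivAt_of_contDiffOn hI hX' ht).const_mul τ')).const_mul
      g.ε).div_const s).deriv
  have d2 : ∀ t ∈ times Ω, deriv (deriv χ') t = g.ε * (g.a ^ 2 * deriv (deriv χ) (g.a * t + g.b)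
      - τ' * deriv (deriv (deriv g.X)) t) / s := by
    intro t ht
    rw [deriv_congr_of_isOpen hI d1 ht]
    refine HasDerivAt.deriv ?_
    refine ((((((dcomp _ hχ1 t ht).const_mul g.a).sub
      ((hasDerivAt_of_contDiffOn hI hX'' ht).const_mul τ')).const_mul g.ε).div_const s)).congr_deriv
      ?_
    ring
  -- The derivative of σ' collects the x-free terms of the transformed condition: χ_tt x'/2 with x'
  -- = εsx + X leaves X χ_tt/2, and the last two terms come from the derivatives of the shift.
  obtain ⟨σ', hσ', hd⟩ := exists_primitive hI hΩ.ordConnected_times hΩ.nonempty_times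
    (g := fun t => |g.a| * deriv σ (g.a * t + g.b)
      + |g.a| * g.X t * deriv (deriv χ) (g.a * t + g.b) / 2
      - τ' * deriv g.shiftTime t - χ' t * (g.ε * deriv (deriv g.X) t / (2 * s)))
    ((((contDiffOn_const.mul hσ1c).add (((contDiffOn_const.mul hX).mul hχ2c).div_const _)).sub
      (contDiffOn_const.mul (contDiffOn_deriv hI hr))).sub
      (hχ's.mul ((contDiffOn_const.mul hX'').div_const _)))
  refine ⟨σ', hχ's, hσ', fun p hp => ?_⟩
  have hpt := mem_times hp
  -- the hat of `V` and its derivatives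
  have hVd := differentiableAt_of_contDiffOn hΩ.1 hV hp
  have hW : (fun q => hat g.a (V q)) =ᶠ[𝓝 p]
      fun q => ((|g.a| : ℝ) : ℂ) * V' (g.base q) - (g.shift q : ℂ) :=
    eventuallyEq_of_eqOn hΩ.1 (fun q hq => by rw [hfor q hq]; ring) hp
  have hb := (Transf.contDiffAt_base hg hI hp).differentiableAt (by simp)
  have hV'd := differentiableAt_of_contDiffOn hΩ'd.1 hV's (mem_image_of_mem _ hp)
  have hVb : DifferentiableAt ℝ (fun q => V' (g.base q)) p := DifferentiableAt.comp p hV'd hb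
  have hsh := Transf.contDiffOn_shift hI hg
  have hshd := differentiableAt_of_contDiffOn hΩ.1 (contDiffOn_ofReal hsh) hp
  have hL : DifferentiableAt ℝ (fun q => ((|g.a| : ℝ) : ℂ) * V' (g.base q)) p :=
    (differentiableAt_const _).mul hVb
  have cx : dx (fun q => V' (g.base q)) p = ((g.ε * s : ℝ) : ℂ) * dx V' (g.base p) := by
    have hbx : HasDerivAt (fun y => g.base (p.1, y)) (0, g.ε * s) p.2 :=
      (hasDerivAt_const p.2 (g.a * p.1 + g.b)).prodMk
        ((((hasDerivAt_id p.2).const_mul (g.ε * s)).add_const (g.X p.1)).congr_deriv (by simp))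
    refine dx_eq hVb ((HasFDerivAt.comp_hasDerivAt (f := fun y => g.base (p.1, y)) p.2
      hV'd.hasFDerivAt hbx).congr_deriv ?_)
    rw [fderiv_pair]; simp
  have ct : dt (fun q => V' (g.base q)) p
      = (g.a : ℂ) * dt V' (g.base p) + ((deriv g.X p.1 : ℝ) : ℂ) * dx V' (g.base p) := by
    have hbt : HasDerivAt (fun t => g.base (t, p.2)) (g.a, deriv g.X p.1) p.1 :=
      HasDerivAt.prodMk
        ((((hasDerivAt_id p.1).const_mul g.a).add_const g.b).congr_deriv (by simp))
        ((hasDerivAt_of_contDiffOn hI hX hpt).const_add (g.ε * s * p.2))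
    refine dt_eq hVb ((HasFDerivAt.comp_hasDerivAt (f := fun t => g.base (t, p.2)) p.1
      hV'd.hasFDerivAt hbt).congr_deriv ?_)
    rw [fderiv_pair]
  have sx : dx (fun q => (g.shift q : ℂ)) p
      = ((g.ε * deriv (deriv g.X) p.1 / (2 * s) : ℝ) : ℂ) := by
    refine dx_eq hshd ?_
    have h1 : HasDerivAt (fun y => g.shift (p.1, y)) (g.ε * deriv (deriv g.X) p.1 / (2 * s)) p.2 := by
      simp only [Transf.shift_eq]
      refine ((((hasDerivAt_id p.2).const_mul (g.ε * deriv (deriv g.X) p.1)).div_const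
        (2 * √|g.a|)).add_const (g.shiftTime p.1)).congr_deriv ?_
      rw [mul_one]
    exact h1.ofReal_comp
  have st : dt (fun q => (g.shift q : ℂ)) p
      = ((g.ε * deriv (deriv (deriv g.X)) p.1 * p.2 / (2 * s) + deriv g.shiftTime p.1 : ℝ) : ℂ) := by
    refine dt_eq hshd ?_
    have h1 : HasDerivAt (fun t => g.shift (t, p.2))
        (g.ε * deriv (deriv (deriv g.X)) p.1 * p.2 / (2 * s) + deriv g.shiftTime p.1) p.1 := by
      simp only [Transf.shift_eq]
      exact ((((hasDerivAt_of_contDiffOn hI hX'' hpt).const_mul g.ε).mul_const p.2).div_const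
        (2 * √|g.a|)).add (hasDerivAt_of_contDiffOn hI hr hpt)
    exact h1.ofReal_comp
  have hx : hat g.a (dx V p) = ((|g.a| : ℝ) : ℂ) * (((g.ε * s : ℝ) : ℂ) * dx V' (g.base p))
      - ((g.ε * deriv (deriv g.X) p.1 / (2 * s) : ℝ) : ℂ) := by
    rw [dx, ← fderiv_hat _ hVd, ← dx, dx_congr hW, dx_sub hL hshd,
      dx_mul (differentiableAt_const _) hVb, sx, cx]
    simp [dx]
  have ht : hat g.a (dt V p) = ((|g.a| : ℝ) : ℂ) * ((g.a : ℂ) * dt V' (g.base p)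
      + ((deriv g.X p.1 : ℝ) : ℂ) * dx V' (g.base p))
      - ((g.ε * deriv (deriv (deriv g.X)) p.1 * p.2 / (2 * s) + deriv g.shiftTime p.1 : ℝ) : ℂ) := by
    rw [dt, ← fderiv_hat _ hVd, ← dt, dt_congr hW, dt_sub hL hshd,
      dt_mul (differentiableAt_const _) hVb, st, ct]
    simp [dt]
  have hV'p := heq _ (mem_image_of_mem _ hp)
  have hb1 : (g.base p).1 = g.a * p.1 + g.b := rfl
  have hb2 : (g.base p).2 = g.ε * s * p.2 + g.X p.1 := rfl
  rw [hb1, hb2] at hV'p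
  -- both sides agree after conjugation
  have hinj : ∀ z w : ℂ, hat g.a z = hat g.a w → z = w := fun z w hzw => by
    rw [← hat_hat g.a z, hzw, hat_hat]
  apply hinj
  rw [hat_add, hat_mul, hat_mul, hat_ofReal, hat_ofReal, hat_ofReal, ht, hx, d2 _ hpt,
    (hd _ hpt).deriv, ← hs2]
  simp only [hχ', hτ']
  have cε2 : (g.ε : ℂ) ^ 2 = 1 := by exact_mod_cast Transf.sq_eq_one_of hε
  have cs0 : (s : ℂ) ≠ 0 := by exact_mod_cast hs0
  have ca0 : (g.a : ℂ) ≠ 0 := by exact_mod_cast ha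
  have cs4 : (s : ℂ) ^ 4 = (g.a : ℂ) ^ 2 := by exact_mod_cast ha2
  push_cast at hV'p ⊢
  have hm : (s : ℂ) * (s : ℂ)⁻¹ = 1 := mul_inv_cancel₀ cs0
  have hn : (g.a : ℂ) * (g.a : ℂ)⁻¹ = 1 := mul_inv_cancel₀ ca0
  simp only [div_eq_mul_inv, mul_inv]
  generalize (s : ℂ)⁻¹ = m at *
  generalize (g.a : ℂ)⁻¹ = n at *
  generalize dt V' (g.base p) = A at *
  generalize dx V' (g.base p) = B at *
  generalize ((deriv (deriv χ) (g.a * p.1 + g.b) : ℝ) : ℂ) = c₂ at *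
  generalize ((deriv σ (g.a * p.1 + g.b) : ℝ) : ℂ) = σ₁ at *
  generalize ((χ (g.a * p.1 + g.b) : ℝ) : ℂ) = c at *
  have e3 : (s : ℂ) ^ 3 = (g.a : ℂ) ^ 2 * m := by linear_combination m * cs4 - (s : ℂ) ^ 3 * hm
  generalize ((deriv g.X p.1 : ℝ) : ℂ) = X₁ at *
  linear_combination (s : ℂ) ^ 2 * hV'p + (s : ℂ) ^ 2 * τ * A * hn + g.ε * c₂ * p.2 / 2 * e3
    + (c - τ * n * X₁) * m * (s : ℂ) ^ 3 * B * cε2 + (c - τ * n * X₁) * (s : ℂ) ^ 2 * B * hm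

/-! ### Transport of extensions; transitivity and symmetry of equivalence. -/

variable {Ω Ω' Ω'' : Set (ℝ × ℝ)} {P : Set ℝ} {f : ℝ → ℂ} {V V' V'' : ℝ × ℝ → ℂ}

theorem IsNonlinearity.lieAlgebra_ne_iff_hasExtension (hf : IsNonlinearity f P)
    (hΩ : IsTXDomain Ω) (hV : ContDiffOn ℝ ∞ V Ω) :
    lieAlgebra f P Ω V ≠ kernelAlgebra f P Ω ↔ HasExtension Ω V :=
  hf.lieAlgebra_ne_iff hΩ hV

theorem PotEquiv.hasExtension (hf : IsNonlinearity f P) (hΩ : IsTXDomain Ω)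
    (hV : ContDiffOn ℝ ∞ V Ω) (h : PotEquiv f P Ω V Ω' V') (h' : HasExtension Ω' V') :
    HasExtension Ω V := by
  obtain ⟨g, hg⟩ := h
  obtain ⟨τ, χ, σ, hs, hne⟩ := h'
  obtain ⟨σ', hs'⟩ := hg.pullback hf hΩ hV hs
  obtain ⟨⟨ha, hε, -⟩, rfl, -⟩ := hg
  refine ⟨_, _, _, hs', ?_⟩
  by_cases hτ : τ = 0
  · right
    obtain ⟨t', ht', hχ⟩ := hne.resolve_left (not_not_intro hτ)
    rw [Transf.times_image_base] at ht'
    obtain ⟨t, ht, rfl⟩ := ht'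
    have hε0 : g.ε ≠ 0 := by rcases hε with h | h <;> simp [h]
    refine ⟨t, ht, ?_⟩
    simp only [hτ, zero_div, zero_mul, sub_zero]
    exact div_ne_zero (mul_ne_zero hε0 hχ) (Transf.sqrt_pos ha).ne'
  · exact Or.inl (div_ne_zero hτ ha)

/-- A potential equivalent to an autonomous one admits a field with nonzero `∂_t`-component. -/
theorem PotEquiv.exists_isSymmetry_one (hf : IsNonlinearity f P) (hΩ : IsTXDomain Ω)
    (hV : ContDiffOn ℝ ∞ V Ω) (h : PotEquiv f P Ω V Ω' V') (h' : ∀ p ∈ Ω', dt V' p = 0) :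
    ∃ τ χ σ, τ ≠ 0 ∧ IsSymmetry Ω V τ χ σ := by
  obtain ⟨g, hg⟩ := h
  have hs : IsSymmetry Ω' V' 1 (fun _ => 0) (fun _ => 0) :=
    ⟨contDiffOn_const, contDiffOn_const, fun p hp => by simp [h' p hp]⟩
  obtain ⟨σ', hs'⟩ := hg.pullback hf hΩ hV hs
  exact ⟨_, _, _, div_ne_zero one_ne_zero hg.1.1, hs'⟩

theorem hasDerivAt_comp_affine {I J : Set ℝ} (hJ : IsOpen J) {k : ℝ → ℝ}
    (hk : ContDiffOn ℝ ∞ k J) {a b : ℝ} (hm : MapsTo (fun t => a * t + b) I J) {t : ℝ}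
    (ht : t ∈ I) : HasDerivAt (fun t => k (a * t + b)) (a * deriv k (a * t + b)) t := by
  have h1 : HasDerivAt (fun t => a * t + b) a t :=
    (((hasDerivAt_id t).const_mul a).add_const b).congr_deriv (by simp)
  exact (HasDerivAt.comp t (hasDerivAt_of_contDiffOn hJ hk (hm ht)) h1).congr_deriv (mul_comm _ _)

theorem contDiffOn_comp_affine {I J : Set ℝ} {k : ℝ → ℝ}
    (hk : ContDiffOn ℝ ∞ k J) {a b : ℝ} (hm : MapsTo (fun t => a * t + b) I J) :
    ContDiffOn ℝ ∞ (fun t => k (a * t + b)) I :=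
  hk.comp (by fun_prop : ContDiff ℝ ∞ fun t => a * t + b).contDiffOn hm

theorem deriv_deriv_comp_affine {I J : Set ℝ} (hI : IsOpen I) (hJ : IsOpen J) {k : ℝ → ℝ}
    (hk : ContDiffOn ℝ ∞ k J) {a b : ℝ} (hm : MapsTo (fun t => a * t + b) I J) {t : ℝ}
    (ht : t ∈ I) : deriv (deriv fun t => k (a * t + b)) t = a ^ 2 * deriv (deriv k) (a * t + b) := by
  rw [deriv_congr_of_isOpen hI (fun s hs => (hasDerivAt_comp_affine hJ hk hm hs).deriv) ht,
    ((hasDerivAt_comp_affine hJ (contDiffOn_deriv hJ hk) hm ht).const_mul a).deriv]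
  ring

theorem deriv_deriv_const_mul {I : Set ℝ} (hI : IsOpen I) {k : ℝ → ℝ}
    (hk : ContDiffOn ℝ ∞ k I) (c : ℝ) {t : ℝ} (ht : t ∈ I) :
    deriv (deriv fun t => c * k t) t = c * deriv (deriv k) t := by
  rw [deriv_congr_of_isOpen hI
    (fun s hs => ((hasDerivAt_of_contDiffOn hI hk hs).const_mul c).deriv) ht,
    ((hasDerivAt_of_contDiffOn hI (contDiffOn_deriv hI hk) ht).const_mul c).deriv]

theorem deriv_deriv_add {I : Set ℝ} (hI : IsOpen I) {k l : ℝ → ℝ}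
    (hk : ContDiffOn ℝ ∞ k I) (hl : ContDiffOn ℝ ∞ l I) {t : ℝ} (ht : t ∈ I) :
    deriv (deriv fun t => k t + l t) t = deriv (deriv k) t + deriv (deriv l) t := by
  rw [deriv_congr_of_isOpen hI (fun s hs =>
    ((hasDerivAt_of_contDiffOn hI hk hs).fun_add (hasDerivAt_of_contDiffOn hI hl hs)).deriv) ht,
    ((hasDerivAt_of_contDiffOn hI (contDiffOn_deriv hI hk) ht).fun_add
      (hasDerivAt_of_contDiffOn hI (contDiffOn_deriv hI hl) ht)).deriv]

theorem hat_mul_left {a b : ℝ} (ha : a ≠ 0) (hb : b ≠ 0) (z : ℂ) :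
    hat (b * a) z = hat b (hat a z) := by
  rcases lt_or_gt_of_ne ha with h | h <;> rcases lt_or_gt_of_ne hb with h' | h'
  · simp [hat, mul_pos_of_neg_of_neg h' h, not_lt.2 h.le, not_lt.2 h'.le]
  · simp [hat, not_lt.2 (mul_neg_of_pos_of_neg h' h).le, not_lt.2 h.le, h']
  · simp [hat, not_lt.2 (mul_neg_of_neg_of_pos h' h).le, not_lt.2 h'.le, h]
  · simp [hat, mul_pos h' h, h, h']

/-- Only the base maps are composed. The phase of the composition need not be computed, since
`exists_carries` supplies one as soon as the potentials match up to a prescribed real function of t.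
-/
theorem PotEquiv.trans (hf : IsNonlinearity f P) (hΩ : IsTXDomain Ω) (hV : ContDiffOn ℝ ∞ V Ω)
    (h₁ : PotEquiv f P Ω V Ω' V') (h₂ : PotEquiv f P Ω' V' Ω'' V'') :
    PotEquiv f P Ω V Ω'' V'' := by
  have hΩ'd := h₁.isTXDomain hΩ
  have hV' := h₁.contDiffOn
  obtain ⟨g₁, h₁⟩ := h₁
  obtain ⟨g₂, h₂⟩ := h₂
  obtain ⟨hg₁, rfl, e₁⟩ := (Transf.carries_iff hf hΩ hV).1 h₁
  obtain ⟨hg₂, rfl, e₂⟩ := (Transf.carries_iff hf hΩ'd hV').1 h₂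
  have hI := hΩ.isOpen_times
  have hI' := hΩ'd.isOpen_times
  have hm : MapsTo (fun t => g₁.a * t + g₁.b) (times Ω) (times (g₁.base '' Ω)) := by
    rw [Transf.times_image_base]; exact mapsTo_image _ _
  have hr₁ := Transf.contDiffOn_shiftTime hI hg₁
  have hr₂ := contDiffOn_comp_affine (Transf.contDiffOn_shiftTime hI' hg₂) hm
  have hX₂ := contDiffOn_comp_affine hg₂.2.2.1 hm
  have hX₂'' := contDiffOn_comp_affine
    (contDiffOn_deriv hI' (contDiffOn_deriv hI' hg₂.2.2.1)) hm
  obtain ⟨ha₁, hε₁, hX₁, -⟩ := id hg₁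
  obtain ⟨ha₂, hε₂, -, -⟩ := id hg₂
  have hs₁ := Transf.sqrt_pos ha₁
  have hs₂ := Transf.sqrt_pos ha₂
  have hsq : √|g₂.a * g₁.a| = √|g₂.a| * √|g₁.a| := by rw [abs_mul, Real.sqrt_mul (abs_nonneg _)]
  suffices h : ∃ g : Transf, g.a = g₂.a * g₁.a ∧ g.Carries f P Ω V (g₂.base '' (g₁.base '' Ω)) V''
    from ⟨_, h.choose_spec.2⟩
  refine exists_carries (b := g₂.a * g₁.b + g₂.b) (ε := g₂.ε * g₁.ε)
    (Ω' := g₂.base '' (g₁.base '' Ω)) (V' := V'') hf hΩ hV (mul_ne_zero ha₂ ha₁)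
    (by rcases hε₁ with h | h <;> rcases hε₂ with h' | h' <;> simp [h, h'])
    (X := fun t => g₂.ε * √|g₂.a| * g₁.X t + g₂.X (g₁.a * t + g₁.b))
    -- The shift of g₂ is linear in x' = ε₁|a₁|^{1/2}x + X₁. Its X₁-part is free of x and therefore
    -- belongs to r.
    (r := fun t => g₁.shiftTime t + |g₁.a| * g₂.ε * deriv (deriv g₂.X) (g₁.a * t + g₁.b) * g₁.X t
      / (2 * √|g₂.a|) + |g₁.a| * g₂.shiftTime (g₁.a * t + g₁.b))
    ((contDiffOn_const.mul hX₁).add hX₂)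
    ((hr₁.add (((contDiffOn_const.mul hX₂'').mul hX₁).div_const _)).add (contDiffOn_const.mul hr₂))
    ?_ ?_
  · rw [image_image]
    refine image_congr fun p _ => Prod.ext ?_ ?_
    · simp only [Transf.base]; ring
    · simp only [Transf.base, hsq]; ring
  · intro p hp
    have h2 := e₂ _ (mem_image_of_mem _ hp)
    have h1 := congrArg (hat g₂.a) (e₁ p hp)
    have hb : g₂.base (g₁.base p) = (g₂.a * g₁.a * p.1 + (g₂.a * g₁.b + g₂.b),
        g₂.ε * g₁.ε * √|g₂.a * g₁.a| * p.2
          + (g₂.ε * √|g₂.a| * g₁.X p.1 + g₂.X (g₁.a * p.1 + g₁.b))) := by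
      refine Prod.ext ?_ ?_
      · simp only [Transf.base]; ring
      · simp only [Transf.base, hsq]; ring
    rw [← hb, hat_mul_left ha₁ ha₂, abs_mul, deriv_deriv_add hI (contDiffOn_const.mul hX₁) hX₂
      (mem_times hp), deriv_deriv_const_mul hI hX₁ _ (mem_times hp),
      deriv_deriv_comp_affine hI hI' hg₂.2.2.1 hm (mem_times hp), ← abs_mul, hsq]
    rw [hat_mul, hat_ofReal, hat_add, hat_ofReal] at h1
    rw [Transf.shift_eq] at h1 h2
    simp only [Transf.base] at h1 h2 ⊢
    have hab : g₁.a ^ 2 = √|g₁.a| ^ 4 := by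
      rw [← sq_abs, show √|g₁.a| ^ 4 = (√|g₁.a| ^ 2) ^ 2 by ring, Real.sq_sqrt (abs_nonneg _)]
    have cA : ((|g₁.a| : ℝ) : ℂ) = ((√|g₁.a| : ℝ) : ℂ) ^ 2 := by
      exact_mod_cast (Real.sq_sqrt (abs_nonneg _)).symm
    have cε : (g₂.ε : ℂ) ^ 2 = 1 := by exact_mod_cast Transf.sq_eq_one_of hε₂
    have c₁ : ((√|g₁.a| : ℝ) : ℂ) ≠ 0 := by exact_mod_cast hs₁.ne'
    have c₂ : ((√|g₂.a| : ℝ) : ℂ) ≠ 0 := by exact_mod_cast hs₂.ne'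
    rw [abs_mul, hab]
    push_cast at h1 h2 ⊢
    generalize V'' _ = W at *
    generalize V' _ = W' at *
    generalize ((|g₁.a| : ℝ) : ℂ) = A at *
    generalize ((√|g₁.a| : ℝ) : ℂ) = s₁ at *
    generalize ((√|g₂.a| : ℝ) : ℂ) = s₂ at *
    linear_combination (norm := (field_simp; ring)) A * h2 + h1
      - g₁.ε * ((deriv (deriv g₁.X) p.1 : ℝ) : ℂ) * p.2 / (2 * s₁) * cε
      + g₂.ε * g₁.ε * ((deriv (deriv g₂.X) (g₁.a * p.1 + g₁.b) : ℝ) : ℂ) * s₁ * p.2 / (2 * s₂) * cA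

/-- As for transitivity, the base map is inverted and the phase is left to `exists_carries`. -/
theorem PotEquiv.symm (hf : IsNonlinearity f P) (hΩ : IsTXDomain Ω) (hV : ContDiffOn ℝ ∞ V Ω)
    (h : PotEquiv f P Ω V Ω' V') : PotEquiv f P Ω' V' Ω V := by
  have hΩ'd := h.isTXDomain hΩ
  have hV' := h.contDiffOn
  obtain ⟨g, h⟩ := h
  obtain ⟨hg, rfl, e⟩ := (Transf.carries_iff hf hΩ hV).1 h
  have hI := hΩ.isOpen_times
  have hI' := hΩ'd.isOpen_times
  obtain ⟨ha, hε, hX, -⟩ := id hg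
  have hs := Transf.sqrt_pos ha
  have hinv : ∀ t, g.a⁻¹ * (g.a * t + g.b) + -(g.a⁻¹ * g.b) = t := fun t => by field_simp; ring
  have hm : MapsTo (fun t => g.a⁻¹ * t + -(g.a⁻¹ * g.b)) (times (g.base '' Ω)) (times Ω) := by
    rw [Transf.times_image_base]
    rintro _ ⟨t, ht, rfl⟩
    simp only [hinv]
    exact ht
  have hXc := contDiffOn_comp_affine hX hm
  have hX'' := contDiffOn_deriv hI (contDiffOn_deriv hI hX)
  have hrc := contDiffOn_comp_affine (((hX''.mul hX).div_const (2 * g.a ^ 2)).sub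
    ((Transf.contDiffOn_shiftTime hI hg).div_const |g.a|)) hm
  have hsq : √|g.a⁻¹| = (√|g.a|)⁻¹ := by rw [abs_inv, Real.sqrt_inv]
  have hε2 := Transf.sq_eq_one_of hε
  have hbase : ∀ p : ℝ × ℝ, ((g.a⁻¹ * (g.base p).1 + -(g.a⁻¹ * g.b),
      g.ε * √|g.a⁻¹| * (g.base p).2
        + -(g.ε / √|g.a|) * g.X (g.a⁻¹ * (g.base p).1 + -(g.a⁻¹ * g.b))) : ℝ × ℝ) = p := by
    intro p
    simp only [Transf.base, hinv, hsq]
    refine Prod.ext rfl ?_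
    field_simp
    linear_combination (√|g.a| * p.2) * hε2
  suffices h : ∃ g' : Transf, g'.a = g.a⁻¹ ∧ g'.Carries f P (g.base '' Ω) V' Ω V
    from ⟨_, h.choose_spec.2⟩
  refine exists_carries hf hΩ'd hV' (inv_ne_zero ha) hε (b := -(g.a⁻¹ * g.b))
    (X := fun t => -(g.ε / √|g.a|) * g.X (g.a⁻¹ * t + -(g.a⁻¹ * g.b)))
    (contDiffOn_const.mul hXc) hrc ?_ ?_
  · rw [image_image]
    simp only [hbase, image_id']
  · rintro _ ⟨p, hp, rfl⟩
    have hp' := mem_times (mem_image_of_mem g.base hp)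
    have h1 := congrArg (hat g.a) (e p hp)
    rw [hat_mul, hat_ofReal, hat_add, hat_hat, hat_ofReal, Transf.shift_eq] at h1
    rw [hbase, hat_inv, deriv_deriv_const_mul hI' hXc _ hp', deriv_deriv_comp_affine hI' hI hX hm hp']
    have hb1 : g.a⁻¹ * (g.base p).1 + -(g.a⁻¹ * g.b) = p.1 := hinv p.1
    have hb2 : (g.base p).2 = g.ε * √|g.a| * p.2 + g.X p.1 := rfl
    simp only [hb1, hb2, hsq]
    rw [abs_inv]
    have cε : (g.ε : ℂ) ^ 2 = 1 := by exact_mod_cast hε2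
    have ca2 : (g.a : ℂ) ^ 2 = ((|g.a| : ℝ) : ℂ) ^ 2 := by exact_mod_cast (sq_abs g.a).symm
    have cA : ((|g.a| : ℝ) : ℂ) = ((√|g.a| : ℝ) : ℂ) ^ 2 := by
      exact_mod_cast (Real.sq_sqrt (abs_nonneg _)).symm
    have c₁ : ((√|g.a| : ℝ) : ℂ) ≠ 0 := by exact_mod_cast hs.ne'
    have c₂ : (g.a : ℂ) ≠ 0 := by exact_mod_cast ha
    push_cast at h1 ⊢
    simp only [inv_pow, ca2]
    rw [cA] at h1 ⊢
    generalize V' _ = W' at *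
    generalize ((√|g.a| : ℝ) : ℂ) = s at *
    linear_combination (norm := (field_simp; ring)) -h1 / s ^ 2
      + ((deriv (deriv g.X) p.1 : ℝ) : ℂ) * (g.ε * s * p.2 + g.X p.1) / (2 * s ^ 4) * cε

variable {Ω Ω' : Set (ℝ × ℝ)} {P : Set ℝ} {f : ℝ → ℂ} {V V' : ℝ × ℝ → ℂ}

/-! ### Potentials that admit fields without `∂_t`-component -/

/-- Subtracting the classifying conditions at two points of a slice eliminates σ and leaves χ_tt =
hχ. The two points serve only nearby times, so h is available only locally. Uniqueness for this
equation makes the set of times near which χ vanishes relatively closed as well as open. -/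
theorem IsSymmetry.frequently_ne_zero (hΩ : IsTXDomain Ω) (hV : ContDiffOn ℝ ∞ V Ω)
    {χ σ : ℝ → ℝ} (h : IsSymmetry Ω V 0 χ σ) (hne : ∃ t ∈ times Ω, χ t ≠ 0) {t : ℝ}
    (ht : t ∈ times Ω) : ∃ᶠ s in 𝓝 t, χ s ≠ 0 := by
  intro hcon
  simp only [not_not] at hcon
  obtain ⟨hχ, -, heq⟩ := h
  have hI := hΩ.isOpen_times
  set Z : Set ℝ := {t | ∀ᶠ s in 𝓝 t, χ s = 0} with hZ
  have hZo : IsOpen Z := isOpen_iff_mem_nhds.2 fun t ht => eventually_eventually_nhds.2 ht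
  -- Connectedness of the interval of times: a limit point t₀ of `Z` has a ball on which the
  -- equation for χ holds, and this ball contains a t₁ where χ has zero Cauchy data.
  have hsub : times Ω ⊆ Z := by
    refine (isPreconnected_iff_ordConnected.2 hΩ.ordConnected_times).subset_of_closure_inter_subset
      hZo ⟨t, ht, hcon⟩ ?_
    rintro t₀ ⟨hcl, h₀⟩
    obtain ⟨x₁, hx₁⟩ := exists_of_mem_times h₀
    obtain ⟨x₂, hx₂, hx⟩ := (infinite_slice hΩ.1 h₀).exists_notMem_finset {x₁}
    have hx12 : x₂ - x₁ ≠ 0 := sub_ne_zero.2 (by simpa using hx)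
    obtain ⟨ε, hε, hb⟩ := Metric.eventually_nhds_iff_ball.1
      ((eventually_mem_slice hΩ.1 hx₁).and (eventually_mem_slice hΩ.1 hx₂))
    have hJI : Metric.ball t₀ ε ⊆ times Ω := fun s hs => mem_times (hb s hs).1
    obtain ⟨t₁, h₁, h₁Z⟩ := mem_closure_iff.1 hcl _ Metric.isOpen_ball (Metric.mem_ball_self hε)
    have hcont : ∀ x : ℝ, (∀ s ∈ Metric.ball t₀ ε, (s, x) ∈ Ω) →
        ContinuousOn (fun s => (dx V (s, x)).re) (Metric.ball t₀ ε) := fun x hs =>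
      Complex.continuous_re.comp_continuousOn ((contDiffOn_dx hΩ.1 hV).continuousOn.comp
        (by fun_prop : Continuous fun s : ℝ => (s, x)).continuousOn hs)
    have key : ∀ s ∈ Metric.ball t₀ ε, deriv (deriv χ) s
        = 2 * ((dx V (s, x₂)).re - (dx V (s, x₁)).re) / (x₂ - x₁) * χ s := by
      intro s hs
      have e₁ := congrArg Complex.re (heq _ (hb s hs).1)
      have e₂ := congrArg Complex.re (heq _ (hb s hs).2)
      simp only [Complex.ofReal_zero, zero_mul, zero_add, Complex.re_ofReal_mul,
        Complex.ofReal_re] at e₁ e₂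
      field_simp
      linear_combination -2 * e₂ + 2 * e₁
    refine eventually_of_mem (Metric.isOpen_ball.mem_nhds (Metric.mem_ball_self hε)) fun s hs =>
      eq_zero_of_second_order Metric.isOpen_ball (by rw [Real.ball_eq_Ioo]; exact ordConnected_Ioo)
        ?_ (hχ.mono hJI) key h₁ h₁Z.self_of_nhds ?_ hs
    · exact (continuousOn_const.mul ((hcont x₂ fun s hs => (hb s hs).2).sub
        (hcont x₁ fun s hs => (hb s hs).1))).div_const _
    · have : χ =ᶠ[𝓝 t₁] fun _ => 0 := h₁Z
      rw [this.deriv_eq, deriv_const]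
  obtain ⟨s, hs, hχs⟩ := hne
  exact hχs (hsub hs).self_of_nhds

/-- Times with χ ≠ 0 are dense, so identities obtained after division by χ extend by continuity
along t. -/
theorem eq_zero_of_frequently {E : Type*} [NormedAddCommGroup E] (hΩ : IsOpen Ω) {χ : ℝ → ℝ}
    (hχ : ∀ t ∈ times Ω, ∃ᶠ s in 𝓝 t, χ s ≠ 0) {F : ℝ × ℝ → E} (hF : ContinuousOn F Ω)
    (h : ∀ p ∈ Ω, χ p.1 ≠ 0 → F p = 0) {p : ℝ × ℝ} (hp : p ∈ Ω) : F p = 0 := by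
  by_contra hne
  have h1 : ∀ᶠ q in 𝓝 p, F q ≠ 0 ∧ q ∈ Ω :=
    ((hF.continuousAt (hΩ.mem_nhds hp)).eventually_ne hne).and (hΩ.mem_nhds hp)
  have h2 : ∀ᶠ s in 𝓝 p.1, F (s, p.2) ≠ 0 ∧ (s, p.2) ∈ Ω :=
    (by fun_prop : Continuous fun s : ℝ => (s, p.2)).continuousAt.eventually h1
  obtain ⟨s, hs, hFs, hsΩ⟩ := ((hχ _ (mem_times hp)).and_eventually h2).exists
  exact hFs (h _ hsΩ hs)

/-- A potential that admits a field without `∂_t`-component is quadratic in `x`. -/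
theorem IsSymmetry.exists_quadratic (hΩ : IsTXDomain Ω) (hV : ContDiffOn ℝ ∞ V Ω)
    {χ σ : ℝ → ℝ} (h : IsSymmetry Ω V 0 χ σ) (hne : ∃ t ∈ times Ω, χ t ≠ 0) :
    ∃ v b : ℝ → ℝ, ∃ c : ℝ → ℂ, ContDiffOn ℝ ∞ v (times Ω) ∧ ContDiffOn ℝ ∞ b (times Ω) ∧
      ContDiffOn ℝ ∞ c (times Ω) ∧
      ∀ p ∈ Ω, V p = (v p.1 : ℂ) * (p.2 : ℂ) ^ 2 + (b p.1 : ℂ) * p.2 + c p.1 := by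
  have hfr := fun t (ht : t ∈ times Ω) => h.frequently_ne_zero hΩ hV hne ht
  obtain ⟨hχ, hσ, heq⟩ := h
  have hΩo := hΩ.1
  have h1s := contDiffOn_dx hΩo hV
  have h2s := contDiffOn_dx hΩo h1s
  have h3s := contDiffOn_dx hΩo h2s
  have hre : ∀ {k : ℝ → ℂ}, ContDiffOn ℝ ∞ k (times Ω) → ContDiffOn ℝ ∞ (fun t => (k t).re) (times Ω) :=
    fun hk => Complex.reCLM.contDiff.comp_contDiffOn hk
  have slice : ∀ p ∈ Ω, ∀ᶠ y in 𝓝 p.2, (p.1, y) ∈ Ω := fun p hp =>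
    (isOpen_slice hΩo p.1).mem_nhds hp
  -- The classifying condition is divided by χ: V_x is affine in x with real coefficients, though
  -- only where χ ≠ 0.
  have f1 : ∀ p ∈ Ω, χ p.1 ≠ 0 → dx V p
      = ((deriv (deriv χ) p.1 / (2 * χ p.1) * p.2 + deriv σ p.1 / χ p.1 : ℝ) : ℂ) := by
    intro p hp h0
    have h0' : (χ p.1 : ℂ) ≠ 0 := by exact_mod_cast h0
    have := heq p hp
    push_cast at this ⊢
    linear_combination (norm := (field_simp; ring)) this / χ p.1
  have f2 : ∀ p ∈ Ω, χ p.1 ≠ 0 → dx (dx V) p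
      = ((deriv (deriv χ) p.1 / (2 * χ p.1) : ℝ) : ℂ) := by
    intro p hp h0
    refine dx_eq (differentiableAt_of_contDiffOn hΩo h1s hp) ?_
    have hl : HasDerivAt (fun y => deriv (deriv χ) p.1 / (2 * χ p.1) * y + deriv σ p.1 / χ p.1)
        (deriv (deriv χ) p.1 / (2 * χ p.1)) p.2 :=
      (((hasDerivAt_id p.2).const_mul _).add_const _).congr_deriv (mul_one _)
    refine hl.ofReal_comp.congr_of_eventuallyEq ?_
    filter_upwards [slice p hp] with y hy using f1 (p.1, y) hy h0
  have f3 : ∀ p ∈ Ω, χ p.1 ≠ 0 → dx (dx (dx V)) p = 0 := by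
    intro p hp h0
    refine dx_eq (differentiableAt_of_contDiffOn hΩo h2s hp) ?_
    refine (hasDerivAt_const p.2 ((deriv (deriv χ) p.1 / (2 * χ p.1) : ℝ) : ℂ)).congr_of_eventuallyEq
      ?_
    filter_upwards [slice p hp] with y hy using f2 (p.1, y) hy h0
  have g3 : ∀ p ∈ Ω, dx (dx (dx V)) p = 0 := fun p hp =>
    eq_zero_of_frequently hΩo hfr h3s.continuousOn f3 hp
  have g2 : ∀ p ∈ Ω, (dx (dx V) p).im = 0 := fun p hp =>
    eq_zero_of_frequently hΩo hfr (Complex.continuous_im.comp_continuousOn h2s.continuousOn)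
      (fun p hp h0 => by rw [Function.comp_apply, f2 p hp h0, Complex.ofReal_im]) hp
  have g1 : ∀ p ∈ Ω, (dx V p).im = 0 := fun p hp =>
    eq_zero_of_frequently hΩo hfr (Complex.continuous_im.comp_continuousOn h1s.continuousOn)
      (fun p hp h0 => by rw [Function.comp_apply, f1 p hp h0, Complex.ofReal_im]) hp
  have real : ∀ z : ℂ, z.im = 0 → z = (z.re : ℂ) := fun z hz => Complex.ext rfl (by simpa using hz)
  obtain ⟨k, hk, hkv⟩ := hΩ.exists_descent h2s g3
  -- The coefficients are taken from V_xx, V_x and V rather than from quotients by χ, so they are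
  -- smooth across the zeros of χ.
  set v : ℝ → ℝ := fun t => (k t).re / 2 with hv
  have hvs : ContDiffOn ℝ ∞ v (times Ω) := (hre hk).div_const 2
  have hv2 : ∀ p ∈ Ω, dx (dx V) p = 2 * (v p.1 : ℂ) := by
    intro p hp
    rw [real _ (g2 p hp), hkv p hp, hv]
    push_cast; ring
  have z : ContDiffOn ℝ ∞ (fun _ : ℝ => (0 : ℂ)) (times Ω) := contDiffOn_const
  have hx : ContDiffOn ℝ ∞ (fun p : ℝ × ℝ => (p.2 : ℂ)) Ω := contDiffOn_ofReal contDiffOn_snd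
  have hl : ContDiffOn ℝ ∞ (fun p : ℝ × ℝ => 2 * (v p.1 : ℂ) * p.2) Ω :=
    (contDiffOn_const.mul (contDiffOn_ofReal (contDiffOn_comp_fst hvs))).mul hx
  obtain ⟨l, hls, hlv⟩ := hΩ.exists_descent (h1s.sub hl) fun p hp => by
    change dx (fun q => dx V q - 2 * (v q.1 : ℂ) * q.2) p = 0
    rw [dx_sub (differentiableAt_of_contDiffOn hΩo h1s hp)
      (differentiableAt_of_contDiffOn hΩo hl hp), hv2 p hp,
      dx_quadratic (b := fun t => 2 * (v t : ℂ)) hΩo z (contDiffOn_const.mul (contDiffOn_ofReal hvs)) z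
        (fun q _ => by ring) hp]
    ring
  set b : ℝ → ℝ := fun t => (l t).re with hb
  have hbs : ContDiffOn ℝ ∞ b (times Ω) := hre hls
  have hb1 : ∀ p ∈ Ω, dx V p = 2 * (v p.1 : ℂ) * p.2 + (b p.1 : ℂ) := by
    intro p hp
    have := congrArg Complex.re (hlv p hp)
    rw [real _ (g1 p hp), hb]
    simp only [← this]
    simp
  have hq : ContDiffOn ℝ ∞ (fun p : ℝ × ℝ => (v p.1 : ℂ) * (p.2 : ℂ) ^ 2 + (b p.1 : ℂ) * p.2) Ω :=
    ((contDiffOn_ofReal (contDiffOn_comp_fst hvs)).mul (hx.pow 2)).add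
      ((contDiffOn_ofReal (contDiffOn_comp_fst hbs)).mul hx)
  obtain ⟨c, hcs, hcv⟩ := hΩ.exists_descent (hV.sub hq) fun p hp => by
    change dx (fun q => V q - ((v q.1 : ℂ) * (q.2 : ℂ) ^ 2 + (b q.1 : ℂ) * q.2)) p = 0
    rw [dx_sub (differentiableAt_of_contDiffOn hΩo hV hp)
      (differentiableAt_of_contDiffOn hΩo hq hp), hb1 p hp,
      dx_quadratic (v := fun t => (v t : ℂ)) (b := fun t => (b t : ℂ)) hΩo (contDiffOn_ofReal hvs)
        (contDiffOn_ofReal hbs) z (fun q _ => by ring) hp]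
    ring
  refine ⟨v, b, c, hvs, hbs, hcs, fun p hp => ?_⟩
  rw [← hcv p hp]
  simp

variable {Ω Ω' : Set (ℝ × ℝ)} {P : Set ℝ} {f : ℝ → ℂ} {V V' : ℝ × ℝ → ℂ}

/-! ### Normalization of potentials -/

/-- The potential obtained from `V` by `x' = x + X(t)`. -/
def boost (X r : ℝ → ℝ) (V : ℝ × ℝ → ℂ) (q : ℝ × ℝ) : ℂ :=
  V (q.1, q.2 - X q.1) + ((deriv (deriv X) q.1 * (q.2 - X q.1) / 2 + r q.1 : ℝ) : ℂ)

/-- The image of `Ω` under `x' = x + X(t)`. -/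
def boostDomain (X : ℝ → ℝ) (Ω : Set (ℝ × ℝ)) : Set (ℝ × ℝ) :=
  {q | (q.1, q.2 - X q.1) ∈ Ω}

/-- With a = 1 the nonlinearity is preserved. Any `r` is allowed, because the phase Ψ can be chosen
to produce it. -/
theorem strictPotEquiv_boost (hf : IsNonlinearity f P) (hΩ : IsTXDomain Ω)
    (hV : ContDiffOn ℝ ∞ V Ω) {X r : ℝ → ℝ} (hX : ContDiffOn ℝ ∞ X (times Ω))
    (hr : ContDiffOn ℝ ∞ r (times Ω)) :
    StrictPotEquiv f P Ω V (boostDomain X Ω) (boost X r V) := by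
  obtain ⟨g, hga, hg⟩ := exists_carries (Ω' := boostDomain X Ω) (V' := boost X r V) (a := 1) (b := 0)
    (ε := 1) hf hΩ hV one_ne_zero (Or.inl rfl) hX hr
    (by
      ext q
      constructor
      · intro hq
        exact ⟨_, hq, Prod.ext (by simp) (by simp)⟩
      · rintro ⟨p, hp, rfl⟩
        simpa [boostDomain] using hp)
    (fun p _ => by simp [boost, hat])
  exact ⟨g, Or.inl hga, hg⟩

theorem times_boostDomain (X : ℝ → ℝ) (Ω : Set (ℝ × ℝ)) : times (boostDomain X Ω) = times Ω := by
  ext t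
  constructor
  · rintro ⟨q, hq, rfl⟩
    exact mem_times (p := (q.1, q.2 - X q.1)) hq
  · rintro ⟨p, hp, rfl⟩
    exact ⟨(p.1, p.2 + X p.1), by simpa [boostDomain] using hp, rfl⟩

/-- Straightening of a field with nonzero `∂_t`-component. -/
theorem IsSymmetry.exists_boost_autonomous (hf : IsNonlinearity f P) (hΩ : IsTXDomain Ω)
    (hV : ContDiffOn ℝ ∞ V Ω) {τ : ℝ} {χ σ : ℝ → ℝ} (h : IsSymmetry Ω V τ χ σ) (hτ : τ ≠ 0) :
    ∃ X r : ℝ → ℝ, ContDiffOn ℝ ∞ X (times Ω) ∧ ContDiffOn ℝ ∞ r (times Ω) ∧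
      ∀ q ∈ boostDomain X Ω, dt (boost X r V) q = 0 := by
  obtain ⟨hχ, hσ, heq⟩ := h
  have hI := hΩ.isOpen_times
  -- The new x-component of the field is χ + τX_t, and this choice makes it vanish.
  obtain ⟨X, hX, hXd⟩ := exists_primitive hI hΩ.ordConnected_times hΩ.nonempty_times
    (g := fun t => -(χ t / τ)) (hχ.div_const τ).neg
  -- The derivative of r cancels σ_t/τ and the product X_t X_tt/2 that arises from differentiating
  -- X_tt(x - X)/2.
  set r : ℝ → ℝ := fun t => χ t ^ 2 / (4 * τ ^ 2) - σ t / τ with hr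
  have hrs : ContDiffOn ℝ ∞ r (times Ω) := ((hχ.pow 2).div_const _).sub (hσ.div_const _)
  refine ⟨X, r, hX, hrs, fun q hq => ?_⟩
  have he := strictPotEquiv_boost hf hΩ hV hX hrs
  have hd := differentiableAt_of_contDiffOn (he.potEquiv.isTXDomain hΩ).1 he.potEquiv.contDiffOn hq
  have hqt : q.1 ∈ times Ω := mem_times (p := (q.1, q.2 - X q.1)) hq
  have hχ1 := contDiffOn_deriv hI hχ
  have hX1 : ∀ t ∈ times Ω, deriv X t = -(χ t / τ) := fun t ht => (hXd t ht).deriv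
  have hX2 : ∀ t ∈ times Ω, deriv (deriv X) t = -(deriv χ t / τ) := fun t ht => by
    rw [deriv_congr_of_isOpen hI hX1 ht]
    exact ((hasDerivAt_of_contDiffOn hI hχ ht).div_const τ).neg.deriv
  have hX3 : HasDerivAt (deriv (deriv X)) (-(deriv (deriv χ) q.1 / τ)) q.1 := by
    refine (((hasDerivAt_of_contDiffOn hI hχ1 hqt).div_const τ).neg).congr_of_eventuallyEq ?_
    filter_upwards [hI.mem_nhds hqt] with t ht using hX2 t ht
  have hrd : HasDerivAt r (2 * χ q.1 * deriv χ q.1 / (4 * τ ^ 2) - deriv σ q.1 / τ) q.1 :=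
    ((((hasDerivAt_of_contDiffOn hI hχ hqt).pow 2).div_const _).sub
      ((hasDerivAt_of_contDiffOn hI hσ hqt).div_const τ)).congr_deriv (by simp)
  have hcurve : HasDerivAt (fun t : ℝ => (t, q.2 - X t)) ((1 : ℝ), χ q.1 / τ) q.1 :=
    ((hasDerivAt_id q.1).prodMk ((hXd q.1 hqt).const_sub q.2)).congr_deriv (by simp)
  have hVc := HasFDerivAt.comp_hasDerivAt (f := fun t : ℝ => (t, q.2 - X t)) q.1
    (differentiableAt_of_contDiffOn hΩ.1 hV hq).hasFDerivAt hcurve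
  rw [fderiv_pair] at hVc
  have hs := ((hX3.mul ((hXd q.1 hqt).const_sub q.2)).div_const 2).add hrd
  refine (dt_eq hd (hVc.add hs.ofReal_comp)).trans ?_
  have e := heq _ hq
  have hτ' : (τ : ℂ) ≠ 0 := by exact_mod_cast hτ
  rw [hX2 _ hqt]
  push_cast at e ⊢
  linear_combination (norm := (field_simp; ring)) e / τ

/-- Normalization of a potential that is quadratic in `x`. -/
theorem exists_boost_quadratic (hΩ : IsTXDomain Ω) {v b : ℝ → ℝ} {c : ℝ → ℂ}
    (hv : ContDiffOn ℝ ∞ v (times Ω)) (hb : ContDiffOn ℝ ∞ b (times Ω))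
    (hc : ContDiffOn ℝ ∞ c (times Ω))
    (h : ∀ p ∈ Ω, V p = (v p.1 : ℂ) * (p.2 : ℂ) ^ 2 + (b p.1 : ℂ) * p.2 + c p.1) :
    ∃ X r : ℝ → ℝ, ContDiffOn ℝ ∞ X (times Ω) ∧ ContDiffOn ℝ ∞ r (times Ω) ∧
      ∀ q ∈ boostDomain X Ω, boost X r V q
        = ((v q.1 * q.2 ^ 2 : ℝ) : ℂ) + Complex.I * ((c q.1).im : ℂ) := by
  have hI := hΩ.isOpen_times
  obtain ⟨t₀, h₀⟩ := hΩ.nonempty_times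
  -- The coefficient of x after the shift is -2vX + b + X_tt/2, which gives this equation for X. The
  -- Cauchy data are immaterial.
  obtain ⟨X, hX, -, -, hXd⟩ := exists_second_order hI hΩ.ordConnected_times
    (h := fun t => 4 * v t) (k := fun t => -(2 * b t)) (contDiffOn_const.mul hv)
    (contDiffOn_const.mul hb).neg h₀ 0 0
  have hre : ContDiffOn ℝ ∞ (fun t => (c t).re) (times Ω) :=
    Complex.reCLM.contDiff.comp_contDiffOn hc
  -- The x-free part becomes c - vX² + r. The real function r removes all of it but i Im c.
  refine ⟨X, fun t => v t * X t ^ 2 - (c t).re, hX, (hv.mul (hX.pow 2)).sub hre, fun q hq => ?_⟩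
  have hqt : q.1 ∈ times Ω := mem_times (p := (q.1, q.2 - X q.1)) hq
  rw [boost, h _ hq, hXd _ hqt]
  have := Complex.re_add_im (c q.1)
  push_cast
  linear_combination -this

theorem dt_eq_zero_of_isOscillator (hΩ : IsOpen Ω) {s ν : ℝ} (h : IsOscillator s ν Ω V)
    {p : ℝ × ℝ} (hp : p ∈ Ω) : dt V p = 0 := by
  rw [dt_congr (eventuallyEq_of_eqOn hΩ h hp)]
  refine dt_eq (DifferentiableAt.add_const _ ?_) (hasDerivAt_const p.1 (((s * p.2 ^ 2 : ℝ) : ℂ) + Complex.I * (ν : ℂ)))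
  have h1 : DifferentiableAt ℝ (fun q : ℝ × ℝ => s * q.2 ^ 2) p := by fun_prop
  exact Complex.ofRealCLM.differentiable.differentiableAt.comp p h1

theorem Case3.exists_isOscillator (h : Case3 Ω V) : ∃ ν, IsOscillator 0 ν Ω V := by
  rcases h with h | h
  · exact ⟨0, fun p hp => by simp [h p hp]⟩
  · exact ⟨1, fun p hp => by simp [h p hp]⟩

/-- Potentials with additional fields are equivalent to autonomous ones or to those of Case 2. -/
theorem HasExtension.exists_strictPotEquiv (hf : IsNonlinearity f P) (hΩ : IsTXDomain Ω)
    (hV : ContDiffOn ℝ ∞ V Ω) (h : HasExtension Ω V) :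
    ∃ Ω' V', StrictPotEquiv f P Ω V Ω' V' ∧ ((∀ p ∈ Ω', dt V' p = 0) ∨ Case2 Ω' V') := by
  obtain ⟨τ, χ, σ, hs, hne⟩ := h
  by_cases hτ : τ = 0
  · subst hτ
    obtain ⟨v, b, c, hv, hb, hc, hq⟩ := hs.exists_quadratic hΩ hV (hne.resolve_left (by simp))
    obtain ⟨X, r, hX, hr, hB⟩ := exists_boost_quadratic hΩ hv hb hc hq
    have he := strictPotEquiv_boost hf hΩ hV hX hr
    have hcim : ContDiffOn ℝ ∞ (fun t => (c t).im) (times Ω) :=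
      Complex.imCLM.contDiff.comp_contDiffOn hc
    refine ⟨_, _, he, ?_⟩
    rw [← times_boostDomain X Ω] at hv hcim
    by_cases hd : ∃ t ∈ times (boostDomain X Ω), deriv v t ≠ 0 ∨ deriv (fun t => (c t).im) t ≠ 0
    · exact Or.inr ⟨v, fun t => (c t).im, hv, hcim, hd, hB⟩
    · left
      push Not at hd
      have hΩ' := he.potEquiv.isTXDomain hΩ
      intro p hp
      rw [dt_quadratic (v := fun t => (v t : ℂ)) (b := fun _ => 0)
        (c := fun t => Complex.I * ((c t).im : ℂ)) hΩ'.1 hΩ'.isOpen_times (contDiffOn_ofReal hv)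
        contDiffOn_const (contDiffOn_const.mul (contDiffOn_ofReal hcim))
        (fun q hq => by rw [hB q hq]; push_cast; ring) hp]
      obtain ⟨d1, d2⟩ := hd _ (mem_times hp)
      have e1 := (hasDerivAt_of_contDiffOn hΩ'.isOpen_times hv (mem_times hp)).ofReal_comp.deriv
      have e2 := ((hasDerivAt_of_contDiffOn hΩ'.isOpen_times hcim
        (mem_times hp)).ofReal_comp.const_mul Complex.I).deriv
      rw [e1, e2, d1, d2]
      simp
  · obtain ⟨X, r, hX, hr, h0⟩ := hs.exists_boost_autonomous hf hΩ hV hτ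
    exact ⟨_, _, strictPotEquiv_boost hf hΩ hV hX hr, Or.inl h0⟩

/-- An oscillator potential is equivalent to one of Cases 3, 4 and 5. -/
theorem IsOscillator.exists_potEquiv (hf : IsNonlinearity f P) (hΩ : IsTXDomain Ω)
    (hV : ContDiffOn ℝ ∞ V Ω) {s ν : ℝ} (h : IsOscillator s ν Ω V) :
    ∃ Ω' V', PotEquiv f P Ω V Ω' V' ∧ (Case3 Ω' V' ∨ Case4 Ω' V' ∨ Case5 Ω' V') := by
  -- Under the pure scaling t' = at the coefficient s is divided by a² and ν by a.
  have scale : ∀ a : ℝ, a ≠ 0 → ∀ s' ν' : ℝ, a ^ 2 * s' = s → |a| * ν' = SignType.sign a * ν →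
      ∃ Ω' V', PotEquiv f P Ω V Ω' V' ∧ IsOscillator s' ν' Ω' V' := by
    intro a ha s' ν' h1 h2
    set V' : ℝ × ℝ → ℂ := fun q => ((s' * q.2 ^ 2 : ℝ) : ℂ) + Complex.I * (ν' : ℂ) with hV'
    obtain ⟨g, -, hg⟩ := exists_carries (V' := V') (b := 0) (ε := 1) (X := fun _ => 0)
      (r := fun _ => 0) hf hΩ hV ha (Or.inl rfl) contDiffOn_const contDiffOn_const rfl
      (fun p hp => by
        have hsq : √|a| ^ 2 = |a| := Real.sq_sqrt (abs_nonneg _)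
        have e1 : |a| * (s' * (1 * √|a| * p.2 + 0) ^ 2) = s * p.2 ^ 2 := by
          rw [← h1, ← sq_abs a]
          linear_combination |a| * s' * p.2 ^ 2 * hsq
        have e1' : ((|a| : ℝ) : ℂ) * ((s' * (1 * √|a| * p.2 + 0) ^ 2 : ℝ) : ℂ)
            = ((s * p.2 ^ 2 : ℝ) : ℂ) := by exact_mod_cast e1
        have e2' : ((|a| : ℝ) : ℂ) * ν' = ((SignType.sign a : ℝ) : ℂ) * ν := by exact_mod_cast h2
        rw [h p hp, hat_add, hat_mul, hat_ofReal, hat_ofReal, hat_I ha, hV', mul_add, e1']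
        simp only [deriv_const', deriv_const]
        push_cast
        linear_combination Complex.I * e2')
    exact ⟨_, _, ⟨g, hg⟩, fun q _ => rfl⟩
  rcases lt_trichotomy s 0 with hs | hs | hs
  · have h1 : 0 < √(-s) := Real.sqrt_pos.2 (by linarith)
    obtain ⟨Ω', V', he, ho⟩ := scale √(-s) h1.ne' (-1) (ν / √(-s))
      (by rw [Real.sq_sqrt (by linarith)]; ring)
      (by rw [abs_of_pos h1, sign_pos h1]; field_simp; simp)
    exact ⟨Ω', V', he, Or.inr (Or.inr ⟨_, ho⟩)⟩
  · subst hs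
    by_cases hν : ν = 0
    · subst hν
      obtain ⟨Ω', V', he, ho⟩ := scale 1 one_ne_zero 0 0 (by simp) (by simp)
      exact ⟨Ω', V', he, Or.inl (Or.inl fun p hp => by simp [ho p hp])⟩
    -- Scaling by a = ν normalizes iν to i. A negative ν is covered because a < 0 reverses time and
    -- conjugates.
    · obtain ⟨Ω', V', he, ho⟩ := scale ν hν 0 1 (by simp) (by rw [sign_mul_self, mul_one])
      exact ⟨Ω', V', he, Or.inl (Or.inr fun p hp => by simp [ho p hp])⟩
  · have h1 : 0 < √s := Real.sqrt_pos.2 hs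
    obtain ⟨Ω', V', he, ho⟩ := scale √s h1.ne' 1 (ν / √s)
      (by rw [Real.sq_sqrt hs.le]; ring)
      (by rw [abs_of_pos h1, sign_pos h1]; field_simp; simp)
    exact ⟨Ω', V', he, Or.inr (Or.inl ⟨_, ho⟩)⟩

/-- An autonomous potential that is quadratic in `x` is equivalent to one of Cases 3, 4 and 5. -/
theorem IsSymmetry.exists_potEquiv_of_autonomous (hf : IsNonlinearity f P) (hΩ : IsTXDomain Ω)
    (hV : ContDiffOn ℝ ∞ V Ω) (h0 : ∀ p ∈ Ω, dt V p = 0) {χ σ : ℝ → ℝ}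
    (h : IsSymmetry Ω V 0 χ σ) (hne : ∃ t ∈ times Ω, χ t ≠ 0) :
    ∃ Ω' V', PotEquiv f P Ω V Ω' V' ∧ (Case3 Ω' V' ∨ Case4 Ω' V' ∨ Case5 Ω' V') := by
  have hI := hΩ.isOpen_times
  obtain ⟨v, b, c, hv, hb, hc, hq⟩ := h.exists_quadratic hΩ hV hne
  -- Since V_t vanishes for all x of a slice, so do the derivatives of all three coefficients.
  have hd : ∀ t ∈ times Ω, deriv (fun t => (v t : ℂ)) t = 0 ∧ deriv (fun t => (b t : ℂ)) t = 0
      ∧ deriv c t = 0 := fun t ht => quadratic_eq_zero hΩ.1 ht fun x hx => by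
    rw [← h0 _ hx, dt_quadratic hΩ.1 hI (contDiffOn_ofReal hv) (contDiffOn_ofReal hb) hc hq hx]
  have cst := fun {k : ℝ → ℂ} (hk : ContDiffOn ℝ ∞ k (times Ω)) (h0 : ∀ t ∈ times Ω, deriv k t = 0) =>
    exists_const_of_deriv_eq_zero hI hΩ.ordConnected_times hΩ.nonempty_times hk h0
  obtain ⟨v₀, hv₀⟩ := cst (contDiffOn_ofReal hv) fun t ht => (hd t ht).1
  obtain ⟨c₀, hc₀⟩ := cst hc fun t ht => (hd t ht).2.2
  obtain ⟨X, r, hX, hr, hB⟩ := exists_boost_quadratic hΩ hv hb hc hq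
  have he := (strictPotEquiv_boost hf hΩ hV hX hr).potEquiv
  -- The shift changes neither v nor Im c, so the resulting potential is an oscillator with constant
  -- parameters.
  have ho : IsOscillator v₀.re c₀.im (boostDomain X Ω) (boost X r V) := fun q hqm => by
    have hqt : q.1 ∈ times Ω := mem_times (p := (q.1, q.2 - X q.1)) hqm
    have : v q.1 = v₀.re := by rw [← hv₀ _ hqt, Complex.ofReal_re]
    rw [hB q hqm, hc₀ _ hqt, this]
  obtain ⟨Ω', V', he', hcase⟩ := ho.exists_potEquiv hf (he.isTXDomain hΩ) he.contDiffOn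
  exact ⟨Ω', V', he.trans hf hΩ hV he', hcase⟩

variable {Ω Ω' : Set (ℝ × ℝ)} {P : Set ℝ} {f : ℝ → ℂ} {V V' : ℝ × ℝ → ℂ}

/-! ### The classification -/

theorem dt_eq_zero_of_cases (hΩ : IsOpen Ω) (h : Case3 Ω V ∨ Case4 Ω V ∨ Case5 Ω V) {p : ℝ × ℝ}
    (hp : p ∈ Ω) : dt V p = 0 := by
  rcases h with h | ⟨ν, h⟩ | ⟨ν, h⟩
  · obtain ⟨ν, h⟩ := h.exists_isOscillator
    exact dt_eq_zero_of_isOscillator hΩ h hp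
  all_goals exact dt_eq_zero_of_isOscillator hΩ h hp

theorem hasExtension_of_autonomous (h : ∀ p ∈ Ω, dt V p = 0) : HasExtension Ω V :=
  ⟨1, fun _ => 0, fun _ => 0, ⟨contDiffOn_const, contDiffOn_const, fun p hp => by simp [h p hp]⟩,
    Or.inl one_ne_zero⟩

theorem IsFundamentalSystem.exists_ne_zero {I : Set ℝ} {v χ₁ χ₂ : ℝ → ℝ}
    (h : IsFundamentalSystem v I χ₁ χ₂) : ∃ t ∈ I, χ₁ t ≠ 0 := by
  by_contra! hcon
  exact one_ne_zero (h.2.2.2.2 1 0 fun t ht => by simp [hcon t ht]).1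

theorem Case2.hasExtension (hΩ : IsTXDomain Ω) (h : Case2 Ω V) : HasExtension Ω V := by
  obtain ⟨v, w, hv, hw, -, hV⟩ := h
  obtain ⟨χ₁, χ₂, hχ⟩ := exists_isFundamentalSystem hΩ.isOpen_times hΩ.ordConnected_times
    hΩ.nonempty_times hv
  exact ⟨0, χ₁, fun _ => 0, (isSymmetry_quadratic_iff hΩ hv hw hV).2 ⟨hχ.1, contDiffOn_const,
    fun t ht => ⟨by simp, by simp, hχ.2.2.1 t ht, by simp⟩⟩, Or.inr hχ.exists_ne_zero⟩

/-- A potential of Case 2 admits no field with nonzero `∂_t`-component. -/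
theorem Case2.eq_zero_of_isSymmetry (hΩ : IsTXDomain Ω) (h : Case2 Ω V) {τ : ℝ} {χ σ : ℝ → ℝ}
    (hs : IsSymmetry Ω V τ χ σ) : τ = 0 := by
  obtain ⟨v, w, hv, hw, ⟨t, ht, hne⟩, hV⟩ := h
  obtain ⟨-, -, he⟩ := (isSymmetry_quadratic_iff hΩ hv hw hV).1 hs
  obtain ⟨h1, h2, -⟩ := he t ht
  rcases hne with h | h
  · exact (mul_eq_zero.1 h1).resolve_right h
  · exact (mul_eq_zero.1 h2).resolve_right h

/-- The potentials that admit additional fields. -/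
theorem IsNonlinearity.lieAlgebra_ne_kernel_iff (hf : IsNonlinearity f P) (hΩ : IsTXDomain Ω)
    (hV : ContDiffOn ℝ ∞ V Ω) :
    lieAlgebra f P Ω V ≠ kernelAlgebra f P Ω ↔
      ∃ (Ω' : Set (ℝ × ℝ)) (V' : ℝ × ℝ → ℂ),
        (StrictPotEquiv f P Ω V Ω' V' ∧ (Case1 f P Ω' V' ∨ Case2 Ω' V')) ∨
        (PotEquiv f P Ω V Ω' V' ∧ (Case3 Ω' V' ∨ Case4 Ω' V' ∨ Case5 Ω' V')) := by
  rw [hf.lieAlgebra_ne_iff_hasExtension hΩ hV]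
  constructor
  · intro h
    obtain ⟨Ω', V', he, h0 | h2⟩ := h.exists_strictPotEquiv hf hΩ hV
    · by_cases h1 : Case1 f P Ω' V'
      · exact ⟨Ω', V', Or.inl ⟨he, Or.inl h1⟩⟩
      · have : ∃ Ω'' V'', PotEquiv f P Ω' V' Ω'' V''
            ∧ (Case3 Ω'' V'' ∨ Case4 Ω'' V'' ∨ Case5 Ω'' V'') := by
          by_contra! hcon
          refine h1 ⟨h0, fun Ω'' V'' h hc => ?_⟩
          obtain ⟨h3, h4, h5⟩ := hcon Ω'' V'' h
          exact hc.elim h3 fun hc => hc.elim h4 h5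
        obtain ⟨Ω'', V'', he', hc⟩ := this
        exact ⟨Ω'', V'', Or.inr ⟨he.potEquiv.trans hf hΩ hV he', hc⟩⟩
    · exact ⟨Ω', V', Or.inl ⟨he, Or.inr h2⟩⟩
  · rintro ⟨Ω', V', ⟨he, h1 | h2⟩ | ⟨he, hc⟩⟩
    · exact he.potEquiv.hasExtension hf hΩ hV (hasExtension_of_autonomous h1.1)
    · exact he.potEquiv.hasExtension hf hΩ hV (h2.hasExtension (he.potEquiv.isTXDomain hΩ))
    · exact he.hasExtension hf hΩ hV (hasExtension_of_autonomous fun p hp =>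
        dt_eq_zero_of_cases (he.isTXDomain hΩ).1 hc hp)

/-- Subtracting τ∂_t leaves a field without ∂_t-component. If its χ were not zero, the autonomous
potential would be equivalent to one of Cases 3, 4, 5, which the definition of Case 1 forbids. -/
theorem IsNonlinearity.isBasisOf_case1 (hf : IsNonlinearity f P) (hΩ : IsTXDomain Ω)
    (hV : ContDiffOn ℝ ∞ V Ω) (h : Case1 f P Ω V) :
    IsBasisOf ![fieldM, fieldDt] (lieAlgebra f P Ω V) := by
  have hI := hΩ.isOpen_times
  have hsum : ∀ (c τ : ℝ) (z : Space),
      c • fieldM z + τ • fieldDt z = symField τ (fun _ => 0) (fun _ => c) z := by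
    intro c τ z
    simp [symField, fieldM, fieldDt]
  refine isBasisOf_of (fun c h0 => ?_) fun R => ?_
  · obtain ⟨ψ, hψ, hm⟩ := exists_mem_phaseDomain (Ω := Ω) hf.nonempty hf.pos
    obtain ⟨p, hp⟩ := hΩ.2.1
    have e := h0 _ (hm p hp)
    simp only [Fin.sum_univ_two, Matrix.cons_val_zero, Matrix.cons_val_one, hsum, symField,
      deriv_const] at e
    have e1 := congrArg Prod.fst e
    have e2 := congrArg (fun z : Space => z.2.2) e
    intro i
    fin_cases i
    · simpa [hψ] using e2
    · simpa using e1
  · rw [hf.mem_lieAlgebra_iff hΩ hV]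
    constructor
    · rintro ⟨τ, χ, σ, ⟨hχ, hσ, he⟩, rfl⟩
      have hs : IsSymmetry Ω V 0 χ σ := ⟨hχ, hσ, fun p hp => by
        rw [← he p hp, h.1 p hp]; simp⟩
      have hχ0 : ∀ t ∈ times Ω, χ t = 0 := by
        by_contra! hne
        obtain ⟨Ω', V', he', hc⟩ := hs.exists_potEquiv_of_autonomous hf hΩ hV h.1 hne
        exact h.2 Ω' V' he' hc
      have hσ0 : ∀ t ∈ times Ω, deriv σ t = 0 := by
        intro t ht
        obtain ⟨x, hx⟩ := exists_of_mem_times ht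
        have e := hs.2.2 _ hx
        have d1 : ∀ s ∈ times Ω, deriv χ s = 0 := fun s hs => by
          rw [deriv_congr_of_isOpen hI hχ0 hs, deriv_const]
        rw [deriv_congr_of_isOpen hI d1 ht, deriv_const, hχ0 t ht] at e
        simpa using e.symm
      obtain ⟨c, hc⟩ := exists_const_of_deriv_eq_zero hI hΩ.ordConnected_times hΩ.nonempty_times
        hσ hσ0
      refine ⟨![c, τ], ?_⟩
      rw [symField_congr hI rfl fun t ht => ⟨hχ0 t ht, hc t ht⟩]
      funext z
      simpa [Fin.sum_univ_two] using hsum c τ z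
    · rintro ⟨c, rfl⟩
      refine ⟨c 1, fun _ => 0, fun _ => c 0, ⟨contDiffOn_const, contDiffOn_const, fun p hp => by
        simp [h.1 p hp]⟩, ?_⟩
      funext z
      simpa [Fin.sum_univ_two] using (hsum (c 0) (c 1) z).symm

/-! ### Inequivalence of the listed potentials. -/

/-- The transformations between oscillator potentials. -/
theorem Transf.Carries.isOscillator {g : Transf} (hf : IsNonlinearity f P) (hΩ : IsTXDomain Ω)
    (hV : ContDiffOn ℝ ∞ V Ω) (h : g.Carries f P Ω V Ω' V') {s ν s' ν' : ℝ}
    (h1 : IsOscillator s ν Ω V) (h2 : IsOscillator s' ν' Ω' V') :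
    g.a ≠ 0 ∧ g.a ^ 2 * s' = s ∧ |g.a| * ν' = SignType.sign g.a * ν := by
  obtain ⟨hg, rfl, e⟩ := (Transf.carries_iff hf hΩ hV).1 h
  have ha := hg.1
  obtain ⟨t, ht⟩ := hΩ.nonempty_times
  set k := √|g.a| with hk
  have hk2 : k ^ 2 = |g.a| := Real.sq_sqrt (abs_nonneg _)
  have hε2 := Transf.sq_eq_one_of hg.2.1
  -- The transformation formula on one slice is an identity between quadratics in x. The shift has
  -- no x²-term and is real, so it affects neither the leading coefficient nor the imaginary part.
  obtain ⟨q1, -, q3⟩ := quadratic_eq_zero hΩ.1 ht (a := ((g.a ^ 2 * s' - s : ℝ) : ℂ))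
    (b := ((|g.a| * s' * (2 * g.ε * k * g.X t) - g.ε * deriv (deriv g.X) t / (2 * k) : ℝ) : ℂ))
    (c := ((|g.a| * s' * g.X t ^ 2 - g.shiftTime t : ℝ) : ℂ)
      + ((|g.a| * ν' - SignType.sign g.a * ν : ℝ) : ℂ) * Complex.I) fun x hx => by
    have h0 := e _ hx
    rw [h1 _ hx, h2 _ (mem_image_of_mem _ hx), hat_add, hat_mul, hat_ofReal, hat_ofReal, hat_I ha,
      Transf.shift_eq] at h0
    simp only [Transf.base, ← hk] at h0
    have cε : (g.ε : ℂ) ^ 2 = 1 := by exact_mod_cast hε2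
    have ck : (k : ℂ) ^ 2 = ((|g.a| : ℝ) : ℂ) := by exact_mod_cast hk2
    have ca : ((|g.a| : ℝ) : ℂ) ^ 2 = (g.a : ℂ) ^ 2 := by exact_mod_cast sq_abs g.a
    push_cast at h0 ⊢
    linear_combination h0 - s' * x ^ 2 * ca - ((|g.a| : ℝ) : ℂ) * s' * x ^ 2 * ck
      - ((|g.a| : ℝ) : ℂ) * s' * k ^ 2 * x ^ 2 * cε
  refine ⟨ha, by linarith [Complex.ofReal_eq_zero.1 q1], ?_⟩
  have := congrArg Complex.im q3
  simp only [Complex.add_im, Complex.ofReal_im, Complex.mul_im, Complex.I_im,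
    Complex.I_re, Complex.ofReal_re, Complex.zero_im, mul_zero, mul_one, zero_add, add_zero] at this
  linarith

/-- The factor a² is positive, hence preserves the sign of s, and ν is multiplied by a nonzero
number. -/
theorem PotEquiv.eq_of_isOscillator (hf : IsNonlinearity f P) (hΩ : IsTXDomain Ω)
    (hV : ContDiffOn ℝ ∞ V Ω) (h : PotEquiv f P Ω V Ω' V') {s ν s' ν' : ℝ}
    (h1 : IsOscillator s ν Ω V) (h2 : IsOscillator s' ν' Ω' V') :
    SignType.sign s = SignType.sign s' ∧ (ν = 0 ↔ ν' = 0) := by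
  obtain ⟨g, hg⟩ := h
  obtain ⟨ha, e1, e2⟩ := hg.isOscillator hf hΩ hV h1 h2
  have hs : (SignType.sign g.a : ℝ) ≠ 0 := by
    rcases lt_or_gt_of_ne ha with h | h
    · simp [sign_neg h]
    · simp [sign_pos h]
  constructor
  · rw [← e1, sign_mul, sign_pos (by positivity), one_mul]
  · constructor
    · rintro rfl
      exact (mul_eq_zero.1 (e2.trans (mul_zero _))).resolve_left (abs_pos.2 ha).ne'
    · rintro rfl
      exact (mul_eq_zero.1 (e2.symm.trans (mul_zero _))).resolve_left hs

/-- The pullback of ∂_t would have ∂_t-component 1/a ≠ 0, which Case 2 excludes. -/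
theorem PotEquiv.not_case2_of_autonomous (hf : IsNonlinearity f P) (hΩ : IsTXDomain Ω)
    (hV : ContDiffOn ℝ ∞ V Ω) (h : PotEquiv f P Ω V Ω' V') (h2 : Case2 Ω V) :
    ¬ ∀ p ∈ Ω', dt V' p = 0 := by
  intro h0
  obtain ⟨τ, χ, σ, hτ, hs⟩ := h.exists_isSymmetry_one hf hΩ hV h0
  exact hτ (h2.eq_zero_of_isSymmetry hΩ hs)

/-- Potentials of different cases are inequivalent. -/
theorem PotEquiv.tableCase_unique (hf : IsNonlinearity f P) (hΩ : IsTXDomain Ω)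
    (hV : ContDiffOn ℝ ∞ V Ω) (h : PotEquiv f P Ω V Ω' V') (i j : Fin 5)
    (hi : TableCase f P i Ω V) (hj : TableCase f P j Ω' V') : i = j := by
  have hΩ' := h.isTXDomain hΩ
  have hV' := h.contDiffOn
  have hsym := h.symm hf hΩ hV
  have auto : ∀ {U : Set (ℝ × ℝ)} {W : ℝ × ℝ → ℂ} (k : Fin 5), IsTXDomain U →
      TableCase f P k U W → k ≠ 1 → ∀ p ∈ U, dt W p = 0 := by
    intro U W k hU hk h1 p hp
    fin_cases k
    · exact hk.1 p hp
    · exact absurd rfl h1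
    · exact dt_eq_zero_of_cases hU.1 (Or.inl hk) hp
    · exact dt_eq_zero_of_cases hU.1 (Or.inr (Or.inl hk)) hp
    · exact dt_eq_zero_of_cases hU.1 (Or.inr (Or.inr hk)) hp
  have special : ∀ {U : Set (ℝ × ℝ)} {W : ℝ × ℝ → ℂ} (k : Fin 5), TableCase f P k U W →
      k ≠ 0 → k ≠ 1 → Case3 U W ∨ Case4 U W ∨ Case5 U W := by
    intro U W k hk h0 h1
    fin_cases k
    · exact absurd rfl h0
    · exact absurd rfl h1
    · exact Or.inl hk
    · exact Or.inr (Or.inl hk)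
    · exact Or.inr (Or.inr hk)
  -- The first two entries of the vector are placeholders for Cases 1 and 2 and are never used. The
  -- other entries 0, 1, -1 differ in sign, which separates Cases 3, 4, 5.
  have osc : ∀ {U : Set (ℝ × ℝ)} {W : ℝ × ℝ → ℂ} (k : Fin 5), TableCase f P k U W →
      k ≠ 0 → k ≠ 1 → ∃ ν, IsOscillator (![2, 2, 0, 1, -1] k) ν U W := by
    intro U W k hk h0 h1
    fin_cases k
    · exact absurd rfl h0
    · exact absurd rfl h1
    · exact Case3.exists_isOscillator hk
    · exact hk
    · exact hk
  by_cases i1 : i = 1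
  · subst i1
    by_contra hne
    exact h.not_case2_of_autonomous hf hΩ hV hi (auto j hΩ' hj (Ne.symm hne))
  by_cases j1 : j = 1
  · subst j1
    exact absurd (auto i hΩ hi i1) (hsym.not_case2_of_autonomous hf hΩ' hV' hj)
  by_cases i0 : i = 0
  · subst i0
    by_contra hne
    exact hi.2 Ω' V' h (special j hj (Ne.symm hne) j1)
  by_cases j0 : j = 0
  · subst j0
    exact absurd (special i hi i0 i1) (hj.2 Ω V hsym)
  obtain ⟨ν, h1⟩ := osc i hi i0 i1
  obtain ⟨ν', h2⟩ := osc j hj j0 j1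
  have hs := (h.eq_of_isOscillator hf hΩ hV h1 h2).1
  fin_cases i <;> fin_cases j <;> simp_all

/-- Equal s ≠ 0 force a² = 1. The value a = -1 is time reversal and changes the sign of ν. -/
theorem PotEquiv.oscillator_parameter (hf : IsNonlinearity f P) (hΩ : IsTXDomain Ω)
    (hV : ContDiffOn ℝ ∞ V Ω) (h : PotEquiv f P Ω V Ω' V') {s ν ν' : ℝ} (hs : s = 1 ∨ s = -1)
    (h1 : IsOscillator s ν Ω V) (h2 : IsOscillator s ν' Ω' V') : ν' = ν ∨ ν' = -ν := by
  obtain ⟨g, hg⟩ := h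
  obtain ⟨-, e1, e2⟩ := hg.isOscillator hf hΩ hV h1 h2
  have h3 : g.a ^ 2 = 1 := by rcases hs with rfl | rfl <;> linarith
  rcases mul_self_eq_one_iff.1 ((sq g.a).symm.trans h3) with h | h
  · left; simpa [h] using e2
  · right; simpa [h] using e2

/-- If f is not real-valued, a strict equivalence has a = 1. -/
theorem StrictPotEquiv.oscillator_parameter (hf : IsNonlinearity f P) (hΩ : IsTXDomain Ω)
    (hV : ContDiffOn ℝ ∞ V Ω) (h : StrictPotEquiv f P Ω V Ω' V') (hne : ∃ ρ ∈ P, (f ρ).im ≠ 0)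
    {s ν ν' : ℝ} (h1 : IsOscillator s ν Ω V) (h2 : IsOscillator s ν' Ω' V') : ν' = ν := by
  obtain ⟨g, ha, hg⟩ := h
  obtain ⟨-, -, e2⟩ := hg.isOscillator hf hΩ hV h1 h2
  obtain ⟨ρ, hρ, hi⟩ := hne
  have ha1 : g.a = 1 := ha.resolve_right fun h => hi (h.2 ρ hρ)
  simpa [ha1] using e2

end NLS

end

/-! ### The classification theorem. -/

theorem mainTheorem5 (P : Set ℝ) (hPo : IsOpen P) (hPc : P.OrdConnected)
    (hP0 : P ⊆ Set.Ioi 0) (f : ℝ → ℂ) (hf : ContDiffOn ℝ ∞ f P)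
    (hfc : ¬ ∃ c : ℝ, ∀ ρ ∈ P, (ρ : ℂ) * deriv (deriv f) ρ = (c : ℂ) * deriv f ρ) :
    -- the kernel algebra is `⟨M⟩`
    (∀ Ω : Set (ℝ × ℝ), NLS.IsTXDomain Ω →
      NLS.IsBasisOf ![NLS.fieldM] (NLS.kernelAlgebra f P Ω)) ∧
    -- the potentials with an extension are those that are equivalent to a potential of the list
    (∀ (Ω : Set (ℝ × ℝ)) (V : ℝ × ℝ → ℂ), NLS.IsTXDomain Ω → ContDiffOn ℝ ∞ V Ω →
      (NLS.lieAlgebra f P Ω V ≠ NLS.kernelAlgebra f P Ω ↔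
        ∃ (Ω' : Set (ℝ × ℝ)) (V' : ℝ × ℝ → ℂ),
          (NLS.StrictPotEquiv f P Ω V Ω' V' ∧ (NLS.Case1 f P Ω' V' ∨ NLS.Case2 Ω' V')) ∨
          (NLS.PotEquiv f P Ω V Ω' V' ∧
            (NLS.Case3 Ω' V' ∨ NLS.Case4 Ω' V' ∨ NLS.Case5 Ω' V')))) ∧
    -- the maximal Lie invariance algebras of the potentials of the list
    (∀ (Ω : Set (ℝ × ℝ)) (V : ℝ × ℝ → ℂ), NLS.IsTXDomain Ω → ContDiffOn ℝ ∞ V Ω →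
      (NLS.Case1 f P Ω V →
        NLS.IsBasisOf ![NLS.fieldM, NLS.fieldDt] (NLS.lieAlgebra f P Ω V)) ∧
      (∀ v w : ℝ → ℝ, NLS.IsQuadratic v w Ω V →
        (∃ χ₁ χ₂ : ℝ → ℝ, NLS.IsFundamentalSystem v (NLS.times Ω) χ₁ χ₂) ∧
        ∀ χ₁ χ₂ : ℝ → ℝ, NLS.IsFundamentalSystem v (NLS.times Ω) χ₁ χ₂ →
          NLS.IsBasisOf ![NLS.fieldM, NLS.fieldG χ₁, NLS.fieldG χ₂]
            (NLS.lieAlgebra f P Ω V)) ∧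
      (NLS.Case3 Ω V →
        NLS.IsBasisOf ![NLS.fieldM, NLS.fieldDt, NLS.fieldG (fun _ => 1), NLS.fieldG (fun t => t)]
          (NLS.lieAlgebra f P Ω V)) ∧
      (NLS.Case4 Ω V →
        NLS.IsBasisOf ![NLS.fieldM, NLS.fieldDt, NLS.fieldG (fun t => Real.exp (-2 * t)),
          NLS.fieldG (fun t => Real.exp (2 * t))] (NLS.lieAlgebra f P Ω V)) ∧
      (NLS.Case5 Ω V →
        NLS.IsBasisOf ![NLS.fieldM, NLS.fieldDt, NLS.fieldG (fun t => Real.cos (2 * t)),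
          NLS.fieldG (fun t => Real.sin (2 * t))] (NLS.lieAlgebra f P Ω V))) ∧
    -- inequivalence of the potentials of the list
    (∀ (Ω Ω' : Set (ℝ × ℝ)) (V V' : ℝ × ℝ → ℂ), NLS.IsTXDomain Ω → ContDiffOn ℝ ∞ V Ω →
      NLS.PotEquiv f P Ω V Ω' V' →
      (∀ i j : Fin 5, NLS.TableCase f P i Ω V → NLS.TableCase f P j Ω' V' → i = j) ∧
      ((∀ p ∈ Ω, V p = 0) → ¬ ∀ p ∈ Ω', V' p = Complex.I) ∧
      ((∀ p ∈ Ω, V p = Complex.I) → ¬ ∀ p ∈ Ω', V' p = 0) ∧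
      (∀ s ν ν' : ℝ, (s = 1 ∨ s = -1) → NLS.IsOscillator s ν Ω V →
        NLS.IsOscillator s ν' Ω' V' →
        (ν' = ν ∨ ν' = -ν) ∧
        (NLS.StrictPotEquiv f P Ω V Ω' V' → (∃ ρ ∈ P, (f ρ).im ≠ 0) → ν' = ν))) := by
  have hF : NLS.IsNonlinearity f P := ⟨hPo, hPc, hP0, hf, hfc⟩
  refine ⟨fun Ω hΩ => hF.isBasisOf_kernelAlgebra hΩ, fun Ω V hΩ hV => hF.lieAlgebra_ne_kernel_iff hΩ hV,
    fun Ω V hΩ hV => ⟨hF.isBasisOf_case1 hΩ hV, fun v w h => ⟨?_, fun χ₁ χ₂ hχ => ?_⟩,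
      fun h => ?_, ?_, ?_⟩,
    fun Ω Ω' V V' hΩ hV h => ⟨h.tableCase_unique hF hΩ hV, fun h1 h2 => ?_, fun h1 h2 => ?_,
      fun s ν ν' hs h1 h2 => ⟨h.oscillator_parameter hF hΩ hV hs h1 h2,
        fun hst hne => hst.oscillator_parameter hF hΩ hV hne h1 h2⟩⟩⟩
  · exact NLS.exists_isFundamentalSystem hΩ.isOpen_times hΩ.ordConnected_times hΩ.nonempty_times h.1
  · exact hF.isBasisOf_isQuadratic hΩ hV h hχ
  · obtain ⟨ν, hν⟩ := h.exists_isOscillator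
    exact hF.isBasisOf_isOscillator hΩ hV hν
      (NLS.isFundamentalSystem_free hΩ.isOpen_times hΩ.nonempty_times)
  · rintro ⟨ν, hν⟩
    exact hF.isBasisOf_isOscillator hΩ hV hν
      (NLS.isFundamentalSystem_exp hΩ.isOpen_times hΩ.nonempty_times)
  · rintro ⟨ν, hν⟩
    exact hF.isBasisOf_isOscillator hΩ hV hν
      (NLS.isFundamentalSystem_trig hΩ.isOpen_times hΩ.nonempty_times)
  -- Both potentials are oscillators with s = 0, and the vanishing of ν is invariant under
  -- equivalence.
  · have := (h.eq_of_isOscillator hF hΩ hV (s := 0) (ν := 0) (s' := 0) (ν' := 1)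
      (fun p hp => by simp [h1 p hp]) (fun p hp => by simp [h2 p hp])).2
    simp at this
  · have := (h.eq_of_isOscillator hF hΩ hV (s := 0) (ν := 1) (s' := 0) (ν' := 0)
      (fun p hp => by simp [h1 p hp]) (fun p hp => by simp [h2 p hp])).2
    simp at this
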